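/- Let $d=4$. For $n\ge 1$ let $B_n=\{0,1,\dots,n-1\}^4\subset\mathbb Z^4$, with standard basis vectors $e_1,\dots,e_4$; let $E_n$ be the set of edges $(x,x+e_j)$ with both end points in $B_n$, and let $B_n'$ be the set of plaquettes, i.e. triples $(x,j,k)$ with $1\le j<k\le 4$ and $x,\ x+e_j,\ x+e_k,\ x+e_j+e_k\in B_n$. **Partition function.** Let $N\ge 1$. A configuration $U$ assigns to each edge $(x,y)\in E_n$ a matrix $U(x,y)$ in the unitary group $U(N)$, and $U(y,x):=U(x,y)^{-1}$. For a plaquette put $$U(x,j,k):=U(x,x+e_j)\,U(x+e_j,x+e_j+e_k)\,U(x+e_j+e_k,x+e_k)\,U(x+e_k,x),$$ and let $S_{B_n}(U):=\sum_{(x,j,k)\in B_n'}\Re\operatorname{Tr}(I-U(x,j,k))$. For $\epsilon,g>0$, let $$Z(n,\epsilon,g):=\int \exp\Bigl(-\frac{1}{g^2\epsilon^{4-d}}\,S_{B_n}(U)\Bigr)\,d\sigma_{B_n}(U),\qquad d=4,$$ where $\sigma_{B_n}$ is the product over $E_n$ of the normalized Haar measures on $U(N)$; this is the partition function of $U(N)$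 lattice gauge theory with coupling strength $g$ in the box $\{0,\epsilon,\dots,(n-1)\epsilon\}^4$ (the vertex $\epsilon x$ being labelled by $x\in B_n$). **The constant $K_4$.** For $t\in\mathbb R^{E_n}$ put $t(y,x):=-t(x,y)$, $$t(x,j,k):=t(x,x+e_j)+t(x+e_j,x+e_j+e_k)+t(x+e_j+e_k,x+e_k)+t(x+e_k,x),$$ and $M_n(t):=\sum_{(x,j,k)\in B_n'}t(x,j,k)^2$. Let $E_n^0\subseteq E_n$ be the set of edges $(x,x+e_j)$ with $x_k=0$ for all $k>j$, let $E_n^1:=E_n\setminus E_n^0$, and let $M_n^0$ be the restriction of $M_n$ to the functions vanishing on $E_n^0$, regarded as a quadratic form on $\mathbb R^{E_n^1}$, with $\det M_n^0$ the determinant of its symmetric matrix in the standard basis. Let $K_{n,4}:=-\dfrac{\log\det M_n^0}{2n^4}$. **Theorem.** The limit $K_4:=\lim_{n\to\infty}K_{n,4}$ exists and is finite, and for every $N\ge 1$, as $n\to\infty$, $\epsilon\to 0^+$ and $g\to 0^+$ simultaneously, with no restriction on how they are related to each other, $$\log Z(n,\epsilon,g)=n^4\biggl(\Bigl(\frac32-\frac2n+\frac1{2n^4}\Bigr)N^2\log(g^2)+3\log\biggl(\frac{\prod_{j=1}^{N-1}j!}{(2\pi)^{N/2}}\biggr)+N^2K_4\biggr)+o(n^4),$$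 where $o(n^4)$ denotes a term that tends to zero when divided by $n^4$. -/

import Mathlib

open Filter Topology MeasureTheory Asymptotics

noncomputable section

namespace LatticeGauge

/-! ### The unitary group with its normalized Haar measure -/

/-- The group `U(N)` of `N × N` complex unitary matrices. -/
abbrev UN (N : ℕ) : Type := ↥(Matrix.unitaryGroup (Fin N) ℂ)

instance instMeasurableSpaceUN (N : ℕ) : MeasurableSpace (UN N) := borel (UN N)

instance instBorelSpaceUN (N : ℕ) : BorelSpace (UN N) := ⟨rfl⟩

instance instCompactSpaceUN (N : ℕ) : CompactSpace (UN N) := by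
  have hcl : IsClosed (Matrix.unitaryGroup (Fin N) ℂ : Set (Matrix (Fin N) (Fin N) ℂ)) := by
    have h : (Matrix.unitaryGroup (Fin N) ℂ : Set (Matrix (Fin N) (Fin N) ℂ)) =
        {A | A * star A = 1} := by
      ext A
      exact Matrix.mem_unitaryGroup_iff
    rw [h]
    exact isClosed_eq (continuous_id.mul continuous_star) continuous_const
  have hb : IsCompact (Set.univ.pi fun _ : Fin N => Set.univ.pi fun _ : Fin N =>
      Metric.closedBall (0 : ℂ) 1) :=
    isCompact_univ_pi fun _ => isCompact_univ_pi fun _ => isCompact_closedBall _ _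
  refine isCompact_iff_compactSpace.mp (IsCompact.of_isClosed_subset hb hcl ?_)
  intro A hA i _ j _
  simpa using entry_norm_bound_of_unitary hA i j

/-- The Haar measure of total mass one on `U(N)`. -/
def haarUN (N : ℕ) : Measure (UN N) := Measure.haarMeasure ⊤

/-- `φ(U) = Re Tr (I - U)`. -/
def phi {N : ℕ} (U : UN N) : ℝ :=
  (Matrix.trace (1 - (U : Matrix (Fin N) (Fin N) ℂ))).re

/-! ### Edges and plaquettes of a finite subset of `ℤ^d` -/

/-- The standard basis vector `e_j` of `ℤ^d`. -/
def stdVec {d : ℕ} (j : Fin d) : Fin d → ℤ := Pi.single j 1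

/-- The positively oriented nearest-neighbour edges of `Λ`; the pair `(x, j)` stands for the
edge from `x` to `x + e_j`, both end points being in `Λ`. -/
def edges {d : ℕ} (Λ : Finset (Fin d → ℤ)) : Finset ((Fin d → ℤ) × Fin d) :=
  (Λ ×ˢ Finset.univ).filter fun e => e.1 + stdVec e.2 ∈ Λ

/-- The plaquettes `(x, j, k)`, `j < k`, with all four vertices in `Λ`. -/
def plaquettes {d : ℕ} (Λ : Finset (Fin d → ℤ)) : Finset ((Fin d → ℤ) × Fin d × Fin d) :=
  (Λ ×ˢ Finset.univ).filter fun p =>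
    p.2.1 < p.2.2 ∧ p.1 + stdVec p.2.1 ∈ Λ ∧ p.1 + stdVec p.2.2 ∈ Λ ∧
      p.1 + stdVec p.2.1 + stdVec p.2.2 ∈ Λ

/-- The box `{0, 1, …, n - 1}^d`. -/
def box (d n : ℕ) : Finset (Fin d → ℤ) :=
  Fintype.piFinset fun _ => Finset.Ico (0 : ℤ) n

/-! ### Lattice gauge theory -/

/-- A configuration, given by its values on the positively oriented edges; the value on a
reversed edge is the inverse matrix. -/
abbrev Config {d : ℕ} (N : ℕ) (Λ : Finset (Fin d → ℤ)) : Type := ↥(edges Λ) → UN N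

/-- The matrix `U(x, x + e_j)`. It is only evaluated at edges of `Λ`; the value `1` elsewhere
plays no role. -/
def Config.link {d N : ℕ} {Λ : Finset (Fin d → ℤ)} (U : Config N Λ)
    (x : Fin d → ℤ) (j : Fin d) : UN N :=
  if h : (x, j) ∈ edges Λ then U ⟨(x, j), h⟩ else 1

/-- `U(x,j,k) = U(x, x+e_j) U(x+e_j, x+e_j+e_k) U(x+e_j+e_k, x+e_k) U(x+e_k, x)`. -/
def Config.plaquette {d N : ℕ} {Λ : Finset (Fin d → ℤ)} (U : Config N Λ)
    (p : (Fin d → ℤ) × Fin d × Fin d) : UN N :=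
  U.link p.1 p.2.1 * U.link (p.1 + stdVec p.2.1) p.2.2 *
    (U.link (p.1 + stdVec p.2.2) p.2.1)⁻¹ * (U.link p.1 p.2.2)⁻¹

/-- The Wilson action `S_Λ(U)`. -/
def wilsonAction {d N : ℕ} {Λ : Finset (Fin d → ℤ)} (U : Config N Λ) : ℝ :=
  ∑ p ∈ plaquettes Λ, phi (U.plaquette p)

/-- The product Haar measure on the configurations. -/
def productHaar {d : ℕ} (N : ℕ) (Λ : Finset (Fin d → ℤ)) : Measure (Config N Λ) :=
  Measure.pi fun _ => haarUN N

/-- The partition function of `U(N)` lattice gauge theory on `Λ`, as a function of the square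
`s = g₀²` of the coupling strength. -/
def partitionFunction {d : ℕ} (N : ℕ) (Λ : Finset (Fin d → ℤ)) (s : ℝ) : ℝ :=
  ∫ U : Config N Λ, Real.exp (-(1 / s) * wilsonAction U) ∂(productHaar N Λ)

/-- The partition function `Z(n, ε, g)` of `d`-dimensional `U(N)` lattice gauge theory in the
box `{0, ε, …, (n-1)ε}^d`, whose vertices `ε x` are labelled by `x ∈ {0, …, n-1}^d`: the
squared coupling is `g² ε^{4-d}`. -/
def scaledPartitionFunction (d N n : ℕ) (ε g : ℝ) : ℝ :=
  partitionFunction N (box d n) (g ^ 2 * ε ^ ((4 : ℤ) - (d : ℤ)))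

/-! ### Lattice Maxwell theory and the constants `K_{n,d}` -/

/-- The linear functional `t ↦ t(x, x + e_j)` on `ℝ^{E}`, `E` the edges of `Λ`. It is only
used at edges of `Λ`; the value `0` elsewhere plays no role. -/
def edgeCoord {d : ℕ} (Λ : Finset (Fin d → ℤ)) (x : Fin d → ℤ) (j : Fin d) :
    (↥(edges Λ) → ℝ) →ₗ[ℝ] ℝ :=
  if h : (x, j) ∈ edges Λ then LinearMap.proj ⟨(x, j), h⟩ else 0

/-- The linear functional
`t ↦ t(x,j,k) = t(x, x+e_j) + t(x+e_j, x+e_j+e_k) + t(x+e_j+e_k, x+e_k) + t(x+e_k, x)`,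
where `t(y,x) = -t(x,y)`. -/
def plaquetteSum {d : ℕ} (Λ : Finset (Fin d → ℤ)) (p : (Fin d → ℤ) × Fin d × Fin d) :
    (↥(edges Λ) → ℝ) →ₗ[ℝ] ℝ :=
  edgeCoord Λ p.1 p.2.1 + edgeCoord Λ (p.1 + stdVec p.2.1) p.2.2
    - edgeCoord Λ (p.1 + stdVec p.2.2) p.2.1 - edgeCoord Λ p.1 p.2.2

/-- The quadratic form `M_n(t) = ∑ t(x,j,k)²` on `ℝ^{E_n}`. -/
def maxwellForm (d n : ℕ) : QuadraticForm ℝ (↥(edges (box d n)) → ℝ) :=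
  ∑ p ∈ plaquettes (box d n),
    (QuadraticMap.sq (R := ℝ) (A := ℝ)).comp (plaquetteSum (box d n) p)

/-- The edges `E_n^0`: those from `(x_1, …, x_j, 0, …, 0)` to `(x_1, …, x_j + 1, 0, …, 0)`. -/
def axialEdges (d n : ℕ) : Finset ((Fin d → ℤ) × Fin d) :=
  (edges (box d n)).filter fun e => ∀ k, e.2 < k → e.1 k = 0

/-- `E_n^1 = E_n \ E_n^0`. -/
def freeEdges (d n : ℕ) : Finset ((Fin d → ℤ) × Fin d) :=
  edges (box d n) \ axialEdges d n

/-- The identification of `ℝ^{E_n^1}` with the functions in `ℝ^{E_n}` that vanish on `E_n^0`. -/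
def extendZero (d n : ℕ) : (↥(freeEdges d n) → ℝ) →ₗ[ℝ] (↥(edges (box d n)) → ℝ) :=
  LinearMap.pi fun e =>
    if h : (e : (Fin d → ℤ) × Fin d) ∈ freeEdges d n then LinearMap.proj ⟨e, h⟩ else 0

/-- The restriction `M_n^0` of `M_n`, as a quadratic form on `ℝ^{E_n^1}`. -/
def maxwellForm0 (d n : ℕ) : QuadraticForm ℝ (↥(freeEdges d n) → ℝ) :=
  (maxwellForm d n).comp (extendZero d n)

/-- `K_{n,d} = - log det M_n^0 / (2 n^d)`, with the determinant of the matrix of `M_n^0` in the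
standard basis. -/
def maxwellConst (d n : ℕ) : ℝ :=
  -Real.log (maxwellForm0 d n).toMatrix'.det / (2 * (n : ℝ) ^ d)

end LatticeGauge

end

noncomputable section

namespace LatticeGauge

open Matrix Complex
open scoped ComplexOrder

/-! ### Hermitian matrices and the Cayley transform -/

/-! In dimension four the lattice spacing drops out, and the axial gauge leaves |E_n^1| = 3n⁴ - 4n³
+ 1 link integrals without zero modes. Each link has N² real degrees of freedom fluctuating on scale
g, so log Z should equal |E_n^1| (N²/2) log g² plus a bounded amount per site. `freeEnergy` is log Z
with that divergent term removed; the theorem says that `freeEnergy` / n⁴ tends to 3 `linkConst` +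
N² K₄ along the joint filter.

For a box of fixed side m this is Laplace's method (`tendsto_log_laplace`). In the Cayley
coordinates U = (1 + iH)(1 - iH)⁻¹ Haar measure has density proportional to |det(1 - iH)|^(-2N)
(`map_mul_cayleyMeasure`), whose total mass follows from a recursion in N
(`lintegral_cayleyDensity_succ`). Scaling H by g/2 produces in the limit a Gaussian integral with N²
independent copies of the Maxwell form. A discrete Stokes argument (`le_of_axial`) bounds every link
by the plaquettes, which gives both the domination and the positive definiteness. The limit of
`freeEnergy N m` is |E_m^1| `linkConst` + N² m⁴ K_{m,4}.

This convergence is not uniform in the size of the box, so a box of side n is compared with q⁴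
blocks of fixed side m, where q = n / m. For the upper bound (`partitionFunction_le`), every edge
outside the blocks and outside a spanning tree is given a private plaquette; all other plaquettes
outside the blocks are dropped, and these edges are integrated out one at a time. For the lower
bound (`le_partitionFunction`), the gauge is fixed along a spanning tree that restricts to the axial
tree of each block, and the plaquettes not inside a block are dominated by mass terms on the outer
edges and on the block boundaries. Both bounds have a product form. The number of outer edges is
exactly |E_n^1| - q⁴ |E_m^1| (`card_outerEdges`), so all terms in log g² cancel and only convergent
quantities of fixed size remain.

As n grows the outer edges number O(n⁴ / m), and the boundary masses change the logarithm of each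
block determinant by at most O(m³ log m) (`log_det_massiveMatrix_le`). Hence `freeEnergy` / n⁴ is
eventually within N² `blockError m` + δ of 3 `linkConst` + N² K_{m,4}, and `blockError` tends to 0.
Letting g tend to 0 at fixed n with N = 1 shows that K_{n,4} is a Cauchy sequence; letting m grow
then gives the asymptotics for all N. -/

/-- Real coordinates for Hermitian matrices. -/
abbrev Coord (N : ℕ) : Type := Fin N → Fin N → ℝ

/-- The Hermitian matrix `(a + aᵀ) / 2 + i (a - aᵀ) / 2`; the map is isometric for the Frobenius
norms. -/
def herm {N : ℕ} : Coord N →ₗ[ℝ] Matrix (Fin N) (Fin N) ℂ where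
  toFun a := Matrix.of fun i j => ((1 + I) / 2) * a i j + ((1 - I) / 2) * a j i
  map_add' a b := by ext i j; simp; ring
  map_smul' r a := by ext i j; simp; ring

/-- The coordinates of a Hermitian matrix. -/
def coordOf {N : ℕ} : Matrix (Fin N) (Fin N) ℂ →ₗ[ℝ] Coord N where
  toFun H i j := (H i j).re + (H i j).im
  map_add' a b := by ext i j; simp; ring
  map_smul' r a := by ext i j; simp; ring

theorem herm_apply {N : ℕ} (a : Coord N) (i j : Fin N) :
    herm a i j = ((1 + I) / 2) * a i j + ((1 - I) / 2) * a j i := rfl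

theorem coordOf_apply {N : ℕ} (H : Matrix (Fin N) (Fin N) ℂ) (i j : Fin N) :
    coordOf H i j = (H i j).re + (H i j).im := rfl

theorem isHermitian_herm {N : ℕ} (a : Coord N) : (herm a).IsHermitian := by
  ext i j
  apply Complex.ext <;> simp [herm_apply] <;> ring

theorem coordOf_herm {N : ℕ} (a : Coord N) : coordOf (herm a) = a := by
  ext i j
  simp [coordOf_apply, herm_apply]
  ring

theorem herm_coordOf {N : ℕ} {H : Matrix (Fin N) (Fin N) ℂ} (hH : H.IsHermitian) :
    herm (coordOf H) = H := by
  ext i j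
  have h := hH.apply i j
  rw [Complex.ext_iff] at h
  simp only [RCLike.star_def, conj_re, conj_im] at h
  rw [herm_apply, coordOf_apply, coordOf_apply]
  apply Complex.ext <;> simp <;> linarith [h.1, h.2]

/-! ### The Cayley transform and its inverse -/

section Cayley

variable {N : ℕ} {H : Matrix (Fin N) (Fin N) ℂ}

theorem conjTranspose_one_sub (hH : H.IsHermitian) : (1 - I • H)ᴴ = 1 + I • H := by
  simp [hH.eq]

theorem isUnit_det_one_sub (hH : H.IsHermitian) : IsUnit (1 - I • H).det := by
  have h : (1 - I • H)ᴴ * (1 - I • H) = 1 + Hᴴ * H := by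
    rw [conjTranspose_one_sub hH, hH.eq]
    simp only [add_mul, mul_sub, one_mul, mul_one, smul_mul_assoc, mul_smul_comm]
    rw [smul_add, smul_smul, I_mul_I, neg_one_smul]
    abel
  have hp : (1 + Hᴴ * H).PosDef := Matrix.PosDef.one.add_posSemidef (posSemidef_conjTranspose_mul_self H)
  have hd := hp.det_pos.ne'
  rw [← h, det_mul] at hd
  exact isUnit_iff_ne_zero.2 (right_ne_zero_of_mul hd)

/-- The resolvent-type matrix `(1 - iH)⁻¹`. -/
theorem inv_add_conjTranspose (hH : H.IsHermitian) :
    (1 - I • H)⁻¹ + ((1 - I • H)⁻¹)ᴴ = (2 : ℂ) • ((1 - I • H)⁻¹ * ((1 - I • H)⁻¹)ᴴ) := by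
  have hu := isUnit_det_one_sub hH
  have hu' : IsUnit ((1 - I • H)ᴴ).det := by rw [det_conjTranspose]; exact hu.star
  have h2 : (2 : ℂ) • (1 : Matrix (Fin N) (Fin N) ℂ) = (1 - I • H)ᴴ + (1 - I • H) := by
    rw [conjTranspose_one_sub hH, two_smul]; abel
  calc _ = (1 - I • H)⁻¹ * ((1 - I • H)ᴴ + (1 - I • H)) * ((1 - I • H)⁻¹)ᴴ := by
        rw [mul_add, add_mul, nonsing_inv_mul _ hu, one_mul, conjTranspose_nonsing_inv, mul_assoc,
          mul_nonsing_inv _ hu', mul_one]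
    _ = _ := by rw [← h2]; simp

/-- The Cayley transform `(1 + iH)(1 - iH)⁻¹ = 2(1 - iH)⁻¹ - 1`. -/
def cayleyMat (H : Matrix (Fin N) (Fin N) ℂ) : Matrix (Fin N) (Fin N) ℂ :=
  (2 : ℂ) • (1 - I • H)⁻¹ - 1

theorem cayleyMat_mem (hH : H.IsHermitian) : cayleyMat H ∈ unitaryGroup (Fin N) ℂ := by
  rw [mem_unitaryGroup_iff, star_eq_conjTranspose, cayleyMat]
  have h := inv_add_conjTranspose hH
  simp only [conjTranspose_sub, conjTranspose_smul, conjTranspose_one, sub_mul, mul_sub, one_mul,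
    mul_one, smul_mul_assoc, mul_smul_comm]
  have h2 : (star (2 : ℂ)) = 2 := by simp
  rw [h2, ← h]
  simp only [smul_add, smul_sub]
  abel

/-- The unitary matrix with given Hermitian Cayley coordinates. -/
def cayley (a : Coord N) : UN N := ⟨cayleyMat (herm a), cayleyMat_mem (isHermitian_herm a)⟩

theorem coe_cayley (a : Coord N) :
    (cayley a : Matrix (Fin N) (Fin N) ℂ) = (2 : ℂ) • (1 - I • herm a)⁻¹ - 1 := rfl

theorem one_add_cayley (a : Coord N) :
    1 + (cayley a : Matrix (Fin N) (Fin N) ℂ) = (2 : ℂ) • (1 - I • herm a)⁻¹ := by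
  rw [coe_cayley]; abel

/-- The inverse of the Cayley transform. -/
def unCayley (U : Matrix (Fin N) (Fin N) ℂ) : Coord N :=
  coordOf (-I • (1 - (2 : ℂ) • (1 + U)⁻¹))

variable {U : Matrix (Fin N) (Fin N) ℂ}

theorem conjTranspose_inv_one_add (hU : U ∈ unitaryGroup (Fin N) ℂ) (hd : IsUnit (1 + U).det) :
    ((1 + U)⁻¹)ᴴ = (1 + U)⁻¹ * U := by
  rw [mem_unitaryGroup_iff', star_eq_conjTranspose] at hU
  rw [conjTranspose_nonsing_inv]
  apply inv_eq_right_inv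
  have : (1 + U)ᴴ = Uᴴ * (1 + U) := by
    rw [mul_add, mul_one, hU]; simp [add_comm]
  rw [this, mul_assoc, ← mul_assoc (1 + U), mul_nonsing_inv _ hd, one_mul, hU]

/-- Unitarity gives ((1 + U)⁻¹)ᴴ = (1 + U)⁻¹U = 1 - (1 + U)⁻¹, so 1 - 2(1 + U)⁻¹ is skew-Hermitian.
-/
theorem isHermitian_unCayley (hU : U ∈ unitaryGroup (Fin N) ℂ) (hd : IsUnit (1 + U).det) :
    (-I • (1 - (2 : ℂ) • (1 + U)⁻¹)).IsHermitian := by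
  have h := conjTranspose_inv_one_add hU hd
  have h1 : (1 + U)⁻¹ * U = 1 - (1 + U)⁻¹ := by
    rw [eq_sub_iff_add_eq]
    calc _ = (1 + U)⁻¹ * (1 + U) := by rw [mul_add, mul_one]; abel
      _ = 1 := nonsing_inv_mul _ hd
  unfold Matrix.IsHermitian
  rw [conjTranspose_smul, conjTranspose_sub, conjTranspose_smul, h, h1]
  have h2 : star (2 : ℂ) = 2 := by simp
  have h3 : star (-I) = I := by simp
  rw [h2, h3, conjTranspose_one, neg_smul, ← smul_neg]
  congr 1
  rw [smul_sub, two_smul ℂ (1 : Matrix (Fin N) (Fin N) ℂ)]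
  abel

theorem herm_unCayley (hU : U ∈ unitaryGroup (Fin N) ℂ) (hd : IsUnit (1 + U).det) :
    herm (unCayley U) = -I • (1 - (2 : ℂ) • (1 + U)⁻¹) :=
  herm_coordOf (isHermitian_unCayley hU hd)

theorem one_sub_herm_unCayley (hU : U ∈ unitaryGroup (Fin N) ℂ) (hd : IsUnit (1 + U).det) :
    1 - I • herm (unCayley U) = (2 : ℂ) • (1 + U)⁻¹ := by
  rw [herm_unCayley hU hd, smul_smul]
  simp

theorem cayley_unCayley (hU : U ∈ unitaryGroup (Fin N) ℂ) (hd : IsUnit (1 + U).det) :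
    (cayley (unCayley U) : Matrix (Fin N) (Fin N) ℂ) = U := by
  rw [coe_cayley, one_sub_herm_unCayley hU hd]
  have : ((2 : ℂ) • (1 + U)⁻¹)⁻¹ = (2 : ℂ)⁻¹ • (1 + U) := by
    apply inv_eq_right_inv
    rw [smul_mul_smul_comm, nonsing_inv_mul _ hd]
    simp
  rw [this, smul_smul]
  simp

theorem isUnit_one_add_cayley (a : Coord N) :
    IsUnit (1 + (cayley a : Matrix (Fin N) (Fin N) ℂ)).det := by
  rw [one_add_cayley, det_smul]
  refine IsUnit.mul (by simp) ?_
  rw [det_nonsing_inv]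
  exact (isUnit_det_one_sub (isHermitian_herm a)).ringInverse

theorem unCayley_cayley (a : Coord N) : unCayley (cayley a : Matrix (Fin N) (Fin N) ℂ) = a := by
  have h1 : ((2 : ℂ) • (1 - I • herm a)⁻¹)⁻¹ = (2 : ℂ)⁻¹ • (1 - I • herm a) := by
    apply inv_eq_right_inv
    rw [smul_mul_smul_comm, nonsing_inv_mul _ (isUnit_det_one_sub (isHermitian_herm a))]
    simp
  rw [unCayley, one_add_cayley, h1, smul_smul]
  simp only [ne_eq, OfNat.ofNat_ne_zero, not_false_eq_true, mul_inv_cancel₀, one_smul,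
    sub_sub_cancel, smul_smul, neg_mul, I_mul_I, neg_neg]
  exact coordOf_herm a

end Cayley

/-! ### The Jacobian of `H ↦ L H R` on Hermitian matrices -/

/-- Vectorization turns Y ↦ AYB into the Kronecker product of Bᵀ and A. -/
theorem det_mul_mul {n : Type*} [Fintype n] [DecidableEq n] (A B : Matrix n n ℂ)
    (f : Matrix n n ℂ →ₗ[ℂ] Matrix n n ℂ) (hf : ∀ Y, f Y = A * Y * B) :
    LinearMap.det f = A.det ^ Fintype.card n * B.det ^ Fintype.card n := by
  let e : Matrix n n ℂ ≃ₗ[ℂ] (n × n → ℂ) :=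
    { toFun := vec, invFun := fun v => Matrix.of fun i j => v (j, i)
      map_add' := fun _ _ => rfl, map_smul' := fun _ _ => rfl
      left_inv := fun _ => rfl, right_inv := fun _ => rfl }
  have h : (e : Matrix n n ℂ →ₗ[ℂ] _) ∘ₗ f ∘ₗ (e.symm : (n × n → ℂ) →ₗ[ℂ] _) =
      toLin' (kroneckerMap (fun x y => x * y) Bᵀ A) := by
    apply LinearMap.ext
    intro v
    obtain ⟨X, rfl⟩ := e.surjective v
    simp only [LinearMap.coe_comp, LinearEquiv.coe_coe, Function.comp_apply,
      LinearEquiv.symm_apply_apply, toLin'_apply, hf]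
    change vec (A * X * B) = kroneckerMap (fun x y => x * y) Bᵀ A *ᵥ vec X
    rw [kronecker_mulVec_vec, transpose_transpose]
  rw [← LinearMap.det_conj f e, h, LinearMap.det_toLin', det_kronecker, det_transpose, mul_comm]

/-- The complex-linear extension of `herm`. -/
def hermC {N : ℕ} : Matrix (Fin N) (Fin N) ℂ ≃ₗ[ℂ] Matrix (Fin N) (Fin N) ℂ where
  toFun A := ((1 + I) / 2) • A + ((1 - I) / 2) • Aᵀ
  invFun A := ((1 - I) / 2) • A + ((1 + I) / 2) • Aᵀ
  map_add' A B := by rw [transpose_add, smul_add, smul_add]; abel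
  map_smul' r A := by
    rw [transpose_smul, RingHom.id_apply, smul_add, smul_comm r, smul_comm r]
  left_inv A := by
    ext i j
    simp
    linear_combination (A j i / 2 - A i j / 2) * I_sq
  right_inv A := by
    ext i j
    simp
    linear_combination (A j i / 2 - A i j / 2) * I_sq

theorem hermC_map {N : ℕ} (a : Coord N) :
    hermC ((Matrix.of a).map ofRealHom) = herm a := by
  ext i j
  simp [hermC, herm_apply]

/-- The Hermitian matrices are a real form of all matrices: the real matrix of T, read over ℂ, is
that of Y ↦ AYB conjugated by `hermC`, so the two determinants agree. -/
theorem det_coordOf_mul_mul {N : ℕ} (A B : Matrix (Fin N) (Fin N) ℂ)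
    (hAB : ∀ a : Coord N, (A * herm a * B).IsHermitian) (T : Coord N →ₗ[ℝ] Coord N)
    (hT : ∀ a, T a = coordOf (A * herm a * B)) :
    |LinearMap.det T| = (‖A.det‖ * ‖B.det‖) ^ N := by
  let f : Matrix (Fin N) (Fin N) ℂ →ₗ[ℂ] Matrix (Fin N) (Fin N) ℂ :=
    LinearMap.mulLeft ℂ A ∘ₗ LinearMap.mulRight ℂ B
  have hf : ∀ Y, f Y = A * Y * B := fun Y => by simp [f, mul_assoc]
  have h1 : ofRealHom (LinearMap.det T) =
      LinearMap.det ((hermC.symm : Matrix (Fin N) (Fin N) ℂ ≃ₗ[ℂ] _).toLinearMap ∘ₗ f ∘ₗ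
        (hermC.symm.symm : Matrix (Fin N) (Fin N) ℂ ≃ₗ[ℂ] _).toLinearMap) := by
    let b : Module.Basis (Fin N × Fin N) ℝ (Coord N) :=
      (Matrix.stdBasis ℝ (Fin N) (Fin N)).map (Matrix.ofLinearEquiv ℝ).symm
    rw [← LinearMap.det_toMatrix b, ← LinearMap.det_toMatrix (Matrix.stdBasis ℂ (Fin N) (Fin N)),
      RingHom.map_det]
    congr 1
    ext p q
    rw [RingHom.mapMatrix_apply, Matrix.map_apply, LinearMap.toMatrix_apply,
      LinearMap.toMatrix_apply]
    have hq : (Matrix.stdBasis ℂ (Fin N) (Fin N)) q = (Matrix.of (b q)).map ofRealHom := by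
      obtain ⟨i, j⟩ := q
      ext k l
      change _ = ofRealHom (Matrix.stdBasis ℝ (Fin N) (Fin N) (i, j) k l)
      rw [Matrix.stdBasis_eq_single, Matrix.stdBasis_eq_single, Matrix.single_apply,
        Matrix.single_apply]
      split_ifs <;> simp
    have key : ∀ a : Coord N, hermC.symm (f (hermC ((Matrix.of a).map ofRealHom))) =
        (Matrix.of (T a)).map ofRealHom := by
      intro a
      rw [hermC_map, LinearEquiv.symm_apply_eq, hermC_map, hT, hf, herm_coordOf (hAB a)]
    simp only [LinearMap.coe_comp, Function.comp_apply, LinearEquiv.coe_coe, LinearEquiv.symm_symm]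
    rw [hq, key]
    rfl
  rw [LinearMap.det_conj, det_mul_mul A B f hf] at h1
  have h2 := congrArg norm h1
  simpa [mul_pow] using h2

/-! ### Haar measure in Cayley coordinates -/

section Jacobian

theorem continuousAt_matrix_inv {X : Type*} [TopologicalSpace X] {n : Type*} [Fintype n]
    [DecidableEq n] {f : X → Matrix n n ℂ} {x : X} (hf : ContinuousAt f x)
    (hu : IsUnit (f x).det) : ContinuousAt (fun y => (f y)⁻¹) x := by
  simp only [Matrix.inv_def, Ring.inverse_eq_inv']
  have h1 : ContinuousAt (fun y => (f y).det) x :=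
    (Continuous.matrix_det continuous_id).continuousAt.comp hf
  have h2 : ContinuousAt (fun y => (f y).adjugate) x :=
    (Continuous.matrix_adjugate continuous_id).continuousAt.comp hf
  exact (h1.inv₀ hu.ne_zero).smul h2

/-- Carathéodory's form of differentiability. It suits rational matrix maps, whose increments factor
exactly by the resolvent identity. -/
theorem hasFDerivAt_of_sub_eq {E F : Type*} [NormedAddCommGroup E] [NormedSpace ℝ E]
    [NormedAddCommGroup F] [NormedSpace ℝ F] {f : E → F} {G : E → E →L[ℝ] F} {s : Set E} {a : E}
    (hs : s ∈ 𝓝 a) (hG : ContinuousAt G a) (h : ∀ b ∈ s, f b - f a = G b (b - a)) :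
    HasFDerivAt f (G a) a := by
  rw [hasFDerivAt_iff_isLittleO, Asymptotics.isLittleO_iff]
  intro c hc
  have h1 : ∀ᶠ b in 𝓝 a, ‖G b - G a‖ < c := by
    have := Metric.continuousAt_iff'.1 hG c hc
    simpa only [dist_eq_norm] using this
  filter_upwards [h1, hs] with b hb hbs
  rw [h b hbs, ← _root_.sub_apply]
  exact ((G b - G a).le_opNorm _).trans (by gcongr)

variable {N : ℕ}

theorem continuous_herm : Continuous (herm : Coord N → Matrix (Fin N) (Fin N) ℂ) := by
  refine continuous_matrix fun i j => ?_
  simp only [herm_apply]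
  fun_prop

theorem continuous_coordOf : Continuous (coordOf : Matrix (Fin N) (Fin N) ℂ → Coord N) := by
  refine continuous_pi fun i => continuous_pi fun j => ?_
  simp only [coordOf_apply]
  exact (continuous_re.comp (continuous_id.matrix_elem i j)).add
    (continuous_im.comp (continuous_id.matrix_elem i j))

theorem continuous_inv_one_sub_herm :
    Continuous fun a : Coord N => (1 - I • herm a)⁻¹ :=
  continuous_iff_continuousAt.2 fun a => continuousAt_matrix_inv
    (continuous_const.sub (continuous_herm.const_smul I)).continuousAt
    (isUnit_det_one_sub (isHermitian_herm a))

theorem continuous_cayley : Continuous (cayley : Coord N → UN N) :=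
  Continuous.subtype_mk ((continuous_inv_one_sub_herm.const_smul (2 : ℂ)).sub continuous_const) _

theorem continuous_mul_cayley (V : UN N) :
    Continuous fun a : Coord N => 1 + (V * cayley a : Matrix (Fin N) (Fin N) ℂ) :=
  continuous_const.add (continuous_const.mul (continuous_subtype_val.comp continuous_cayley))

/-- The right factor in the differential of left multiplication in Cayley coordinates. -/
def rightFactor (V : UN N) (a : Coord N) : Matrix (Fin N) (Fin N) ℂ :=
  (2 : ℂ) • ((1 - I • herm a)⁻¹ * (1 + (V * cayley a : Matrix (Fin N) (Fin N) ℂ))⁻¹)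

/-- Left multiplication by `V` in Cayley coordinates. -/
def cayleyMul (V : UN N) (a : Coord N) : Coord N :=
  unCayley (V * cayley a : Matrix (Fin N) (Fin N) ℂ)

/-- The coordinates for which `V * cayley a` has Cayley coordinates. -/
def cayleyDomain (V : UN N) : Set (Coord N) :=
  {a | IsUnit (1 + (V * cayley a : Matrix (Fin N) (Fin N) ℂ)).det}

theorem coe_mul_cayley_mem (V : UN N) (a : Coord N) :
    (V * cayley a : Matrix (Fin N) (Fin N) ℂ) ∈ unitaryGroup (Fin N) ℂ := (V * cayley a).2

theorem conjTranspose_rightFactor {V : UN N} {a : Coord N} (ha : a ∈ cayleyDomain V) :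
    (rightFactor V a)ᴴ = (2 : ℂ) •
      ((1 + (V * cayley a : Matrix (Fin N) (Fin N) ℂ))⁻¹ * V * (1 - I • herm a)⁻¹) := by
  have h := inv_add_conjTranspose (isHermitian_herm a)
  have h2 : star (2 : ℂ) = 2 := by simp
  rw [rightFactor, conjTranspose_smul, conjTranspose_mul,
    conjTranspose_inv_one_add (coe_mul_cayley_mem V a) ha, h2]
  congr 1
  simp only [mul_assoc]
  congr 2
  rw [coe_cayley, sub_mul, one_mul, smul_mul_assoc, ← h]
  abel

theorem isOpen_cayleyDomain (V : UN N) : IsOpen (cayleyDomain V) := by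
  simp only [cayleyDomain, isUnit_iff_ne_zero]
  exact isOpen_ne_fun (continuous_mul_cayley V).matrix_det continuous_const

/-- The map `b ↦ A b B` on Hermitian matrices, in coordinates. -/
def coordMul (A B : Matrix (Fin N) (Fin N) ℂ) : Coord N →ₗ[ℝ] Coord N where
  toFun b := coordOf (A * herm b * B)
  map_add' b c := by simp [mul_add, add_mul]
  map_smul' r b := by simp

theorem inv_sub_inv_matrix {A B : Matrix (Fin N) (Fin N) ℂ} (hA : IsUnit A.det)
    (hB : IsUnit B.det) : B⁻¹ - A⁻¹ = B⁻¹ * (A - B) * A⁻¹ := by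
  rw [mul_sub, sub_mul, nonsing_inv_mul _ hB, one_mul, mul_assoc, mul_nonsing_inv _ hA, mul_one]

/-- The resolvent identity is used twice, for (1 + VU)⁻¹ and for (1 - iH)⁻¹. The increment is then
exactly a two-sided product, and at b = a its outer factors are adjoint to each other. -/
theorem cayleyMul_sub {V : UN N} {a b : Coord N} (ha : a ∈ cayleyDomain V)
    (hb : b ∈ cayleyDomain V) :
    cayleyMul V b - cayleyMul V a = coordMul ((rightFactor V b)ᴴ) (rightFactor V a) (b - a) := by
  have h1 := inv_sub_inv_matrix (isUnit_det_one_sub (isHermitian_herm a))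
    (isUnit_det_one_sub (isHermitian_herm b))
  have h2 := inv_sub_inv_matrix ha hb
  have h3 : (1 - I • herm a) - (1 - I • herm b) = I • herm (b - a) := by
    rw [map_sub, smul_sub]; abel
  have h4 : (1 + (V * cayley a : Matrix (Fin N) (Fin N) ℂ)) -
      (1 + (V * cayley b : Matrix (Fin N) (Fin N) ℂ)) =
      -((2 : ℂ) • (V * ((1 - I • herm b)⁻¹ - (1 - I • herm a)⁻¹) : Matrix (Fin N) (Fin N) ℂ)) := by
    rw [coe_cayley, coe_cayley, add_sub_add_left_eq_sub, ← mul_sub, sub_sub_sub_cancel_right,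
      ← smul_sub, mul_smul_comm, ← smul_neg, ← mul_neg, neg_sub]
  rw [cayleyMul, cayleyMul, unCayley, unCayley, ← map_sub]
  change coordOf _ = coordOf _
  congr 1
  rw [← smul_sub, sub_sub_sub_cancel_left, ← smul_sub, ← neg_sub, h2, h4, h1, h3,
    conjTranspose_rightFactor hb, rightFactor]
  simp only [smul_mul_assoc, mul_smul_comm, mul_neg, neg_mul, neg_neg, neg_smul,
    smul_smul, mul_assoc]
  rw [← neg_smul]
  congr 1
  linear_combination (-4) * I_sq

theorem hasFDerivAt_cayleyMul {V : UN N} {a : Coord N} (ha : a ∈ cayleyDomain V) :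
    HasFDerivAt (cayleyMul V) (LinearMap.toContinuousLinearMap
      (coordMul ((rightFactor V a)ᴴ) (rightFactor V a))) a := by
  refine hasFDerivAt_of_sub_eq (G := fun b => LinearMap.toContinuousLinearMap
      (coordMul ((rightFactor V b)ᴴ) (rightFactor V a))) ((isOpen_cayleyDomain V).mem_nhds ha) ?_
      fun b hb => cayleyMul_sub ha hb
  rw [continuousAt_clm_apply]
  intro y
  have hR : ContinuousAt (rightFactor V) a := by
    have h1 := continuousAt_matrix_inv (continuous_mul_cayley V).continuousAt ha
    exact (continuous_inv_one_sub_herm.continuousAt.mul h1).const_smul (2 : ℂ)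
  refine continuous_coordOf.continuousAt.comp
    (f := fun b => (rightFactor V b)ᴴ * herm y * rightFactor V a) ?_
  have hR' : ContinuousAt (fun b => (rightFactor V b)ᴴ) a :=
    (Continuous.matrix_conjTranspose continuous_id).continuousAt.comp hR
  exact (hR'.mul continuousAt_const).mul continuousAt_const

theorem abs_det_coordMul (R : Matrix (Fin N) (Fin N) ℂ) :
    |(LinearMap.toContinuousLinearMap (coordMul Rᴴ R)).det| = ‖R.det‖ ^ (2 * N) := by
  have := det_coordOf_mul_mul Rᴴ R
    (fun b => isHermitian_conjTranspose_mul_mul _ (isHermitian_herm b)) (coordMul Rᴴ R)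
    (fun b => rfl)
  rw [ContinuousLinearMap.det, LinearMap.coe_toContinuousLinearMap, this, det_conjTranspose,
    norm_star, ← sq, pow_mul]

/-- The density of Haar measure in Cayley coordinates, up to normalization. -/
def cayleyDensity (a : Coord N) : ℝ := (‖(1 - I • herm a).det‖ ^ (2 * N))⁻¹

/-- With R = 2(1 - iH)⁻¹(1 + VU)⁻¹ the Jacobian is |det R|^(2N), while the new coordinates H'
satisfy 1 - iH' = 2(1 + VU)⁻¹. The factors containing 1 + VU cancel, which is the infinitesimal form
of left invariance. -/
theorem cayleyMul_jacobian {V : UN N} {a : Coord N} (ha : a ∈ cayleyDomain V) :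
    |(LinearMap.toContinuousLinearMap (coordMul ((rightFactor V a)ᴴ) (rightFactor V a))).det| *
        cayleyDensity (cayleyMul V a) =
      cayleyDensity a := by
  rw [abs_det_coordMul, cayleyDensity, cayleyDensity, cayleyMul,
    one_sub_herm_unCayley (coe_mul_cayley_mem V a) ha, rightFactor]
  have h1 := (isUnit_det_one_sub (isHermitian_herm a)).ne_zero
  have h2 : (1 + (V * cayley a : Matrix (Fin N) (Fin N) ℂ)).det ≠ 0 := IsUnit.ne_zero ha
  simp only [det_smul, det_mul, det_nonsing_inv, Ring.inverse_eq_inv', norm_mul, norm_inv, mul_pow,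
    norm_pow, mul_inv, inv_inv, inv_pow]
  have h3 : ‖(1 - I • herm a).det‖ ≠ 0 := norm_ne_zero_iff.2 h1
  have h4 : ‖(1 + (V * cayley a : Matrix (Fin N) (Fin N) ℂ)).det‖ ≠ 0 := norm_ne_zero_iff.2 h2
  have h5 : ‖(2 : ℂ)‖ ≠ 0 := by simp
  field_simp

end Jacobian

instance instSecondCountableMatrix {N : ℕ} :
    SecondCountableTopology (Matrix (Fin N) (Fin N) ℂ) :=
  inferInstanceAs (SecondCountableTopology (Fin N → Fin N → ℂ))

instance instSecondCountableUN (N : ℕ) : SecondCountableTopology (UN N) :=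
  Topology.IsEmbedding.subtypeVal.secondCountableTopology

/-! ### Left invariance of the Cayley measure -/

section Invariance

variable {N : ℕ}

theorem cayleyDensity_nonneg (a : Coord N) : 0 ≤ cayleyDensity a := by
  unfold cayleyDensity; positivity

theorem continuous_cayleyDensity : Continuous (cayleyDensity : Coord N → ℝ) := by
  unfold cayleyDensity
  refine Continuous.inv₀ (Continuous.pow (Continuous.norm ?_) _) fun a => ?_
  · exact (continuous_const.sub (continuous_herm.const_smul I)).matrix_det
  · exact pow_ne_zero _ (norm_ne_zero_iff.2 (isUnit_det_one_sub (isHermitian_herm a)).ne_zero)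

/-- The image of the unnormalized density under the Cayley transform. -/
def cayleyMeasure (N : ℕ) : Measure (UN N) :=
  ((volume : Measure (Coord N)).withDensity fun a => ENNReal.ofReal (cayleyDensity a)).map cayley

theorem measurable_ofReal_cayleyDensity :
    Measurable fun a : Coord N => ENNReal.ofReal (cayleyDensity a) :=
  ENNReal.measurable_ofReal.comp continuous_cayleyDensity.measurable

theorem lintegral_cayleyMeasure {f : UN N → ENNReal} (hf : Measurable f) :
    ∫⁻ U, f U ∂(cayleyMeasure N) =
      ∫⁻ a, ENNReal.ofReal (cayleyDensity a) * f (cayley a) := by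
  rw [cayleyMeasure, lintegral_map hf continuous_cayley.measurable]
  exact lintegral_withDensity_eq_lintegral_mul _ measurable_ofReal_cayleyDensity
      (hf.comp continuous_cayley.measurable)

theorem cayley_cayleyMul {V : UN N} {a : Coord N} (ha : a ∈ cayleyDomain V) :
    cayley (cayleyMul V a) = V * cayley a :=
  Subtype.ext (cayley_unCayley (coe_mul_cayley_mem V a) ha)

theorem cayleyMul_mem {V : UN N} {a : Coord N} (ha : a ∈ cayleyDomain V) :
    cayleyMul V a ∈ cayleyDomain V⁻¹ := by
  change IsUnit (1 + ((V⁻¹ * cayley (cayleyMul V a) : UN N) : Matrix (Fin N) (Fin N) ℂ)).det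
  rw [cayley_cayleyMul ha, inv_mul_cancel_left]
  exact isUnit_one_add_cayley a

theorem cayleyMul_inv_cayleyMul {V : UN N} {a : Coord N} (ha : a ∈ cayleyDomain V) :
    cayleyMul V⁻¹ (cayleyMul V a) = a := by
  have : ((V⁻¹ * cayley (cayleyMul V a) : UN N) : Matrix (Fin N) (Fin N) ℂ) = cayley a := by
    rw [cayley_cayleyMul ha, inv_mul_cancel_left]
  change unCayley ((V⁻¹ * cayley (cayleyMul V a) : UN N) : Matrix (Fin N) (Fin N) ℂ) = a
  rw [this, unCayley_cayley]

theorem image_cayleyMul (V : UN N) : cayleyMul V '' cayleyDomain V = cayleyDomain V⁻¹ := by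
  ext b
  constructor
  · rintro ⟨a, ha, rfl⟩
    exact cayleyMul_mem ha
  · intro hb
    refine ⟨cayleyMul V⁻¹ b, ?_, ?_⟩
    · simpa using cayleyMul_mem hb
    · simpa using cayleyMul_inv_cayleyMul hb

theorem lintegral_cayleyMul (V : UN N) (g : UN N → ENNReal) :
    ∫⁻ a in cayleyDomain V⁻¹, ENNReal.ofReal (cayleyDensity a) * g (cayley a) =
      ∫⁻ a in cayleyDomain V, ENNReal.ofReal (cayleyDensity a) * g (V * cayley a) := by
  have hm := (isOpen_cayleyDomain V).measurableSet
  rw [← image_cayleyMul, lintegral_image_eq_lintegral_abs_det_fderiv_mul volume hm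
    (fun a ha => (hasFDerivAt_cayleyMul ha).hasFDerivWithinAt)
    (fun a ha b hb hab => by
      rw [← cayleyMul_inv_cayleyMul ha, hab, cayleyMul_inv_cayleyMul hb])]
  refine setLIntegral_congr_fun hm fun a ha => ?_
  rw [cayley_cayleyMul ha, ← mul_assoc, ← ENNReal.ofReal_mul (abs_nonneg _), cayleyMul_jacobian ha]

/-- The unitary matrices `U` for which `V * U` has no Cayley coordinates. -/
def badSet (V : UN N) : Set (UN N) :=
  {U | ¬ IsUnit (1 + ((V * U : UN N) : Matrix (Fin N) (Fin N) ℂ)).det}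

theorem isClosed_badSet (V : UN N) : IsClosed (badSet V) := by
  simp only [badSet, isUnit_iff_ne_zero, not_not]
  refine isClosed_eq (Continuous.matrix_det ?_) continuous_const
  exact continuous_const.add (continuous_subtype_val.comp (continuous_const.mul continuous_id))

theorem lintegral_cayleyDomain {V : UN N} (hV : cayleyMeasure N (badSet V) = 0)
    {g : UN N → ENNReal} (hg : Measurable g) :
    ∫⁻ a in cayleyDomain V, ENNReal.ofReal (cayleyDensity a) * g (cayley a) =
      ∫⁻ U, g U ∂(cayleyMeasure N) := by
  have h1 : ∀ a, a ∈ cayleyDomain V ↔ cayley a ∈ (badSet V)ᶜ := fun a => by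
    simp [cayleyDomain, badSet]
  rw [← lintegral_indicator (isOpen_cayleyDomain V).measurableSet]
  have h2 : ∀ᵐ U ∂(cayleyMeasure N), U ∈ (badSet V)ᶜ := measure_eq_zero_iff_ae_notMem.1 hV
  calc _ = ∫⁻ a, ENNReal.ofReal (cayleyDensity a) * ((badSet V)ᶜ.indicator g) (cayley a) := by
        refine lintegral_congr fun a => ?_
        by_cases ha : a ∈ cayleyDomain V
        · rw [Set.indicator_of_mem ha, Set.indicator_of_mem ((h1 a).1 ha)]
        · rw [Set.indicator_of_notMem ha, Set.indicator_of_notMem (fun h => ha ((h1 a).2 h)),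
            mul_zero]
    _ = ∫⁻ U, (badSet V)ᶜ.indicator g U ∂(cayleyMeasure N) :=
        (lintegral_cayleyMeasure (hg.indicator (isClosed_badSet V).measurableSet.compl)).symm
    _ = _ := by
        refine lintegral_congr_ae ?_
        filter_upwards [h2] with U hU
        rw [Set.indicator_of_mem hU]

theorem map_mul_cayleyMeasure_of_null {V : UN N} (hV : cayleyMeasure N (badSet V) = 0)
    (hV' : cayleyMeasure N (badSet V⁻¹) = 0) :
    (cayleyMeasure N).map (V * ·) = cayleyMeasure N := by
  have hmul : Measurable (V * · : UN N → UN N) := (continuous_const.mul continuous_id).measurable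
  refine Measure.ext_of_lintegral _ fun f hf => ?_
  rw [lintegral_map hf hmul, ← lintegral_cayleyDomain hV' hf, lintegral_cayleyMul]
  exact (lintegral_cayleyDomain hV (hf.comp hmul)).symm

/-- The scalar unitary matrix `(1 + is) / (1 - is)`. -/
def phase (N : ℕ) (s : ℝ) : UN N :=
  ⟨((1 + s * I) / (1 - s * I)) • 1, by
    have h1 : (1 - s * I : ℂ) ≠ 0 := fun h => by simpa using congrArg re h
    have h2 : (1 + s * I : ℂ) ≠ 0 := fun h => by simpa using congrArg re h
    rw [mem_unitaryGroup_iff]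
    simp only [star_smul, star_one, smul_mul_smul_comm, mul_one]
    have : (1 + s * I) / (1 - s * I) * star ((1 + s * I) / (1 - s * I)) = 1 := by
      simp only [RCLike.star_def, map_div₀, map_add, map_sub, map_mul, map_one, conj_ofReal, conj_I]
      rw [show (1 + s * -I : ℂ) = 1 - s * I by ring, show (1 - s * -I : ℂ) = 1 + s * I by ring]
      field_simp
    rw [this, one_smul]⟩

/-- The product of the phase with U has eigenvalue -1 only if -(1 - is)/(1 + is) is an eigenvalue of
U, and this number determines s. -/
theorem finite_phase_bad (U : UN N) : {s : ℝ | U ∈ badSet (phase N s)}.Finite := by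
  have h1 (s : ℝ) : (1 - s * I : ℂ) ≠ 0 := fun h => by simpa using congrArg re h
  have h2 (s : ℝ) : (1 + s * I : ℂ) ≠ 0 := fun h => by simpa using congrArg re h
  have hfin := Polynomial.finite_setOfPred_isRoot
    (Matrix.charpoly_monic (U : Matrix (Fin N) (Fin N) ℂ)).ne_zero
  refine (hfin.preimage (f := fun s : ℝ => -((1 - s * I) / (1 + s * I)) ) ?_).subset ?_
  · intro s _ t _ hst
    simp only [neg_inj] at hst
    rw [div_eq_div_iff (h2 s) (h2 t)] at hst
    have := congrArg im hst
    simp at this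
    linarith
  · intro s hs
    simp only [badSet, Set.mem_ofPred_eq, isUnit_iff_ne_zero, not_not] at hs
    simp only [Set.mem_preimage, Set.mem_ofPred_eq, Polynomial.IsRoot, Matrix.eval_charpoly]
    have : 1 + ((phase N s * U : UN N) : Matrix (Fin N) (Fin N) ℂ) =
        (-((1 + s * I) / (1 - s * I))) • (Matrix.scalar (Fin N) (-((1 - s * I) / (1 + s * I))) - U.1) := by
      rw [smul_sub, Matrix.scalar_apply, ← Matrix.smul_one_eq_diagonal, smul_smul, neg_mul_neg,
        div_mul_div_cancel₀ (h1 s), div_self (h2 s), one_smul, neg_smul, sub_neg_eq_add]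
      change 1 + (((1 + s * I) / (1 - s * I)) • (1 : Matrix (Fin N) (Fin N) ℂ)) * U.1 = _
      rw [smul_mul_assoc, one_mul]
    rw [this, det_smul] at hs
    exact (mul_eq_zero.1 hs).resolve_left
      (pow_ne_zero _ (neg_ne_zero.2 (div_ne_zero (h2 s) (h1 s))))

theorem continuous_phase : Continuous (phase N) := by
  have h : Continuous fun s : ℝ => (1 + s * I) / (1 - s * I) :=
    Continuous.div (by fun_prop) (by fun_prop) fun s h => by simpa using congrArg re h
  exact Continuous.subtype_mk (h.smul continuous_const) _

theorem phase_comm (s : ℝ) (V : UN N) : phase N s * V = V * phase N s := by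
  apply Subtype.ext
  change (_ • (1 : Matrix (Fin N) (Fin N) ℂ)) * V.1 = V.1 * (_ • (1 : Matrix (Fin N) (Fin N) ℂ))
  rw [smul_mul_assoc, mul_smul_comm, one_mul, mul_one]

theorem phase_inv (s : ℝ) : (phase N s)⁻¹ = phase N (-s) := by
  rw [inv_eq_iff_mul_eq_one]
  apply Subtype.ext
  have h1 : (1 - s * I : ℂ) ≠ 0 := fun h => by simpa using congrArg re h
  have h2 : (1 + s * I : ℂ) ≠ 0 := fun h => by simpa using congrArg re h
  change (((1 + s * I) / (1 - s * I)) • (1 : Matrix (Fin N) (Fin N) ℂ)) *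
    (((1 + (-s : ℝ) * I) / (1 - (-s : ℝ) * I)) • (1 : Matrix (Fin N) (Fin N) ℂ)) = 1
  rw [smul_mul_smul_comm, mul_one, ofReal_neg, neg_mul, sub_neg_eq_add, ← sub_eq_add_neg,
    div_mul_div_cancel₀ h1, div_self h2, one_smul]

/-- By Fubini: for each fixed U only finitely many s are bad, so for almost every s the bad U form a
null set. This replaces a direct proof that the bad set of a given V is null. -/
theorem ae_phase_null [IsFiniteMeasure (cayleyMeasure N)] (V : UN N) :
    ∀ᵐ s : ℝ, cayleyMeasure N (badSet (phase N s * V)) = 0 := by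
  have hm : MeasurableSet {x : ℝ × UN N | x.2 ∉ badSet (phase N x.1 * V)} := by
    apply IsOpen.measurableSet
    simp only [badSet, Set.mem_ofPred_eq, not_not, isUnit_iff_ne_zero]
    refine isOpen_ne_fun (Continuous.matrix_det ?_) continuous_const
    refine continuous_const.add (continuous_subtype_val.comp ?_)
    exact ((continuous_phase.comp continuous_fst).mul continuous_const).mul continuous_snd
  have h := (Measure.ae_ae_comm (μ := (volume : Measure ℝ)) (ν := cayleyMeasure N)
    (p := fun s U => U ∉ badSet (phase N s * V)) hm).2 (ae_of_all _ fun U => by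
      refine measure_eq_zero_iff_ae_notMem (s := {s : ℝ | U ∈ badSet (phase N s * V)}).1 ?_
      refine Set.Finite.measure_zero ((finite_phase_bad (V * U)).subset fun s hs => ?_) _
      simpa only [badSet, Set.mem_ofPred_eq, mul_assoc] using hs)
  filter_upwards [h] with s hs
  exact measure_eq_zero_iff_ae_notMem.2 hs

/-- Writing V as a phase times the inverse phase times V splits the translation into two
translations whose bad sets are null for a generic phase. -/
theorem map_mul_cayleyMeasure [IsFiniteMeasure (cayleyMeasure N)] (V : UN N) :
    (cayleyMeasure N).map (V * ·) = cayleyMeasure N := by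
  have hneg (W : UN N) : ∀ᵐ s : ℝ, cayleyMeasure N (badSet (phase N (-s) * W)) = 0 :=
    (Measure.measurePreserving_neg (volume : Measure ℝ)).quasiMeasurePreserving.ae
      (ae_phase_null W)
  -- Each of the two translations needs a null bad set for itself and for its inverse, which makes
  -- four conditions on s.
  obtain ⟨s, h1, h2, h3, h4⟩ := ((ae_phase_null V).and ((hneg V⁻¹).and
    ((ae_phase_null (1 : UN N)).and (hneg 1)))).exists
  rw [mul_one] at h3 h4
  have hA := map_mul_cayleyMeasure_of_null h1
    (by rw [_root_.mul_inv_rev, phase_inv, ← phase_comm]; exact h2)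
  have hB := map_mul_cayleyMeasure_of_null h4 (by rw [phase_inv, neg_neg]; exact h3)
  have hmul (W : UN N) : Measurable (W * · : UN N → UN N) :=
    (continuous_const.mul continuous_id).measurable
  calc _ = ((cayleyMeasure N).map (phase N s * V * ·)).map (phase N (-s) * ·) := by
        rw [Measure.map_map (hmul _) (hmul _)]
        congr 1
        funext U
        simp only [Function.comp_apply]
        rw [← mul_assoc, ← mul_assoc, ← phase_inv, inv_mul_cancel, one_mul]
    _ = _ := by rw [hA, hB]

theorem cayleyMeasure_eq_smul_haarUN [IsFiniteMeasure (cayleyMeasure N)] :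
    cayleyMeasure N = cayleyMeasure N Set.univ • haarUN N := by
  have : (cayleyMeasure N).IsMulLeftInvariant := ⟨map_mul_cayleyMeasure⟩
  exact Measure.haarMeasure_unique (cayleyMeasure N) ⊤

end Invariance

/-! ### The normalization of the Haar density -/

theorem lintegral_rpow_mul_exp {k A : ℝ} (hk : 0 < k) (hA : 0 < A) :
    ∫⁻ t in Set.Ioi (0 : ℝ), ENNReal.ofReal (t ^ (k - 1) * Real.exp (-(A * t))) =
      ENNReal.ofReal ((1 / A) ^ k * Real.Gamma k) := by
  have h := Real.integral_rpow_mul_exp_neg_mul_Ioi hk hA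
  rw [← h, ofReal_integral_eq_lintegral_ofReal]
  · refine Integrable.of_integral_ne_zero ?_
    rw [h]
    have := Real.Gamma_pos_of_pos hk
    positivity
  · refine (ae_restrict_iff' measurableSet_Ioi).2 (ae_of_all _ fun t ht => ?_)
    have : (0 : ℝ) < t := ht
    positivity

/-- Subordination: (A + Q)^(-k) is a Gamma integral of e^(-t(A + Q)) over t, and Tonelli reduces the
claim to the given Gaussian integrals. -/
theorem lintegral_inv_rpow_of_gaussian {E : Type*} [MeasurableSpace E] (μ : Measure E) [SFinite μ]
    {Q : E → ℝ} (hQm : Measurable Q) (hQ : ∀ x, 0 ≤ Q x) {C p : ℝ} (hC : 0 ≤ C)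
    (hg : ∀ t : ℝ, 0 < t → ∫⁻ x, ENNReal.ofReal (Real.exp (-(t * Q x))) ∂μ =
      ENNReal.ofReal (C * t ^ (-p)))
    {k A : ℝ} (hk : 0 < k) (hkp : p < k) (hA : 0 < A) :
    ∫⁻ x, ENNReal.ofReal ((1 / (A + Q x)) ^ k) ∂μ =
      ENNReal.ofReal (C * (1 / A) ^ (k - p) * Real.Gamma (k - p) / Real.Gamma k) := by
  have hG := Real.Gamma_pos_of_pos hk
  have h1 : ∀ x, ENNReal.ofReal ((1 / (A + Q x)) ^ k) = ENNReal.ofReal (Real.Gamma k)⁻¹ *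
      ∫⁻ t in Set.Ioi (0 : ℝ), ENNReal.ofReal (t ^ (k - 1) * Real.exp (-((A + Q x) * t))) := by
    intro x
    rw [lintegral_rpow_mul_exp hk (by linarith [hQ x]), ← ENNReal.ofReal_mul (by positivity)]
    congr 1
    field_simp
  simp_rw [h1]
  rw [lintegral_const_mul _ (Measurable.lintegral_prod_right' (f := fun z : E × ℝ =>
    ENNReal.ofReal (z.2 ^ (k - 1) * Real.exp (-((A + Q z.1) * z.2)))) (by fun_prop)),
    lintegral_lintegral_swap (by fun_prop)]
  have h2 : ∫⁻ t in Set.Ioi (0 : ℝ), ∫⁻ x, ENNReal.ofReal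
      (t ^ (k - 1) * Real.exp (-((A + Q x) * t))) ∂μ =
      ∫⁻ t in Set.Ioi (0 : ℝ), ENNReal.ofReal C *
        ENNReal.ofReal (t ^ (k - p - 1) * Real.exp (-(A * t))) := by
    refine setLIntegral_congr_fun measurableSet_Ioi fun t ht => ?_
    have ht : (0 : ℝ) < t := ht
    have h3 : ∀ x, ENNReal.ofReal (t ^ (k - 1) * Real.exp (-((A + Q x) * t))) =
        ENNReal.ofReal (t ^ (k - 1) * Real.exp (-(A * t))) *
          ENNReal.ofReal (Real.exp (-(t * Q x))) := by
      intro x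
      rw [← ENNReal.ofReal_mul (by positivity), mul_assoc, ← Real.exp_add]
      congr 3
      ring
    simp_rw [h3]
    rw [lintegral_const_mul _ (by fun_prop), hg t ht, ← ENNReal.ofReal_mul (by positivity),
      ← ENNReal.ofReal_mul hC]
    congr 1
    rw [show k - p - 1 = (k - 1) + -p by ring, Real.rpow_add ht]
    ring
  rw [h2, lintegral_const_mul _ (by fun_prop), lintegral_rpow_mul_exp (by linarith) hA,
    ← ENNReal.ofReal_mul hC, ← ENNReal.ofReal_mul (by positivity)]
  congr 1
  field_simp

theorem lintegral_gaussian {b : ℝ} (hb : 0 < b) (c : ℝ) :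
    ∫⁻ x : ℝ, ENNReal.ofReal (Real.exp (-(b * (x - c) ^ 2))) = ENNReal.ofReal √(Real.pi / b) := by
  rw [lintegral_sub_right_eq_self (fun x : ℝ => ENNReal.ofReal (Real.exp (-(b * x ^ 2)))) c,
    ← integral_gaussian, ofReal_integral_eq_lintegral_ofReal (integrable_exp_neg_mul_sq hb)
    (ae_of_all _ fun x => by positivity)]
  simp only [neg_mul]

theorem lintegral_gaussian_pi {b : ℝ} (hb : 0 < b) (N : ℕ) :
    ∫⁻ x : Fin N → ℝ, ENNReal.ofReal (Real.exp (-(b * ∑ i, x i ^ 2))) =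
      ENNReal.ofReal (√(Real.pi / b) ^ N) := by
  have h : ∀ x : Fin N → ℝ, Real.exp (-(b * ∑ i, x i ^ 2)) = ∏ i, Real.exp (-b * x i ^ 2) := by
    intro x
    rw [← Real.exp_sum, Finset.mul_sum, ← Finset.sum_neg_distrib]
    simp only [neg_mul]
  simp_rw [h]
  have hi : Integrable (fun x : Fin N → ℝ => ∏ i, Real.exp (-b * x i ^ 2)) :=
    Integrable.fintype_prod fun _ => integrable_exp_neg_mul_sq hb
  rw [← ofReal_integral_eq_lintegral_ofReal hi (ae_of_all _ fun x => by positivity),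
    integral_fintype_prod_volume_eq_pow (fun y : ℝ => Real.exp (-b * y ^ 2)), integral_gaussian,
    Fintype.card_fin]

theorem lintegral_lorentz (N : ℕ) {A : ℝ} (hA : 0 < A) (B : ℝ) :
    ∫⁻ h : ℝ, ENNReal.ofReal (((A ^ 2 + (h - B) ^ 2) ^ (N + 1))⁻¹) =
      ENNReal.ofReal (√Real.pi * Real.Gamma (N + 1 / 2) / N.factorial * ((A ^ (2 * N + 1))⁻¹)) := by
  have h := lintegral_inv_rpow_of_gaussian (volume : Measure ℝ) (Q := fun h => (h - B) ^ 2)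
    (by fun_prop) (fun x => by positivity) (C := √Real.pi) (p := 1 / 2) (by positivity)
    (fun t ht => by
      rw [lintegral_gaussian ht, Real.sqrt_div Real.pi_pos.le, Real.rpow_neg ht.le,
        ← Real.sqrt_eq_rpow, div_eq_mul_inv])
    (k := N + 1) (A := A ^ 2) (by positivity) (by linarith [(Nat.cast_nonneg N : (0:ℝ) ≤ N)])
    (by positivity)
  rw [Real.Gamma_nat_eq_factorial, show (N + 1 - 1 / 2 : ℝ) = N + 1 / 2 by ring] at h
  have e1 : ∀ x : ℝ, (1 / (A ^ 2 + (x - B) ^ 2)) ^ (N + 1 : ℝ) =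
      ((A ^ 2 + (x - B) ^ 2) ^ (N + 1))⁻¹ := by
    intro x
    rw [one_div, Real.inv_rpow (by positivity)]
    norm_cast
  have e2 : (1 / A ^ 2) ^ (N + 1 / 2 : ℝ) = (A ^ (2 * N + 1))⁻¹ := by
    rw [one_div, Real.inv_rpow (by positivity), ← Real.rpow_natCast A 2, ← Real.rpow_mul hA.le,
      ← Real.rpow_natCast]
    congr 2
    push_cast
    ring
  simp_rw [e1] at h
  rw [h, e2]
  congr 1
  ring

theorem lintegral_inv_quadratic (N : ℕ) :
    ∫⁻ v : (Fin N → ℝ) × (Fin N → ℝ),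
      ENNReal.ofReal (((1 + (∑ i, v.1 i ^ 2 + ∑ i, v.2 i ^ 2) / 2) ^ (2 * N + 1))⁻¹) =
      ENNReal.ofReal ((2 * Real.pi) ^ N * N.factorial / (2 * N).factorial) := by
  have h := lintegral_inv_rpow_of_gaussian (volume : Measure ((Fin N → ℝ) × (Fin N → ℝ)))
    (Q := fun v => (∑ i, v.1 i ^ 2 + ∑ i, v.2 i ^ 2) / 2)
    (by fun_prop) (fun x => by positivity) (C := (2 * Real.pi) ^ N) (p := N) (by positivity)
    (fun t ht => by
      have e : ∀ v : (Fin N → ℝ) × (Fin N → ℝ),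
          ENNReal.ofReal (Real.exp (-(t * ((∑ i, v.1 i ^ 2 + ∑ i, v.2 i ^ 2) / 2)))) =
          ENNReal.ofReal (Real.exp (-(t / 2 * ∑ i, v.1 i ^ 2))) *
            ENNReal.ofReal (Real.exp (-(t / 2 * ∑ i, v.2 i ^ 2))) := by
        intro v
        rw [← ENNReal.ofReal_mul (by positivity), ← Real.exp_add]
        congr 2
        ring
      simp_rw [e]
      rw [Measure.volume_eq_prod, lintegral_prod_mul
        (f := fun x : Fin N → ℝ => ENNReal.ofReal (Real.exp (-(t / 2 * ∑ i, x i ^ 2))))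
        (g := fun x : Fin N → ℝ => ENNReal.ofReal (Real.exp (-(t / 2 * ∑ i, x i ^ 2))))
        (Measurable.aemeasurable (by fun_prop)) (Measurable.aemeasurable (by fun_prop)),
        lintegral_gaussian_pi (by positivity), ← ENNReal.ofReal_mul (by positivity), ← mul_pow,
        Real.mul_self_sqrt (by positivity), Real.rpow_neg ht.le, Real.rpow_natCast,
        ← div_eq_mul_inv, ← div_pow]
      congr 2
      field_simp)
    (k := 2 * N + 1) (A := 1) (by positivity) (by linarith [(Nat.cast_nonneg N : (0:ℝ) ≤ N)])
    (by positivity)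
  rw [show (2 * N + 1 - N : ℝ) = N + 1 by ring, Real.Gamma_nat_eq_factorial,
    show (2 * N + 1 : ℝ) = ((2 * N : ℕ) : ℝ) + 1 by push_cast; ring,
    Real.Gamma_nat_eq_factorial, div_one, Real.one_rpow, mul_one] at h
  rw [← h]
  refine lintegral_congr fun v => ?_
  rw [one_div, Real.inv_rpow (by positivity)]
  norm_cast

theorem hua_constant (N : ℕ) :
    (√Real.pi * Real.Gamma (N + 1 / 2) / N.factorial) *
      ((2 * Real.pi) ^ N * N.factorial / (2 * N).factorial) =
      Real.pi ^ (N + 1) / (2 ^ N * N.factorial) := by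
  rw [Real.Gamma_nat_add_half]
  have h : ((2 * N).factorial : ℝ) = 2 ^ N * N.factorial * (2 * N - 1).doubleFactorial := by
    rcases N with _ | n
    · simp
    · rw [show 2 * (n + 1) = (2 * n + 1) + 1 by ring, Nat.factorial_eq_mul_doubleFactorial,
        show 2 * n + 1 + 1 = 2 * (n + 1) by ring, Nat.doubleFactorial_two_mul]
      push_cast
      rfl
  have hd : ((2 * N - 1).doubleFactorial : ℝ) ≠ 0 := by
    exact_mod_cast (Nat.doubleFactorial_pos _).ne'
  have hf : (N.factorial : ℝ) ≠ 0 := by exact_mod_cast N.factorial_ne_zero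
  rw [h]
  field_simp
  rw [Real.sq_sqrt Real.pi_pos.le, mul_pow]
  ring

/-! ### The total mass of the Haar density by recursion on N -/

section Recursion

variable {N : ℕ}

/-- The coordinates of a Hermitian matrix in terms of its first row, first column and the
remaining block. -/
def bordered (h : ℝ) (v : (Fin N → ℝ) × (Fin N → ℝ)) (a : Coord N) : Coord (N + 1) :=
  Fin.cons (Fin.cons h v.2) fun i => Fin.cons (v.1 i) (a i)

theorem measurable_bordered {X : Type*} [MeasurableSpace X] {h : X → ℝ}
    {v : X → (Fin N → ℝ) × (Fin N → ℝ)} {a : X → Coord N} (hh : Measurable h) (hv : Measurable v)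
    (ha : Measurable a) : Measurable fun x => bordered (h x) (v x) (a x) := by
  refine measurable_pi_iff.2 fun i => measurable_pi_iff.2 fun j => ?_
  refine Fin.cases (Fin.cases ?_ (fun j => ?_) j) (fun i => Fin.cases ?_ (fun j => ?_) j) i <;>
  simp only [bordered, Fin.cons_zero, Fin.cons_succ] <;> fun_prop

theorem lintegral_coord_succ (f : Coord (N + 1) → ENNReal) (hf : Measurable f) :
    ∫⁻ a, f a = ∫⁻ a : Coord N, ∫⁻ v : (Fin N → ℝ) × (Fin N → ℝ), ∫⁻ h : ℝ,
      f (bordered h v a) := by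
  have e1 := (volume_preserving_piFinSuccAbove (fun _ : Fin (N + 1) => Fin (N + 1) → ℝ) 0).symm
  have e2 := (volume_preserving_piFinSuccAbove (fun _ : Fin (N + 1) => ℝ) 0).symm
  have e3 := (volume_measurePreserving_arrowProdEquivProdArrow ℝ (Fin N → ℝ) (Fin N)).symm
  have e4 := volume_preserving_pi fun _ : Fin N => e2
  have e5 := e1.comp (e2.prod (e4.comp e3))
  have hF : Measurable fun z : (ℝ × (Fin N → ℝ)) × ((Fin N → ℝ) × Coord N) =>
      f (bordered z.1.1 (z.2.1, z.1.2) z.2.2) :=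
    hf.comp (measurable_bordered (by fun_prop) (by fun_prop) (by fun_prop))
  rw [← e5.lintegral_comp hf]
  have he : ∀ z : (ℝ × (Fin N → ℝ)) × ((Fin N → ℝ) × Coord N),
      f (bordered z.1.1 (z.2.1, z.1.2) z.2.2) = f (((MeasurableEquiv.piFinSuccAbove
      (fun _ : Fin (N + 1) => Fin (N + 1) → ℝ) 0).symm ∘ Prod.map
      (MeasurableEquiv.piFinSuccAbove (fun _ : Fin (N + 1) => ℝ) 0).symm
      ((fun a i => (MeasurableEquiv.piFinSuccAbove (fun _ : Fin (N + 1) => ℝ) 0).symm (a i)) ∘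
        (MeasurableEquiv.arrowProdEquivProdArrow ℝ (Fin N → ℝ) (Fin N)).symm)) z) := by
    intro z
    congr 1
    funext i j
    refine Fin.cases (Fin.cases ?_ (fun j => ?_) j) (fun i => Fin.cases ?_ (fun j => ?_) j) i <;>
    rfl
  rw [← lintegral_congr he]
  rw [lintegral_prod_symm _ hF.aemeasurable]
  rw [Measure.volume_eq_prod (Fin N → ℝ) (Coord N), lintegral_prod_symm _ (Measurable.aemeasurable
    (Measurable.lintegral_prod_left' hF))]
  refine lintegral_congr fun a => ?_
  have hF2 : Measurable fun z : ((Fin N → ℝ) × (Fin N → ℝ)) × ℝ => f (bordered z.2 z.1 a) :=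
    hf.comp (measurable_bordered (by fun_prop) (by fun_prop) (by fun_prop))
  rw [Measure.volume_eq_prod (Fin N → ℝ) (Fin N → ℝ),
    lintegral_prod _ (Measurable.aemeasurable (Measurable.lintegral_prod_right' hF2))]
  refine lintegral_congr fun c => ?_
  have hF3 : Measurable fun z : ℝ × (Fin N → ℝ) => f (bordered z.1 (c, z.2) a) :=
    hf.comp (measurable_bordered (by fun_prop) (by fun_prop) (by fun_prop))
  rw [Measure.volume_eq_prod, lintegral_prod_symm _ hF3.aemeasurable]

/-- The complex vector with components `((1 + i) c + (1 - i) r) / 2`. -/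
def colVec : ((Fin N → ℝ) × (Fin N → ℝ)) ≃ₗ[ℝ] (Fin N → ℂ) where
  toFun v i := ((1 + I) / 2) * v.1 i + ((1 - I) / 2) * v.2 i
  invFun u := (fun i => (u i).re + (u i).im, fun i => (u i).re - (u i).im)
  map_add' v w := by ext i; simp; ring
  map_smul' r v := by ext i; simp; ring
  left_inv v := by ext i <;> simp <;> ring
  right_inv u := by ext i; apply Complex.ext <;> simp <;> ring

theorem colVec_apply (v : (Fin N → ℝ) × (Fin N → ℝ)) (i : Fin N) :
    colVec v i = ((1 + I) / 2) * v.1 i + ((1 - I) / 2) * v.2 i := rfl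

theorem sum_normSq_colVec (v : (Fin N → ℝ) × (Fin N → ℝ)) :
    ∑ i, normSq (colVec v i) = (∑ i, v.1 i ^ 2 + ∑ i, v.2 i ^ 2) / 2 := by
  rw [← Finset.sum_add_distrib, Finset.sum_div]
  refine Finset.sum_congr rfl fun i _ => ?_
  simp [colVec_apply, normSq_apply]
  ring

/-- Let c be the border vector, D = 1 - iH the lower block and s = D⁻¹c. The Schur complement is 1 -
ih + c*s, and c*s = s*D*s = |s|² + i s*Hs. Hence the corner entry h enters only through a shifted
square, with B = s*Hs. -/
theorem det_bordered (v : (Fin N → ℝ) × (Fin N → ℝ)) (a : Coord N) :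
    ∃ B : ℝ, ∀ h : ℝ, normSq (1 - I • herm (bordered h v a)).det = normSq (1 - I • herm a).det *
      ((1 + ∑ i, normSq (((1 - I • herm a)⁻¹ *ᵥ colVec v) i)) ^ 2 + (h - B) ^ 2) := by
  set D := 1 - I • herm a with hD
  set s := D⁻¹ *ᵥ colVec v with hs
  have hu := isUnit_det_one_sub (isHermitian_herm a)
  have hDs : D *ᵥ s = colVec v := by rw [hs, mulVec_mulVec, mul_nonsing_inv _ hu, one_mulVec]
  refine ⟨(star s ⬝ᵥ herm a *ᵥ s).re, fun h => ?_⟩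
  have him : (star s ⬝ᵥ herm a *ᵥ s).im = 0 := (isHermitian_herm a).im_star_dotProduct_mulVec_self s
  have hss : star s ⬝ᵥ s = ((∑ i, normSq (s i) : ℝ) : ℂ) := by
    simp [dotProduct, normSq_eq_conj_mul_self]
  have hdet : (1 - I • herm (bordered h v a)).det =
      D.det * (1 - I * h + star (colVec v) ⬝ᵥ s) := by
    let e : Unit ⊕ Fin N ≃ Fin (N + 1) := (Equiv.sumComm _ _).trans
      ((Equiv.optionEquivSumPUnit (Fin N)).symm.trans (finSuccEquiv N).symm)
    have he0 (i : Unit) : e (Sum.inl i) = 0 := by simp [e]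
    have he1 (i : Fin N) : e (Sum.inr i) = i.succ := by simp [e]
    let _ := invertibleOfIsUnitDet D hu
    have hb : (1 - I • herm (bordered h v a)).submatrix e e =
        fromBlocks (Matrix.of fun _ _ => 1 - I * h)
          (replicateRow Unit fun j => -I * star (colVec v j))
          (replicateCol Unit fun i => -I * colVec v i) D := by
      ext i j
      rcases i with i | i <;> rcases j with j | j
      · simp [he0, herm_apply, bordered]
        ring
      · simp [he0, he1, herm_apply, bordered, colVec_apply, (Fin.succ_ne_zero j).symm]
        ring
      · simp [he0, he1, herm_apply, bordered, colVec_apply]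
      · simp [he1, herm_apply, bordered, hD, Matrix.one_apply]
    rw [← det_submatrix_equiv_self e, hb, det_fromBlocks₂₂, invOf_eq_nonsing_inv,
      det_unique (n := Unit)]
    congr 1
    rw [Matrix.sub_apply, Matrix.mul_assoc, ← replicateCol_mulVec]
    have h1 : (D⁻¹ *ᵥ fun i => -I * colVec v i) = -I • s := by
      rw [hs, ← mulVec_smul]; rfl
    rw [h1]
    simp only [of_apply, Matrix.mul_apply, replicateRow_apply, replicateCol_apply, Pi.smul_apply,
      smul_eq_mul, dotProduct, Pi.star_apply]
    rw [sub_eq_add_neg, ← Finset.sum_neg_distrib]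
    congr 1
    refine Finset.sum_congr rfl fun i _ => ?_
    linear_combination (-(star (colVec v i) * s i)) * I_sq
  have hq : star (colVec v) ⬝ᵥ s = ((∑ i, normSq (s i) : ℝ) : ℂ) +
      I * ((star s ⬝ᵥ herm a *ᵥ s).re : ℂ) := by
    have h2 : ((star s ⬝ᵥ herm a *ᵥ s).re : ℂ) = star s ⬝ᵥ herm a *ᵥ s :=
      Complex.ext (by simp) (by simp [him])
    rw [h2, ← hDs, star_mulVec, ← dotProduct_mulVec, hD, conjTranspose_one_sub (isHermitian_herm a),
      add_mulVec, one_mulVec, dotProduct_add, hss, smul_mulVec, dotProduct_smul, smul_eq_mul]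
  rw [hdet, normSq_mul, hq]
  congr 1
  simp only [normSq_apply, add_re, sub_re, mul_re, add_im, sub_im, mul_im, I_re, I_im, ofReal_re,
    ofReal_im, one_re, one_im]
  ring

/-- The real determinant of a complex linear map is the squared modulus of its complex determinant.
-/
theorem lintegral_comp_inv_mulVec {D : Matrix (Fin N) (Fin N) ℂ} (hu : IsUnit D.det)
    {F : ℝ → ENNReal} (hF : Measurable F) :
    ∫⁻ v : (Fin N → ℝ) × (Fin N → ℝ), F (∑ i, normSq ((D⁻¹ *ᵥ colVec v) i)) =
      ENNReal.ofReal (normSq D.det) * ∫⁻ v : (Fin N → ℝ) × (Fin N → ℝ),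
        F ((∑ i, v.1 i ^ 2 + ∑ i, v.2 i ^ 2) / 2) := by
  let f : (Fin N → ℂ) →ₗ[ℂ] (Fin N → ℂ) := toLin' D⁻¹
  let T : ((Fin N → ℝ) × (Fin N → ℝ)) →ₗ[ℝ] ((Fin N → ℝ) × (Fin N → ℝ)) :=
    colVec.symm.toLinearMap ∘ₗ f.restrictScalars ℝ ∘ₗ colVec.symm.symm.toLinearMap
  have hT : ∀ v, colVec (T v) = D⁻¹ *ᵥ colVec v := fun v => by simp [T, f]
  have hdet : LinearMap.det T = (normSq D.det)⁻¹ := by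
    rw [LinearMap.det_conj, LinearMap.det_restrictScalars, LinearMap.det_toLin', det_nonsing_inv,
      Ring.inverse_eq_inv', Algebra.norm_complex_apply, normSq_inv]
  have hpos : 0 < normSq D.det := normSq_pos.2 hu.ne_zero
  have hne : LinearMap.det T ≠ 0 := by rw [hdet]; positivity
  have : (volume : Measure ((Fin N → ℝ) × (Fin N → ℝ))).IsAddHaarMeasure :=
    Measure.prod.instIsAddHaarMeasure volume volume
  have hmap := Measure.map_linearMap_addHaar_eq_smul_addHaar
    (volume : Measure ((Fin N → ℝ) × (Fin N → ℝ))) hne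
  rw [hdet, inv_inv, abs_of_pos hpos] at hmap
  have hG : Measurable fun v : (Fin N → ℝ) × (Fin N → ℝ) =>
    F ((∑ i, v.1 i ^ 2 + ∑ i, v.2 i ^ 2) / 2) := hF.comp (by fun_prop)
  rw [← smul_eq_mul, ← lintegral_smul_measure, ← hmap, lintegral_map hG
    (LinearMap.continuous_of_finiteDimensional T).measurable]
  refine lintegral_congr fun v => ?_
  rw [← hT, sum_normSq_colVec]

theorem cayleyDensity_eq (a : Coord N) :
    cayleyDensity a = (normSq (1 - I • herm a).det ^ N)⁻¹ := by
  rw [cayleyDensity, normSq_eq_norm_sq, pow_mul]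

/-- Integrating out the corner leaves a function of |D⁻¹c|² times |det D|^(-2(N+1)). The
substitution that removes D⁻¹ contributes |det D|², which restores exactly the density of size N. -/
theorem lintegral_cayleyDensity_succ (N : ℕ) :
    ∫⁻ a : Coord (N + 1), ENNReal.ofReal (cayleyDensity a) =
      ENNReal.ofReal (Real.pi ^ (N + 1) / (2 ^ N * N.factorial)) *
        ∫⁻ a : Coord N, ENNReal.ofReal (cayleyDensity a) := by
  rw [lintegral_coord_succ _ measurable_ofReal_cayleyDensity,
    ← lintegral_const_mul _ measurable_ofReal_cayleyDensity]
  refine lintegral_congr fun a => ?_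
  have hu := isUnit_det_one_sub (isHermitian_herm a)
  have hpos : 0 < normSq (1 - I • herm a).det := normSq_pos.2 hu.ne_zero
  set d := normSq (1 - I • herm a).det
  have h1 : ∀ v : (Fin N → ℝ) × (Fin N → ℝ),
      ∫⁻ h : ℝ, ENNReal.ofReal (cayleyDensity (bordered h v a)) =
      ENNReal.ofReal ((d ^ (N + 1))⁻¹ * (√Real.pi * Real.Gamma (N + 1 / 2) / N.factorial)) *
        (fun q : ℝ => ENNReal.ofReal (((1 + q) ^ (2 * N + 1))⁻¹))
          (∑ i, normSq (((1 - I • herm a)⁻¹ *ᵥ colVec v) i)) := by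
    intro v
    obtain ⟨B, hB⟩ := det_bordered v a
    change ∀ h, _ = d * _ at hB
    have hq : 0 ≤ ∑ i, normSq (((1 - I • herm a)⁻¹ *ᵥ colVec v) i) :=
      Finset.sum_nonneg fun i _ => normSq_nonneg _
    have hG := Real.Gamma_pos_of_pos (show (0 : ℝ) < N + 1 / 2 by positivity)
    simp_rw [cayleyDensity_eq, hB, mul_pow, mul_inv]
    simp_rw [ENNReal.ofReal_mul (show (0 : ℝ) ≤ (d ^ (N + 1))⁻¹ by positivity)]
    rw [lintegral_const_mul _ (by fun_prop), lintegral_lorentz N (by positivity) B,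
      ENNReal.ofReal_mul (by positivity), mul_assoc]
  have hG := Real.Gamma_pos_of_pos (show (0 : ℝ) < N + 1 / 2 by positivity)
  have hm : Measurable fun v : (Fin N → ℝ) × (Fin N → ℝ) =>
      ∑ i, normSq (((1 - I • herm a)⁻¹ *ᵥ colVec v) i) := by
    have hc : Continuous fun v : (Fin N → ℝ) × (Fin N → ℝ) => colVec v :=
      LinearMap.continuous_of_finiteDimensional colVec.toLinearMap
    have hc2 := (continuous_const (y := (1 - I • herm a)⁻¹)).matrix_mulVec hc
    exact (continuous_finsetSum _ fun i _ =>
      continuous_normSq.comp ((continuous_apply i).comp hc2)).measurable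
  have hF : Measurable fun q : ℝ => ENNReal.ofReal (((1 + q) ^ (2 * N + 1))⁻¹) := by fun_prop
  rw [lintegral_congr h1, lintegral_const_mul _ (hF.fun_comp hm), lintegral_comp_inv_mulVec hu hF,
    lintegral_inv_quadratic, ← mul_assoc, ← ENNReal.ofReal_mul (by positivity),
    ← ENNReal.ofReal_mul (by positivity), ← hua_constant, cayleyDensity_eq,
    ← ENNReal.ofReal_mul (by positivity)]
  congr 1
  change (d ^ (N + 1))⁻¹ * _ * d * _ = _ * (d ^ N)⁻¹
  rw [pow_succ]
  field_simp

/-- The total mass of the unnormalized Haar density. -/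
def huaConst (N : ℕ) : ℝ := ∏ k ∈ Finset.range N, Real.pi ^ (k + 1) / (2 ^ k * k.factorial)

theorem huaConst_pos (N : ℕ) : 0 < huaConst N :=
  Finset.prod_pos fun k _ => by positivity

theorem lintegral_cayleyDensity (N : ℕ) :
    ∫⁻ a : Coord N, ENNReal.ofReal (cayleyDensity a) = ENNReal.ofReal (huaConst N) := by
  induction N with
  | zero => simp [cayleyDensity_eq, huaConst, volume_pi]
  | succ N ih =>
    rw [lintegral_cayleyDensity_succ, ih, ← ENNReal.ofReal_mul (by positivity), huaConst, huaConst,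
      Finset.prod_range_succ, mul_comm]

theorem integrable_cayleyDensity (N : ℕ) : Integrable (cayleyDensity : Coord N → ℝ) := by
  refine ⟨continuous_cayleyDensity.aestronglyMeasurable, ?_⟩
  rw [hasFiniteIntegral_iff_ofReal (ae_of_all _ cayleyDensity_nonneg), lintegral_cayleyDensity]
  exact ENNReal.ofReal_lt_top

theorem cayleyMeasure_univ (N : ℕ) : cayleyMeasure N Set.univ = ENNReal.ofReal (huaConst N) := by
  rw [← lintegral_cayleyDensity, ← setLIntegral_one, Measure.restrict_univ,
    lintegral_cayleyMeasure measurable_const]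
  simp

instance instIsFiniteMeasureCayleyMeasure (N : ℕ) : IsFiniteMeasure (cayleyMeasure N) :=
  ⟨by rw [cayleyMeasure_univ]; exact ENNReal.ofReal_lt_top⟩

theorem haarUN_eq (N : ℕ) : haarUN N = ENNReal.ofReal (huaConst N)⁻¹ • cayleyMeasure N := by
  rw [cayleyMeasure_eq_smul_haarUN, cayleyMeasure_univ, smul_smul,
    ← ENNReal.ofReal_mul (inv_nonneg.2 (huaConst_pos N).le), inv_mul_cancel₀ (huaConst_pos N).ne',
    ENNReal.ofReal_one, one_smul]

end Recursion

/-! ### Product measures -/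

section Product

variable {X : Type*} [MeasurableSpace X]

theorem measurePreserving_comp_injective {A E : Type*} [Fintype A] [Fintype E] (μ : Measure X)
    [IsProbabilityMeasure μ] {ι : A → E} (hι : Function.Injective ι) :
    MeasurePreserving (fun (U : E → X) a => U (ι a)) (Measure.pi fun _ => μ)
      (Measure.pi fun _ => μ) := by
  refine ⟨by fun_prop, (Measure.pi_eq fun s hs => ?_).symm⟩
  rw [Measure.map_apply (by fun_prop) (MeasurableSet.univ_pi hs)]
  have h : (fun (U : E → X) a => U (ι a)) ⁻¹' Set.univ.pi s =
      Set.univ.pi (Function.extend ι s fun _ => Set.univ) := by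
    ext U
    simp only [Set.mem_preimage, Set.mem_univ_pi]
    constructor
    · intro hU e
      by_cases he : ∃ a, ι a = e
      · obtain ⟨a, rfl⟩ := he
        rw [hι.extend_apply]
        exact hU a
      · rw [Function.extend_apply' _ _ _ he]
        trivial
    · intro hU a
      simpa only [hι.extend_apply] using hU (ι a)
  rw [h, Measure.pi_pi]
  symm
  refine Fintype.prod_of_injective ι hι _ _ (fun e he => ?_) fun a => ?_
  · rw [Function.extend_apply' _ _ _ (by simpa using he), measure_univ]
  · rw [hι.extend_apply]

theorem measurePreserving_uncurry {A B : Type*} [Fintype A] [Fintype B] (μ : Measure X)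
    [SigmaFinite μ] :
    MeasurePreserving (MeasurableEquiv.curry A B X).symm
      (Measure.pi fun _ => Measure.pi fun _ => μ) (Measure.pi fun _ => μ) := by
  refine ⟨MeasurableEquiv.measurable _, (Measure.pi_eq fun s hs => ?_).symm⟩
  rw [Measure.map_apply (MeasurableEquiv.measurable _) (MeasurableSet.univ_pi hs)]
  have h : (MeasurableEquiv.curry A B X).symm ⁻¹' Set.univ.pi s =
      Set.univ.pi fun a => Set.univ.pi fun b => s (a, b) := by
    ext U
    simp [Prod.forall]
  rw [h, Measure.pi_pi]
  simp_rw [Measure.pi_pi]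
  rw [Fintype.prod_prod_type]

/-- Injectivity of the index map makes the blocks independent; coordinates outside its range
integrate to one. -/
theorem integral_prod_blocks {A B E : Type*} [Fintype A] [Fintype B] [Fintype E] (μ : Measure X)
    [IsProbabilityMeasure μ] {ι : A × B → E} (hι : Function.Injective ι) (f : A → (B → X) → ℝ)
    (hf : ∀ a, Measurable (f a)) :
    ∫ U : E → X, ∏ a, f a (fun b => U (ι (a, b))) ∂(Measure.pi fun _ => μ) =
      ∏ a, ∫ V, f a V ∂(Measure.pi fun _ => μ) := by
  have h1 := measurePreserving_comp_injective μ hι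
  have h2 := (measurePreserving_uncurry (A := A) (B := B) μ).symm
  have h3 := h2.comp h1
  rw [← integral_fintype_prod_eq_prod, ← h3.map_eq, integral_map h3.measurable.aemeasurable]
  · rfl
  · exact (Finset.measurable_prod _ fun a _ =>
      (hf a).comp (measurable_pi_apply a)).aestronglyMeasurable

theorem integral_prod_swap {A B : Type*} [Fintype A] [Fintype B] (f : (A → ℝ) → ℝ)
    (hf : Measurable f) :
    ∫ x : A → B → ℝ, ∏ b, f (fun a => x a b) = (∫ y : A → ℝ, f y) ^ Fintype.card B := by
  have h1 : MeasurePreserving (MeasurableEquiv.curry A B ℝ).symm volume volume :=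
    measurePreserving_uncurry volume
  have h2 : MeasurePreserving (MeasurableEquiv.curry B A ℝ).symm volume volume :=
    measurePreserving_uncurry volume
  have h3 : MeasurePreserving (fun (x : A × B → ℝ) (p : B × A) => x p.swap) volume volume :=
    volume_measurePreserving_piCongrLeft (fun _ : B × A => ℝ) (Equiv.prodComm A B)
  have h4 := (h2.symm.comp h3).comp h1
  rw [← integral_fintype_prod_volume_eq_pow, ← h4.map_eq, integral_map h4.measurable.aemeasurable]
  · rfl
  · exact (Finset.measurable_prod _ fun a _ =>
      hf.comp (measurable_pi_apply a)).aestronglyMeasurable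

theorem pi_withDensity {E : Type*} [Fintype E] (μ : Measure X) [SigmaFinite μ] {w : X → ℝ}
    (hw : Integrable w μ) (h0 : ∀ x, 0 ≤ w x) :
    (Measure.pi fun _ : E => μ.withDensity fun x => ENNReal.ofReal (w x)) =
      (Measure.pi fun _ : E => μ).withDensity fun x => ENNReal.ofReal (∏ e, w (x e)) := by
  have : IsFiniteMeasure (μ.withDensity fun x => ENNReal.ofReal (w x)) :=
    isFiniteMeasure_withDensity_ofReal hw.2
  refine Measure.pi_eq fun s hs => ?_
  have hS := MeasurableSet.univ_pi hs
  have hind : ∀ e, Integrable ((s e).indicator w) μ := fun e => hw.indicator (hs e)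
  have hpt : ∀ x : E → X, (Set.univ.pi s).indicator (fun x => ENNReal.ofReal (∏ e, w (x e))) x =
      ENNReal.ofReal (∏ e, (s e).indicator w (x e)) := by
    intro x
    by_cases hx : x ∈ Set.univ.pi s
    · rw [Set.indicator_of_mem hx]
      congr 1
      exact Finset.prod_congr rfl fun e _ => (Set.indicator_of_mem (hx e trivial) w).symm
    · rw [Set.indicator_of_notMem hx]
      simp only [Set.mem_univ_pi, not_forall] at hx
      obtain ⟨e, he⟩ := hx
      rw [Finset.prod_eq_zero (Finset.mem_univ e) (Set.indicator_of_notMem he w), ENNReal.ofReal_zero]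
  have hnn : ∀ e x, 0 ≤ (s e).indicator w x := fun e x => Set.indicator_nonneg (fun x _ => h0 x) x
  rw [withDensity_apply _ hS, ← lintegral_indicator hS, lintegral_congr hpt,
    ← ofReal_integral_eq_lintegral_ofReal (Integrable.fintype_prod hind)
      (ae_of_all _ fun x => Finset.prod_nonneg fun e _ => hnn e _),
    integral_fintype_prod_eq_prod, ENNReal.ofReal_prod_of_nonneg fun e _ =>
      integral_nonneg (hnn e)]
  refine Finset.prod_congr rfl fun e _ => ?_
  rw [withDensity_apply _ (hs e), integral_indicator (hs e),
    ofReal_integral_eq_lintegral_ofReal hw.integrableOn (ae_of_all _ h0)]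

end Product

/-! ### Gaussian integrals -/

open scoped MatrixOrder in
theorem integral_exp_quadratic {E : Type*} [Fintype E] [DecidableEq E] {M : Matrix E E ℝ}
    (hM : M.PosDef) :
    ∫ t : E → ℝ, Real.exp (-(t ⬝ᵥ M *ᵥ t) / 2) =
      √(2 * Real.pi) ^ Fintype.card E * (√M.det)⁻¹ := by
  obtain ⟨B, rfl⟩ := CStarAlgebra.nonneg_iff_eq_star_mul_self.mp hM.posSemidef.nonneg
  have hstar : star B = Bᵀ := rfl
  have hdet : (star B * B).det = B.det ^ 2 := by rw [det_mul, hstar, det_transpose, sq]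
  have hB : B.det ≠ 0 := fun h => by
    have := hM.det_pos
    rw [hdet, h] at this
    simp at this
  have hq : ∀ t : E → ℝ, t ⬝ᵥ (star B * B) *ᵥ t = ∑ e, (toLin' B t) e ^ 2 := by
    intro t
    rw [hstar, ← mulVec_mulVec, dotProduct_mulVec, vecMul_transpose, toLin'_apply]
    simp [dotProduct, sq]
  have hmap := Real.map_matrix_volume_pi_eq_smul_volume_pi hB
  have hone : ∫ t : E → ℝ, Real.exp (-(∑ e, t e ^ 2) / 2) = √(2 * Real.pi) ^ Fintype.card E := by
    have h : ∀ t : E → ℝ, Real.exp (-(∑ e, t e ^ 2) / 2) = ∏ e, Real.exp (-(1 / 2) * t e ^ 2) := by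
      intro t
      rw [← Real.exp_sum, ← Finset.mul_sum]
      congr 1
      ring
    simp_rw [h]
    rw [integral_fintype_prod_volume_eq_pow (fun y : ℝ => Real.exp (-(1 / 2) * y ^ 2)),
      integral_gaussian]
    congr 3
    ring
  simp_rw [hq]
  rw [← integral_map (φ := toLin' B) (f := fun t : E → ℝ => Real.exp (-(∑ e, t e ^ 2) / 2))
    (LinearMap.continuous_of_finiteDimensional _).aemeasurable
    (Continuous.aestronglyMeasurable (by fun_prop)), hmap, integral_smul_measure, hone, hdet,
    Real.sqrt_sq_eq_abs, ENNReal.toReal_ofReal (abs_nonneg _), smul_eq_mul, abs_inv, mul_comm]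

/-! ### The function `φ` and the distance to the identity -/

section Deviation
open scoped Matrix.Norms.Frobenius

variable {N : ℕ}

/-- The Frobenius distance of a unitary matrix to the identity. -/
def dev (U : UN N) : ℝ := ‖(U : Matrix (Fin N) (Fin N) ℂ) - 1‖

theorem dev_nonneg (U : UN N) : 0 ≤ dev U := norm_nonneg _

theorem frobenius_norm_sq (A : Matrix (Fin N) (Fin N) ℂ) : ‖A‖ ^ 2 = ∑ i, ∑ j, normSq (A i j) := by
  rw [frobenius_norm_def, ← Real.rpow_natCast, ← Real.rpow_mul (by positivity)]
  simp [normSq_eq_norm_sq]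

theorem frobenius_norm_sq_eq_trace (A : Matrix (Fin N) (Fin N) ℂ) :
    ‖A‖ ^ 2 = (trace (A * Aᴴ)).re := by
  rw [frobenius_norm_sq]
  simp [trace, Matrix.mul_apply, normSq_apply]

theorem norm_mul_unitary (A : Matrix (Fin N) (Fin N) ℂ) (V : UN N) : ‖A * V.1‖ = ‖A‖ := by
  have h : ‖A * V.1‖ ^ 2 = ‖A‖ ^ 2 := by
    have hV : V.1 * V.1ᴴ = 1 := mem_unitaryGroup_iff.1 V.2
    rw [frobenius_norm_sq_eq_trace, frobenius_norm_sq_eq_trace, conjTranspose_mul, mul_assoc,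
      ← mul_assoc V.1, hV, one_mul]
  exact (pow_left_inj₀ (norm_nonneg _) (norm_nonneg _) two_ne_zero).1 h

/-- For unitary U the squared distance ‖U - 1‖² expands to 2N - 2 Re Tr U. Through this identity the
triangle inequality for `dev` becomes a tool for the Wilson action. -/
theorem phi_eq_dev (U : UN N) : phi U = dev U ^ 2 / 2 := by
  have hU : U.1 * U.1ᴴ = 1 := mem_unitaryGroup_iff.1 U.2
  rw [dev, frobenius_norm_sq_eq_trace, phi, conjTranspose_sub, sub_mul, mul_sub, mul_sub, hU]
  simp [trace_sub, trace_conjTranspose]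
  ring

theorem phi_eq_sum (U : UN N) :
    phi U = (∑ i, ∑ j, normSq ((U.1 - 1) i j)) / 2 := by
  rw [phi_eq_dev, dev, frobenius_norm_sq]

theorem phi_nonneg (U : UN N) : 0 ≤ phi U := by
  rw [phi_eq_dev]; positivity

theorem phi_one : phi (1 : UN N) = 0 := by simp [phi]

theorem dev_mul_le (U V : UN N) : dev (U * V) ≤ dev U + dev V := by
  have h : ((U * V : UN N) : Matrix (Fin N) (Fin N) ℂ) - 1 = (U.1 - 1) * V.1 + (V.1 - 1) := by
    rw [sub_mul, one_mul]; change U.1 * V.1 - 1 = _; abel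
  rw [dev, h]
  refine (norm_add_le _ _).trans ?_
  rw [norm_mul_unitary]
  rfl

theorem dev_inv (U : UN N) : dev U⁻¹ = dev U := by
  have h1 : U.1 * (U⁻¹ : UN N).1 = 1 := congrArg Subtype.val (mul_inv_cancel U)
  have h : ((U⁻¹ : UN N) : Matrix (Fin N) (Fin N) ℂ) - 1 = (-(U.1 - 1)) * (U⁻¹ : UN N).1 := by
    rw [neg_sub, sub_mul, one_mul, h1]
  rw [dev, h, norm_mul_unitary, norm_neg]
  rfl

end Deviation

variable {N : ℕ}

theorem continuous_phi : Continuous (phi : UN N → ℝ) :=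
  continuous_re.comp ((continuous_const.sub continuous_subtype_val).matrix_trace)

/-! ### First order behaviour of curves of unitary matrices -/

/-- `T` is the right derivative at `0` of the curve `U` through the identity. -/
def HasTangent (U : ℝ → UN N) (T : Matrix (Fin N) (Fin N) ℂ) : Prop :=
  Tendsto (fun g : ℝ => (g : ℂ)⁻¹ • ((U g).1 - 1)) (𝓝[>] 0) (𝓝 T)

theorem HasTangent.tendsto_one {U : ℝ → UN N} {T : Matrix (Fin N) (Fin N) ℂ}
    (h : HasTangent U T) : Tendsto (fun g => (U g).1) (𝓝[>] 0) (𝓝 1) := by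
  have hg : Tendsto (fun g : ℝ => (g : ℂ)) (𝓝[>] 0) (𝓝 0) :=
    (continuous_ofReal.tendsto' 0 0 ofReal_zero).mono_left nhdsWithin_le_nhds
  have h2 := (hg.smul h).add_const 1
  rw [zero_smul, zero_add] at h2
  refine h2.congr' ?_
  filter_upwards [self_mem_nhdsWithin] with g hg
  have : (g : ℂ) ≠ 0 := ofReal_ne_zero.2 (ne_of_gt hg)
  rw [smul_smul, mul_inv_cancel₀ this, one_smul, sub_add_cancel]

theorem hasTangent_one : HasTangent (fun _ => (1 : UN N)) 0 := by
  simp [HasTangent]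

theorem HasTangent.mul {U V : ℝ → UN N} {S T : Matrix (Fin N) (Fin N) ℂ}
    (hU : HasTangent U S) (hV : HasTangent V T) : HasTangent (fun g => U g * V g) (S + T) := by
  have h := (Tendsto.mul hU hV.tendsto_one).add hV
  rw [mul_one] at h
  refine h.congr fun g => ?_
  change _ = (g : ℂ)⁻¹ • ((U g).1 * (V g).1 - 1)
  rw [smul_mul_assoc, ← smul_add, sub_mul, one_mul]
  congr 1
  abel

theorem HasTangent.inv {U : ℝ → UN N} {S : Matrix (Fin N) (Fin N) ℂ}
    (hU : HasTangent U S) : HasTangent (fun g => (U g)⁻¹) (-S) := by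
  have h1 : Tendsto (fun g => ((U g)⁻¹).1) (𝓝[>] 0) (𝓝 1) := by
    have := (continuous_star.tendsto (1 : Matrix (Fin N) (Fin N) ℂ)).comp hU.tendsto_one
    rw [star_one] at this
    exact this
  have h := (Tendsto.mul hU h1).neg
  rw [mul_one] at h
  refine h.congr fun g => ?_
  have h2 : (U g).1 * ((U g)⁻¹ : UN N).1 = 1 := congrArg Subtype.val (mul_inv_cancel (U g))
  rw [smul_mul_assoc, ← smul_neg, sub_mul, one_mul, h2, neg_sub]

/-- To first order the Cayley transform is 1 + 2iH, hence the coordinate scale g/2. -/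
theorem hasTangent_cayley (b : Coord N) :
    HasTangent (fun g => cayley ((g / 2) • b)) (I • herm b) := by
  have h1 : Tendsto (fun g : ℝ => (1 - I • herm ((g / 2) • b))⁻¹ * (I • herm b)) (𝓝[>] 0)
      (𝓝 (I • herm b)) := by
    have hc : Continuous fun g : ℝ => (1 - I • herm ((g / 2) • b))⁻¹ * (I • herm b) :=
      (continuous_inv_one_sub_herm.comp (by fun_prop : Continuous fun g : ℝ => (g / 2) • b)).mul
        continuous_const
    exact (hc.tendsto' 0 _ (by simp)).mono_left nhdsWithin_le_nhds
  refine h1.congr' ?_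
  filter_upwards [self_mem_nhdsWithin] with g hg
  have hg0 : (g : ℂ) ≠ 0 := ofReal_ne_zero.2 (ne_of_gt hg)
  have hu := isUnit_det_one_sub (isHermitian_herm ((g / 2) • b))
  have h2 : (cayley ((g / 2) • b)).1 - 1 =
      (2 : ℂ) • ((1 - I • herm ((g / 2) • b))⁻¹ * (I • herm ((g / 2) • b))) := by
    have h3 : (1 - I • herm ((g / 2) • b))⁻¹ * (I • herm ((g / 2) • b)) =
        (1 - I • herm ((g / 2) • b))⁻¹ - 1 := by
      calc _ = (1 - I • herm ((g / 2) • b))⁻¹ * (1 - (1 - I • herm ((g / 2) • b))) := by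
            rw [sub_sub_cancel]
        _ = _ := by rw [mul_sub, mul_one, nonsing_inv_mul _ hu]
    rw [coe_cayley, h3, smul_sub, sub_sub, ← two_smul ℂ (1 : Matrix (Fin N) (Fin N) ℂ)]
  rw [h2, map_smul, smul_smul, mul_smul_comm, mul_smul_comm]
  rw [show (g / 2 : ℝ) • herm b = ((g / 2 : ℝ) : ℂ) • herm b from rfl, mul_smul_comm, smul_smul,
    smul_smul, smul_smul]
  congr 1
  push_cast
  field_simp

theorem sum_normSq_smul_herm (b : Coord N) :
    ∑ i, ∑ j, normSq ((I • herm b) i j) = ∑ i, ∑ j, b i j ^ 2 := by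
  have h : ∀ i j, normSq ((I • herm b) i j) = b i j ^ 2 / 2 + b j i ^ 2 / 2 := by
    intro i j
    simp [herm_apply, normSq_apply]
    ring
  simp_rw [h, Finset.sum_add_distrib]
  rw [Finset.sum_comm (f := fun i j => b j i ^ 2 / 2), ← Finset.sum_add_distrib]
  refine Finset.sum_congr rfl fun i _ => ?_
  rw [← Finset.sum_add_distrib]
  exact Finset.sum_congr rfl fun j _ => by ring

theorem HasTangent.tendsto_phi {U : ℝ → UN N} {b : Coord N} (h : HasTangent U (I • herm b)) :
    Tendsto (fun g => phi (U g) / g ^ 2) (𝓝[>] 0) (𝓝 ((∑ i, ∑ j, b i j ^ 2) / 2)) := by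
  have hc : Continuous fun A : Matrix (Fin N) (Fin N) ℂ => (∑ i, ∑ j, normSq (A i j)) / 2 :=
    (continuous_finsetSum _ fun i _ => continuous_finsetSum _ fun j _ =>
      continuous_normSq.comp (continuous_id.matrix_elem i j)).div_const _
  have h2 := (hc.tendsto _).comp h
  rw [sum_normSq_smul_herm] at h2
  refine h2.congr fun g => ?_
  simp only [Function.comp_apply, phi_eq_sum, Matrix.smul_apply, smul_eq_mul, normSq_mul,
    ← Finset.mul_sum]
  rw [normSq_inv, normSq_ofReal, ← sq]
  ring

/-! ### Uniform domination in Cayley coordinates -/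

/-- Diagonalizing the Hermitian matrix makes both quantities functions of its eigenvalues, with the
same l for every g; the domination below becomes a one-variable inequality. -/
theorem exists_eigenvalues (b : Coord N) : ∃ l : Fin N → ℝ, ∀ g : ℝ,
    normSq (1 - I • herm (g • b)).det = ∏ i, (1 + g ^ 2 * l i ^ 2) ∧
    phi (cayley (g • b)) = ∑ i, 2 * (g ^ 2 * l i ^ 2) / (1 + g ^ 2 * l i ^ 2) := by
  have hH := isHermitian_herm b
  refine ⟨hH.eigenvalues, fun g => ?_⟩
  set l := hH.eigenvalues
  set V := hH.eigenvectorUnitary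
  have hspec : herm b = V.1 * diagonal (fun i => (l i : ℂ)) * V.1ᴴ := by
    have := hH.spectral_theorem
    rwa [Unitary.conjStarAlgAut_apply] at this
  have hV : V.1 * V.1ᴴ = 1 := mem_unitaryGroup_iff.1 V.2
  have hV' : V.1ᴴ * V.1 = 1 := mem_unitaryGroup_iff'.1 V.2
  have hdet : V.1.det * V.1ᴴ.det = 1 := by rw [← det_mul, hV, det_one]
  have h1 : 1 - I • herm (g • b) = V.1 * diagonal (fun i => 1 - I * (g * l i)) * V.1ᴴ := by
    have hd : diagonal (fun i => 1 - I * ((g : ℂ) * l i)) =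
        1 - (I * g) • diagonal (fun i => (l i : ℂ)) := by
      rw [← diagonal_one, ← diagonal_smul, diagonal_sub]
      congr 1
      funext i
      simp [mul_assoc]
    rw [hd, mul_sub, sub_mul, mul_one, hV, mul_smul_comm, smul_mul_assoc, ← hspec, map_smul,
      mul_smul]
    rfl
  have hne : ∀ i, (1 - I * ((g : ℂ) * l i)) ≠ 0 := fun i h => by simpa using congrArg re h
  have h2 : (1 - I • herm (g • b))⁻¹ = V.1 * diagonal (fun i => (1 - I * (g * l i))⁻¹) * V.1ᴴ := by
    apply inv_eq_right_inv
    rw [h1]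
    calc _ = V.1 * (diagonal (fun i => 1 - I * ((g : ℂ) * l i)) * (V.1ᴴ * V.1) *
          diagonal (fun i => (1 - I * ((g : ℂ) * l i))⁻¹)) * V.1ᴴ := by simp only [mul_assoc]
      _ = 1 := by
        rw [hV', mul_one, diagonal_mul_diagonal]
        simp only [mul_inv_cancel₀ (hne _), diagonal_one, mul_one, hV]
  have hns : ∀ i, normSq (1 - I * ((g : ℂ) * l i)) = 1 + g ^ 2 * l i ^ 2 := by
    intro i
    simp [normSq_apply]
    ring
  constructor
  · rw [h1, det_mul, det_mul, mul_right_comm, hdet, one_mul, det_diagonal, map_prod]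
    simp only [hns]
  · rw [phi, coe_cayley, h2, trace_sub, trace_sub, trace_smul, trace_mul_comm, ← mul_assoc, hV',
      one_mul, trace_diagonal]
    simp only [trace_one, Fintype.card_fin, sub_re, smul_eq_mul, mul_re, re_sum, re_ofNat, im_ofNat,
      zero_mul, sub_zero, natCast_re, inv_re, hns]
    rw [Finset.mul_sum]
    have : (N : ℝ) = ∑ i : Fin N, 1 := by simp
    rw [this, ← Finset.sum_sub_distrib, ← Finset.sum_sub_distrib]
    refine Finset.sum_congr rfl fun i _ => ?_
    have : 1 + g ^ 2 * l i ^ 2 ≠ 0 := by positivity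
    simp
    field_simp
    ring

theorem one_add_pow_le (N : ℕ) {c : ℝ} (hc : 0 < c) {y : ℝ} (hy : 0 ≤ y) :
    (1 + y) ^ N ≤ (((N + 1) / c) ^ N * Real.exp c) * Real.exp (c * y) := by
  have h1 : c / (N + 1) * (1 + y) ≤ Real.exp (c / (N + 1) * (1 + y)) :=
    (by linarith : c / (N + 1) * (1 + y) ≤ c / (N + 1) * (1 + y) + 1).trans (Real.add_one_le_exp _)
  have h2 : (1 + y) ≤ (N + 1) / c * Real.exp (c / (N + 1) * (1 + y)) := by
    have h3 := mul_le_mul_of_nonneg_left h1 (show 0 ≤ (N + 1) / c by positivity)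
    have h4 : (N + 1) / c * (c / (N + 1) * (1 + y)) = 1 + y := by field_simp
    linarith
  calc (1 + y) ^ N ≤ ((N + 1) / c * Real.exp (c / (N + 1) * (1 + y))) ^ N := by gcongr
    _ = ((N + 1) / c) ^ N * Real.exp (N * (c / (N + 1) * (1 + y))) := by
      rw [mul_pow, ← Real.exp_nat_mul]
    _ ≤ ((N + 1) / c) ^ N * Real.exp (c + c * y) := by
      gcongr
      have h5 : (N : ℝ) * (c / (N + 1) * (1 + y)) = (N / (N + 1)) * (c * (1 + y)) := by ring
      have h6 : (N : ℝ) / (N + 1) ≤ 1 := by rw [div_le_one (by positivity)]; linarith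
      rw [h5]
      calc _ ≤ 1 * (c * (1 + y)) := by gcongr
        _ = _ := by ring
    _ = _ := by rw [Real.exp_add]; ring

/-- This provides the dominating function for Laplace's method. Since φ is bounded, the exponential
alone does not decay at infinity; the density supplies what is missing. Per eigenvalue, with y =
l²/(1 + g²l²), the exponential is e^(-2cy), it absorbs (1 + y)^N, and (1 + y)(1 + g²l²) ≥ 1 + l². -/
theorem exists_cayleyDensity_bound (N : ℕ) {c : ℝ} (hc : 0 < c) : ∃ C : ℝ, 0 ≤ C ∧
    ∀ g : ℝ, 0 < g → g ≤ 1 → ∀ b : Coord N,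
      Real.exp (-(c / g ^ 2) * phi (cayley (g • b))) * cayleyDensity (g • b) ≤
        C * cayleyDensity b := by
  set K := (((N + 1) / (2 * c)) ^ N * Real.exp (2 * c)) with hK
  refine ⟨K ^ N, by positivity, fun g hg hg1 b => ?_⟩
  obtain ⟨l, hl⟩ := exists_eigenvalues b
  have hone := (hl 1).1
  simp only [one_smul, one_pow, one_mul] at hone
  rw [cayleyDensity_eq, cayleyDensity_eq, (hl g).1, (hl g).2, hone, Finset.mul_sum, Real.exp_sum,
    ← Finset.prod_pow, ← Finset.prod_pow, ← Finset.prod_inv_distrib, ← Finset.prod_inv_distrib,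
    ← Finset.prod_mul_distrib]
  have hKN : K ^ N = ∏ _i : Fin N, K := by simp
  rw [hKN, ← Finset.prod_mul_distrib]
  refine Finset.prod_le_prod (fun i _ => by positivity) fun i _ => ?_
  set y := l i ^ 2 / (1 + g ^ 2 * l i ^ 2) with hy
  have hy0 : 0 ≤ y := by positivity
  have hb := one_add_pow_le N (show 0 < 2 * c by positivity) hy0
  rw [← hK] at hb
  have he : -(c / g ^ 2) * (2 * (g ^ 2 * l i ^ 2) / (1 + g ^ 2 * l i ^ 2)) = -(2 * c * y) := by
    rw [hy]; field_simp
  rw [he, Real.exp_neg, ← mul_inv, ← div_eq_mul_inv, inv_eq_one_div,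
    div_le_div_iff₀ (by positivity) (by positivity), one_mul]
  have h1 : 1 + l i ^ 2 ≤ (1 + y) * (1 + g ^ 2 * l i ^ 2) := by
    have : (1 + y) * (1 + g ^ 2 * l i ^ 2) = 1 + g ^ 2 * l i ^ 2 + l i ^ 2 := by
      rw [hy]; field_simp
    rw [this]
    nlinarith [sq_nonneg (g * l i)]
  calc (1 + l i ^ 2) ^ N ≤ ((1 + y) * (1 + g ^ 2 * l i ^ 2)) ^ N := by gcongr
    _ = (1 + y) ^ N * (1 + g ^ 2 * l i ^ 2) ^ N := mul_pow _ _ _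
    _ ≤ (K * Real.exp (2 * c * y)) * (1 + g ^ 2 * l i ^ 2) ^ N := by gcongr
    _ = _ := by ring

/-! ### Laplace asymptotics at fixed size -/

instance instIsProbabilityMeasureHaarUN (N : ℕ) : IsProbabilityMeasure (haarUN N) :=
  ⟨Measure.haarMeasure_self (K₀ := (⊤ : TopologicalSpace.PositiveCompacts (UN N)))⟩

instance instIsMulLeftInvariantHaarUN (N : ℕ) : (haarUN N).IsMulLeftInvariant :=
  Measure.isMulLeftInvariant_haarMeasure _

section Laplace

variable {N : ℕ} {E : Type*} [Fintype E]

theorem haarUN_eq_map (N : ℕ) : haarUN N =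
    ((volume : Measure (Coord N)).withDensity fun a =>
      ENNReal.ofReal ((huaConst N)⁻¹ * cayleyDensity a)).map cayley := by
  rw [haarUN_eq, cayleyMeasure, ← Measure.map_smul]
  congr 1
  rw [← withDensity_smul _ measurable_ofReal_cayleyDensity]
  congr 1
  funext a
  rw [ENNReal.ofReal_mul (inv_nonneg.2 (huaConst_pos N).le)]
  rfl

theorem integral_pi_haarUN (f : (E → UN N) → ℝ) (hf : Measurable f) :
    ∫ U, f U ∂(Measure.pi fun _ : E => haarUN N) =
      ∫ a : E → Coord N, (∏ e, (huaConst N)⁻¹ * cayleyDensity (a e)) * f fun e => cayley (a e) := by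
  have hi : Integrable fun a : Coord N => (huaConst N)⁻¹ * cayleyDensity a :=
    (integrable_cayleyDensity N).const_mul _
  have h0 : ∀ a : Coord N, 0 ≤ (huaConst N)⁻¹ * cayleyDensity a := fun a =>
    mul_nonneg (inv_nonneg.2 (huaConst_pos N).le) (cayleyDensity_nonneg a)
  have : IsFiniteMeasure ((volume : Measure (Coord N)).withDensity fun a =>
      ENNReal.ofReal ((huaConst N)⁻¹ * cayleyDensity a)) := isFiniteMeasure_withDensity_ofReal hi.2
  have hc : Measurable fun (a : E → Coord N) e => cayley (a e) :=
    measurable_pi_iff.2 fun e => continuous_cayley.measurable.comp (measurable_pi_apply e)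
  have hd : Measurable fun a : E → Coord N => ∏ e, (huaConst N)⁻¹ * cayleyDensity (a e) :=
    Finset.measurable_prod _ fun e _ =>
      (continuous_cayleyDensity.measurable.comp (measurable_pi_apply e)).const_mul _
  have hd' : Measurable fun a : E → Coord N =>
      ENNReal.ofReal (∏ e, (huaConst N)⁻¹ * cayleyDensity (a e)) := ENNReal.measurable_ofReal.comp hd
  rw [haarUN_eq_map, ← Measure.pi_map_pi fun _ => continuous_cayley.measurable.aemeasurable,
    integral_map hc.aemeasurable hf.aestronglyMeasurable, pi_withDensity volume hi h0,
    integral_withDensity_eq_integral_toReal_smul hd'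
      (ae_of_all _ fun _ => ENNReal.ofReal_lt_top)]
  refine integral_congr_ae (ae_of_all _ fun a => ?_)
  simp only
  rw [ENNReal.toReal_ofReal (Finset.prod_nonneg fun e _ => h0 _), smul_eq_mul]

theorem cayleyDensity_zero : cayleyDensity (0 : Coord N) = 1 := by
  simp [cayleyDensity]

/-- Substituting (g/2)b for the Cayley coordinates produces the factor (g/2)^(N²|E|) and makes the
integrand converge pointwise. Coercivity of A bounds it by a product of single-link functions, so
dominated convergence applies. -/
theorem tendsto_laplace (A : (E → UN N) → ℝ) (hA : Continuous A) {c : ℝ} (hc : 0 < c)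
    (hlow : ∀ U, c * ∑ e, phi (U e) ≤ A U) (Q : (E → Coord N) → ℝ)
    (hQ : ∀ b : E → Coord N, Tendsto (fun g : ℝ => A (fun e => cayley ((g / 2) • b e)) / g ^ 2)
      (𝓝[>] 0) (𝓝 (Q b / 2))) :
    Tendsto (fun g : ℝ => (g ^ (N * N * Fintype.card E))⁻¹ *
        ∫ U, Real.exp (-(1 / g ^ 2) * A U) ∂(Measure.pi fun _ : E => haarUN N)) (𝓝[>] 0)
      (𝓝 (((huaConst N * 2 ^ (N * N))⁻¹) ^ Fintype.card E *
        ∫ b : E → Coord N, Real.exp (-Q b / 2))) := by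
  have hJ := huaConst_pos N
  have hscale : ∀ g : ℝ, 0 < g → (g ^ (N * N * Fintype.card E))⁻¹ *
      ∫ U, Real.exp (-(1 / g ^ 2) * A U) ∂(Measure.pi fun _ : E => haarUN N) =
      ((huaConst N * 2 ^ (N * N))⁻¹) ^ Fintype.card E * ∫ b : E → Coord N,
        (∏ e, cayleyDensity ((g / 2) • b e)) *
          Real.exp (-(1 / g ^ 2) * A fun e => cayley ((g / 2) • b e)) := by
    intro g hg
    rw [integral_pi_haarUN _ (by
      exact (Real.continuous_exp.comp (continuous_const.mul hA)).measurable)]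
    have : (volume : Measure (Coord N)).IsAddHaarMeasure :=
      Measure.pi.isAddHaarMeasure _
    have : (volume : Measure (E → Coord N)).IsAddHaarMeasure :=
      Measure.pi.isAddHaarMeasure _
    have h1 := Measure.integral_comp_smul_of_nonneg (volume : Measure (E → Coord N))
      (fun a => (∏ e, (huaConst N)⁻¹ * cayleyDensity (a e)) *
        Real.exp (-(1 / g ^ 2) * A fun e => cayley (a e))) (g / 2) (hR := by positivity)
    have hfr : Module.finrank ℝ (E → Coord N) = N * N * Fintype.card E := by
      simp [Module.finrank_pi_fintype, Module.finrank_fintype_fun_eq_card]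
      ring
    rw [hfr, smul_eq_mul] at h1
    have hp : (∏ _e : E, (huaConst N)⁻¹) = ((huaConst N)⁻¹) ^ Fintype.card E := by
      simp
    simp only [Finset.prod_mul_distrib, hp, mul_assoc ((huaConst N)⁻¹ ^ Fintype.card E),
      Pi.smul_apply, integral_const_mul] at h1 ⊢
    rw [div_pow, inv_div] at h1
    have hne : huaConst N ^ Fintype.card E ≠ 0 := by positivity
    have h2 : (∫ a : E → Coord N, (∏ e, cayleyDensity (a e)) *
        Real.exp (-(1 / g ^ 2) * A fun e => cayley (a e))) =
        g ^ (N * N * Fintype.card E) * ((2 ^ (N * N * Fintype.card E))⁻¹ *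
          ∫ b : E → Coord N, (∏ e, cayleyDensity ((g / 2) • b e)) *
          Real.exp (-(1 / g ^ 2) * A fun e => cayley ((g / 2) • b e))) := by
      have h3 : ((huaConst N)⁻¹) ^ Fintype.card E ≠ 0 := by positivity
      have h4 := mul_left_cancel₀ h3 (h1.trans (mul_left_comm _ _ _))
      rw [h4]
      field_simp
    rw [h2, pow_mul 2 (N * N), inv_pow, inv_pow, mul_pow]
    field_simp
  refine Tendsto.congr' (by
    filter_upwards [self_mem_nhdsWithin] with g hg using (hscale g hg).symm)
    (Tendsto.const_mul _ ?_)
  obtain ⟨C, hC0, hC⟩ := exists_cayleyDensity_bound N (show 0 < c by positivity)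
  have hdens : ∀ b : E → Coord N, Tendsto (fun g : ℝ => ∏ e, cayleyDensity ((g / 2) • b e))
      (𝓝[>] 0) (𝓝 1) := by
    intro b
    have hcont : Continuous fun g : ℝ => ∏ e, cayleyDensity ((g / 2) • b e) :=
      continuous_finsetProd _ fun e _ => continuous_cayleyDensity.comp (by fun_prop)
    exact (hcont.tendsto' 0 1 (by simp [cayleyDensity_zero])).mono_left nhdsWithin_le_nhds
  refine tendsto_integral_filter_of_dominated_convergence
    (fun b => ∏ e, C * cayleyDensity ((1 / 2 : ℝ) • b e)) ?_ ?_ ?_ ?_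
  · refine Eventually.of_forall fun g => Continuous.aestronglyMeasurable ?_
    have h1 : Continuous fun b : E → Coord N => ∏ e, cayleyDensity ((g / 2) • b e) :=
      continuous_finsetProd _ fun e _ => continuous_cayleyDensity.comp (by fun_prop)
    have h2 : Continuous fun (b : E → Coord N) e => cayley ((g / 2) • b e) :=
      continuous_pi fun e => continuous_cayley.comp (by fun_prop)
    exact h1.mul (Real.continuous_exp.comp (continuous_const.mul (hA.comp h2)))
  · filter_upwards [self_mem_nhdsWithin, nhdsWithin_le_nhds (Iio_mem_nhds one_pos)] with g hg hg1
    have hg : 0 < g := hg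
    have hg1 : g < 1 := hg1
    refine ae_of_all _ fun b => ?_
    rw [Real.norm_of_nonneg (mul_nonneg (Finset.prod_nonneg fun e _ => cayleyDensity_nonneg _)
      (Real.exp_nonneg _))]
    have h1 : Real.exp (-(1 / g ^ 2) * A fun e => cayley ((g / 2) • b e)) ≤
        ∏ e, Real.exp (-(c / g ^ 2) * phi (cayley ((g / 2) • b e))) := by
      rw [← Real.exp_sum, ← Finset.mul_sum, Real.exp_le_exp]
      have h2 := hlow fun e => cayley ((g / 2) • b e)
      have h3 := mul_le_mul_of_nonneg_left h2 (show 0 ≤ 1 / g ^ 2 by positivity)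
      have h4 : 1 / g ^ 2 * (c * ∑ e, phi (cayley ((g / 2) • b e))) =
          c / g ^ 2 * ∑ e, phi (cayley ((g / 2) • b e)) := by ring
      linarith
    refine (mul_le_mul_of_nonneg_left h1 (Finset.prod_nonneg fun e _ =>
      cayleyDensity_nonneg _)).trans ?_
    rw [← Finset.prod_mul_distrib]
    refine Finset.prod_le_prod (fun e _ => mul_nonneg (cayleyDensity_nonneg _)
      (Real.exp_nonneg _)) fun e _ => ?_
    have h5 := hC g hg hg1.le ((1 / 2 : ℝ) • b e)
    rw [smul_smul, mul_one_div] at h5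
    rw [mul_comm]
    exact h5
  · have h1 : Integrable fun b : Coord N => C * cayleyDensity ((1 / 2 : ℝ) • b) :=
      ((integrable_cayleyDensity N).comp_smul (by norm_num)).const_mul _
    exact Integrable.fintype_prod fun _ => h1
  · refine ae_of_all _ fun b => ?_
    have h1 : Tendsto (fun g : ℝ => Real.exp (-(1 / g ^ 2) * A fun e => cayley ((g / 2) • b e)))
        (𝓝[>] 0) (𝓝 (Real.exp (-Q b / 2))) := by
      refine (Real.continuous_exp.tendsto _).comp ?_
      rw [neg_div]
      refine (hQ b).neg.congr fun g => ?_
      ring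
    simpa using (hdens b).mul h1

/-- The form acts separately on each of the N² matrix coordinates, so the Gaussian integral is a
power of the scalar one. -/
theorem integral_exp_quadratic_coord [DecidableEq E] {M : Matrix E E ℝ} (hM : M.PosDef) :
    ∫ b : E → Coord N, Real.exp (-(∑ i, ∑ j, (fun e => b e i j) ⬝ᵥ M *ᵥ (fun e => b e i j)) / 2) =
      (√(2 * Real.pi) ^ Fintype.card E * (√M.det)⁻¹) ^ (N * N) := by
  rw [← integral_exp_quadratic hM]
  have h1 : MeasurePreserving (fun (b : E → Coord N) e => (MeasurableEquiv.curry (Fin N) (Fin N) ℝ).symm (b e))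
      volume volume := volume_preserving_pi fun _ => measurePreserving_uncurry volume
  have hcont : Continuous fun t : E → ℝ => Real.exp (-(t ⬝ᵥ M *ᵥ t) / 2) := by
    refine Real.continuous_exp.comp (Continuous.div_const (Continuous.neg ?_) _)
    exact continuous_id.dotProduct (continuous_const.matrix_mulVec continuous_id)
  have h2 := integral_prod_swap (A := E) (B := Fin N × Fin N) _ hcont.measurable
  rw [Fintype.card_prod, Fintype.card_fin] at h2
  rw [← h2, ← h1.map_eq, integral_map h1.measurable.aemeasurable]
  · refine integral_congr_ae (ae_of_all _ fun b => ?_)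
    simp only
    rw [← Real.exp_sum, Fintype.sum_prod_type, ← Finset.sum_neg_distrib, Finset.sum_div]
    congr 1
    refine Finset.sum_congr rfl fun i _ => ?_
    rw [← Finset.sum_neg_distrib, Finset.sum_div]
    rfl
  · exact (continuous_finsetProd _ fun p _ => hcont.comp (by fun_prop)).aestronglyMeasurable

/-- The contribution of a single link to the logarithm of the partition function. -/
def linkConst (N : ℕ) : ℝ :=
  Real.log ((∏ j ∈ Finset.Ico 1 N, (Nat.factorial j : ℝ)) / (2 * Real.pi) ^ ((N : ℝ) / 2))

/-- Three sources combine per link: the mass of the Haar density, the factor 2^(N²) from the scale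
g/2, and the Gaussian normalization. Induction on N collapses them to factorials and powers of 2π.
-/
theorem exp_linkConst (N : ℕ) :
    (huaConst N * 2 ^ (N * N))⁻¹ * √(2 * Real.pi) ^ (N * N) = Real.exp (linkConst N) := by
  have hpos : 0 < (∏ j ∈ Finset.Ico 1 N, (Nat.factorial j : ℝ)) :=
    Finset.prod_pos fun j _ => by positivity
  rw [linkConst, Real.exp_log (by positivity)]
  have hf : ∏ j ∈ Finset.Ico 1 N, (Nat.factorial j : ℝ) = ∏ k ∈ Finset.range N, (k.factorial : ℝ) := by
    rcases N with _ | n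
    · simp
    · rw [Finset.range_eq_Ico, Finset.prod_eq_prod_Ico_succ_bot (Nat.succ_pos n)]
      simp
  have hs : (2 * Real.pi) ^ ((N : ℝ) / 2) = √(2 * Real.pi) ^ N := by
    rw [Real.sqrt_eq_rpow, ← Real.rpow_natCast, ← Real.rpow_mul (by positivity)]
    congr 1
    ring
  have hh : huaConst N * 2 ^ (N * N) * ∏ k ∈ Finset.range N, (k.factorial : ℝ) =
      √(2 * Real.pi) ^ (N * N + N) := by
    clear hf hs hpos
    have h2pi : √(2 * Real.pi) ^ 2 = 2 * Real.pi := Real.sq_sqrt (by positivity)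
    induction N with
    | zero => simp [huaConst]
    | succ n ih =>
      rw [huaConst, Finset.prod_range_succ, Finset.prod_range_succ, ← huaConst]
      have e1 : (n + 1) * (n + 1) + (n + 1) = (n * n + n) + 2 * (n + 1) := by ring
      have e2 : (n + 1) * (n + 1) = n * n + (2 * n + 1) := by ring
      rw [e1, e2, pow_add √(2 * Real.pi), pow_mul √(2 * Real.pi) 2, h2pi, ← ih,
        pow_add (2 : ℝ) (n * n), mul_pow, pow_succ (2 : ℝ) (2 * n), two_mul n, pow_add (2 : ℝ) n n]
      field_simp
      ring
  rw [hf, hs]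
  have hprod : (∏ k ∈ Finset.range N, (k.factorial : ℝ)) ≠ 0 :=
    Finset.prod_ne_zero_iff.2 fun k _ => by positivity
  have hJ := (huaConst_pos N).ne'
  rw [inv_mul_eq_div, div_eq_div_iff (by positivity) (by positivity), ← pow_add, ← hh]
  ring

/-- Laplace asymptotics for actions that are quadratic to first order. -/
theorem tendsto_log_laplace [DecidableEq E] (A : (E → UN N) → ℝ) (hA : Continuous A) {c : ℝ}
    (hc : 0 < c) (hlow : ∀ U, c * ∑ e, phi (U e) ≤ A U) {M : Matrix E E ℝ} (hM : M.PosDef)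
    (hQ : ∀ b : E → Coord N, Tendsto (fun g : ℝ => A (fun e => cayley ((g / 2) • b e)) / g ^ 2)
      (𝓝[>] 0) (𝓝 ((∑ i, ∑ j, (fun e => b e i j) ⬝ᵥ M *ᵥ (fun e => b e i j)) / 2))) :
    Tendsto (fun g : ℝ => Real.log (∫ U, Real.exp (-(1 / g ^ 2) * A U)
        ∂(Measure.pi fun _ : E => haarUN N)) -
        Fintype.card E * ((N : ℝ) ^ 2 / 2) * Real.log (g ^ 2)) (𝓝[>] 0)
      (𝓝 (Fintype.card E * linkConst N - (N : ℝ) ^ 2 / 2 * Real.log M.det)) := by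
  have h := tendsto_laplace A hA hc hlow
    (fun b => ∑ i, ∑ j, (fun e => b e i j) ⬝ᵥ M *ᵥ (fun e => b e i j)) hQ
  rw [integral_exp_quadratic_coord hM] at h
  have hdet := hM.det_pos
  have hJ := huaConst_pos N
  have hlim : ((huaConst N * 2 ^ (N * N))⁻¹) ^ Fintype.card E *
      (√(2 * Real.pi) ^ Fintype.card E * (√M.det)⁻¹) ^ (N * N) =
      Real.exp (Fintype.card E * linkConst N - (N : ℝ) ^ 2 / 2 * Real.log M.det) := by
    rw [mul_pow, ← pow_mul, mul_comm (Fintype.card E), pow_mul √(2 * Real.pi), ← mul_assoc, ← mul_pow,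
      exp_linkConst, ← Real.exp_nat_mul, sub_eq_add_neg, Real.exp_add]
    congr 1
    rw [← Real.exp_log (show 0 < (√M.det)⁻¹ by positivity), ← Real.exp_nat_mul, Real.log_inv,
      Real.log_sqrt hdet.le]
    congr 1
    push_cast
    ring
  rw [hlim] at h
  have h2 := ((Real.continuousAt_log (Real.exp_pos _).ne').tendsto).comp h
  rw [Real.log_exp] at h2
  refine h2.congr' ?_
  have hev := h.eventually (lt_mem_nhds (Real.exp_pos _))
  filter_upwards [self_mem_nhdsWithin, hev] with g hg hpos
  have hg : 0 < g := hg
  simp only [Function.comp_apply]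
  have hgp : 0 < (g ^ (N * N * Fintype.card E))⁻¹ := by positivity
  rw [Real.log_mul hgp.ne' (pos_of_mul_pos_right hpos hgp.le).ne', Real.log_inv, Real.log_pow,
    Real.log_pow]
  push_cast
  ring

end Laplace

/-! ### Gauge fixing and integration of single links -/

/-- A right translate is again a Haar probability measure, so uniqueness applies. -/
instance instIsMulRightInvariantHaarUN (N : ℕ) : (haarUN N).IsMulRightInvariant := by
  have : (haarUN N).IsHaarMeasure := inferInstanceAs (Measure.haarMeasure _).IsHaarMeasure
  refine ⟨fun V => ?_⟩
  have h1 : IsProbabilityMeasure (Measure.map (· * V) (haarUN N)) :=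
    Measure.isProbabilityMeasure_map (measurable_mul_const V).aemeasurable
  exact Measure.isHaarMeasure_eq_of_isProbabilityMeasure _ _

/-! ### Conditioning on some coordinates of a product measure -/

section Product

variable {X : Type*} [MeasurableSpace X] {E : Type*} [Fintype E]

open scoped Classical in
theorem measurePreserving_piecewise (μ : Measure X) [IsProbabilityMeasure μ] (T : Set E) :
    MeasurePreserving (fun p : (E → X) × (E → X) => T.piecewise p.1 p.2)
      ((Measure.pi fun _ => μ).prod (Measure.pi fun _ => μ)) (Measure.pi fun _ => μ) := by
  have hm : Measurable fun p : (E → X) × (E → X) => T.piecewise p.1 p.2 := by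
    refine measurable_pi_iff.2 fun e => ?_
    by_cases he : e ∈ T
    · simp only [Set.piecewise, if_pos he]
      fun_prop
    · simp only [Set.piecewise, if_neg he]
      fun_prop
  refine ⟨hm, (Measure.pi_eq fun s hs => ?_).symm⟩
  rw [Measure.map_apply hm (MeasurableSet.univ_pi hs)]
  have h : (fun p : (E → X) × (E → X) => T.piecewise p.1 p.2) ⁻¹' Set.univ.pi s =
      (Set.univ.pi (T.piecewise s fun _ => Set.univ)) ×ˢ
        (Set.univ.pi (T.piecewise (fun _ => Set.univ) s)) := by
    ext p
    simp only [Set.mem_preimage, Set.mem_univ_pi, Set.mem_prod]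
    rw [← forall_and]
    refine forall_congr' fun e => ?_
    by_cases he : e ∈ T <;> simp [Set.piecewise, he]
  rw [h, Measure.prod_prod, Measure.pi_pi, Measure.pi_pi, ← Finset.prod_mul_distrib]
  refine Finset.prod_congr rfl fun e _ => ?_
  by_cases he : e ∈ T <;> simp [Set.piecewise, he]

open scoped Classical in
theorem integral_piecewise (μ : Measure X) [IsProbabilityMeasure μ] (T : Set E) {f : (E → X) → ℝ}
    (hf : Integrable f (Measure.pi fun _ => μ)) :
    ∫ V, ∫ U, f (T.piecewise V U) ∂(Measure.pi fun _ => μ) ∂(Measure.pi fun _ => μ) =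
      ∫ U, f U ∂(Measure.pi fun _ => μ) := by
  have h := measurePreserving_piecewise μ T
  rw [← integral_prod (fun p : (E → X) × (E → X) => f (T.piecewise p.1 p.2))
    (h.integrable_comp_of_integrable hf)]
  conv_rhs => rw [← h.map_eq, integral_map h.measurable.aemeasurable
    (by rw [h.map_eq]; exact hf.aestronglyMeasurable)]

theorem integral_update [DecidableEq E] (μ : Measure X) [IsProbabilityMeasure μ] (e : E)
    {f : (E → X) → ℝ} (hm : Measurable f) (hf : Integrable f (Measure.pi fun _ => μ)) :
    ∫ U, ∫ x, f (Function.update U e x) ∂μ ∂(Measure.pi fun _ => μ) =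
      ∫ U, f U ∂(Measure.pi fun _ => μ) := by
  classical
  rw [← integral_piecewise μ {e}ᶜ hf]
  refine integral_congr_ae (ae_of_all _ fun U => ?_)
  have hp : ∀ (V : E → X) (inst : ∀ i, Decidable (i ∈ ({e}ᶜ : Set E))),
      @Set.piecewise E (fun _ => X) {e}ᶜ U V inst = Function.update U e (V e) := by
    intro V _
    funext i
    by_cases hi : i = e
    · subst hi
      simp [Set.piecewise]
    · simp [Set.piecewise, hi]
  have he := measurePreserving_eval (fun _ : E => μ) e
  simp only [hp]
  conv_lhs => rw [← he.map_eq, integral_map he.measurable.aemeasurable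
    (Measurable.aestronglyMeasurable (by fun_prop))]

/-- Links that can be integrated out one after the other. -/
theorem integral_mul_prod_eq [DecidableEq E] (μ : Measure X) [IsProbabilityMeasure μ] (R : Finset E)
    (rank : E → ℤ) (ψ : E → (E → X) → ℝ) (z : ℝ) (G : (E → X) → ℝ) (hGm : Measurable G)
    (hGb : ∀ U, G U ∈ Set.Icc (0 : ℝ) 1) (hψm : ∀ e, Measurable (ψ e))
    (hψb : ∀ e U, ψ e U ∈ Set.Icc (0 : ℝ) 1)
    (hG : ∀ e ∈ R, ∀ U x, G (Function.update U e x) = G U)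
    (hψ : ∀ e ∈ R, ∀ e' ∈ R, e' ≠ e → rank e ≤ rank e' →
      ∀ U x, ψ e (Function.update U e' x) = ψ e U)
    (hz : ∀ e ∈ R, ∀ U, ∫ x, ψ e (Function.update U e x) ∂μ = z) :
    ∫ U, G U * ∏ e ∈ R, ψ e U ∂(Measure.pi fun _ => μ) =
      z ^ R.card * ∫ U, G U ∂(Measure.pi fun _ => μ) := by
  -- The link of largest rank enters only its own factor, so it is integrated first and yields z
  -- whatever the other links are.
  induction R using Finset.induction_on_max_value rank with
  | empty => simp
  | insert a s ha hmax ih =>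
    rw [Finset.card_insert_of_notMem ha, pow_succ', mul_assoc, ← ih
      (fun e he => hG e (Finset.mem_insert_of_mem he))
      (fun e he e' he' => hψ e (Finset.mem_insert_of_mem he) e' (Finset.mem_insert_of_mem he'))
      (fun e he => hz e (Finset.mem_insert_of_mem he))]
    have hmeas : Measurable fun U => G U * ∏ e ∈ insert a s, ψ e U :=
      hGm.mul (Finset.measurable_prod _ fun e _ => hψm e)
    have hint : Integrable (fun U => G U * ∏ e ∈ insert a s, ψ e U) (Measure.pi fun _ : E => μ) := by
      refine Integrable.of_bound (C := 1) hmeas.aestronglyMeasurable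
        (ae_of_all _ fun U => ?_)
      have h1 : 0 ≤ ∏ e ∈ insert a s, ψ e U := Finset.prod_nonneg fun e _ => (hψb e U).1
      have h2 : ∏ e ∈ insert a s, ψ e U ≤ 1 :=
        Finset.prod_le_one (fun e _ => (hψb e U).1) fun e _ => (hψb e U).2
      rw [Real.norm_of_nonneg (mul_nonneg (hGb U).1 h1)]
      exact mul_le_one₀ (hGb U).2 h1 h2
    rw [← integral_update μ a hmeas hint, ← integral_const_mul]
    refine integral_congr_ae (ae_of_all _ fun U => ?_)
    have hrest : ∀ x, ∏ e ∈ s, ψ e (Function.update U a x) = ∏ e ∈ s, ψ e U := fun x =>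
      Finset.prod_congr rfl fun e he => hψ e (Finset.mem_insert_of_mem he) a
        (Finset.mem_insert_self _ _) (fun h => ha (h ▸ he)) (hmax e he) U x
    simp only [Finset.prod_insert ha, hrest, hG a (Finset.mem_insert_self _ _)]
    rw [integral_const_mul, integral_mul_const, hz a (Finset.mem_insert_self _ _)]
    ring

end Product

/-! ### Gauge transformations and gauge fixing along a tree -/

section Gauge

variable {d N : ℕ} {Λ : Finset (Fin d → ℤ)}

theorem mem_edges {e : (Fin d → ℤ) × Fin d} :
    e ∈ edges Λ ↔ e.1 ∈ Λ ∧ e.1 + stdVec e.2 ∈ Λ := by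
  simp [edges]

theorem mem_plaquettes {p : (Fin d → ℤ) × Fin d × Fin d} :
    p ∈ plaquettes Λ ↔ p.1 ∈ Λ ∧ p.2.1 < p.2.2 ∧ p.1 + stdVec p.2.1 ∈ Λ ∧
      p.1 + stdVec p.2.2 ∈ Λ ∧ p.1 + stdVec p.2.1 + stdVec p.2.2 ∈ Λ := by
  simp [plaquettes]

/-- The product of `u` around a plaquette. -/
def holonomy {G : Type*} [Group G] (u : (Fin d → ℤ) × Fin d → G)
    (p : (Fin d → ℤ) × Fin d × Fin d) : G :=
  u (p.1, p.2.1) * u (p.1 + stdVec p.2.1, p.2.2) * (u (p.1 + stdVec p.2.2, p.2.1))⁻¹ *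
    (u (p.1, p.2.2))⁻¹

/-- The four positively oriented edges around a plaquette. -/
def boundary (p : (Fin d → ℤ) × Fin d × Fin d) : Fin 4 → (Fin d → ℤ) × Fin d :=
  ![(p.1, p.2.1), (p.1 + stdVec p.2.1, p.2.2), (p.1 + stdVec p.2.2, p.2.1), (p.1, p.2.2)]

theorem holonomy_eq {G : Type*} [Group G] (u : (Fin d → ℤ) × Fin d → G)
    (p : (Fin d → ℤ) × Fin d × Fin d) :
    holonomy u p = u (boundary p 0) * u (boundary p 1) * (u (boundary p 2))⁻¹ *
      (u (boundary p 3))⁻¹ := rfl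

theorem boundary_mem_edges {p : (Fin d → ℤ) × Fin d × Fin d} (hp : p ∈ plaquettes Λ) (s : Fin 4) :
    boundary p s ∈ edges Λ := by
  obtain ⟨h0, -, h1, h2, h3⟩ := mem_plaquettes.1 hp
  fin_cases s
  · exact mem_edges.2 ⟨h0, h1⟩
  · exact mem_edges.2 ⟨h1, h3⟩
  · exact mem_edges.2 ⟨h2, by rwa [add_right_comm] at h3⟩
  · exact mem_edges.2 ⟨h0, h2⟩

/-- The extension of a configuration by `1`. -/
def Config.ext (U : Config N Λ) (e : (Fin d → ℤ) × Fin d) : UN N := U.link e.1 e.2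

theorem Config.ext_coe (U : Config N Λ) (e : edges Λ) : U.ext e = U e := by
  simp [Config.ext, Config.link]

theorem Config.ext_mem (U : Config N Λ) {e : (Fin d → ℤ) × Fin d} (he : e ∈ edges Λ) :
    U.ext e = U ⟨e, he⟩ := U.ext_coe ⟨e, he⟩

theorem wilsonAction_eq (U : Config N Λ) :
    wilsonAction U = ∑ p ∈ plaquettes Λ, phi (holonomy U.ext p) := rfl

theorem continuous_ext (e : (Fin d → ℤ) × Fin d) : Continuous fun U : Config N Λ => U.ext e := by
  by_cases he : e ∈ edges Λ
  · simp only [Config.ext_mem _ he]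
    fun_prop
  · simp only [Config.ext, Config.link, Prod.mk.eta, he, dite_false]
    fun_prop

theorem continuous_holonomy (p : (Fin d → ℤ) × Fin d × Fin d) :
    Continuous fun U : Config N Λ => holonomy U.ext p :=
  (((continuous_ext _).mul (continuous_ext _)).mul (continuous_ext _).inv).mul (continuous_ext _).inv

theorem continuous_wilsonAction : Continuous fun U : Config N Λ => wilsonAction U := by
  simp only [wilsonAction_eq]
  exact continuous_finsetSum _ fun p _ => continuous_phi.comp (continuous_holonomy p)

theorem wilsonAction_nonneg (U : Config N Λ) : 0 ≤ wilsonAction U :=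
  Finset.sum_nonneg fun _ _ => phi_nonneg _

theorem phi_conj (V U : UN N) : phi (V * U * V⁻¹) = phi U := by
  simp only [phi, Matrix.trace_sub, Submonoid.coe_mul]
  rw [Matrix.trace_mul_comm, ← Matrix.mul_assoc, ← Submonoid.coe_mul, inv_mul_cancel]
  simp

theorem phi_inv (U : UN N) : phi U⁻¹ = phi U := by
  rw [phi_eq_dev, phi_eq_dev, dev_inv]

/-- The action of a gauge transformation. -/
def gaugeAct (h : (Fin d → ℤ) → UN N) (U : Config N Λ) : Config N Λ := fun e =>
  h e.1.1 * U e * (h (e.1.1 + stdVec e.1.2))⁻¹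

theorem ext_gaugeAct (h : (Fin d → ℤ) → UN N) (U : Config N Λ) {e : (Fin d → ℤ) × Fin d}
    (he : e ∈ edges Λ) : (gaugeAct h U).ext e = h e.1 * U.ext e * (h (e.1 + stdVec e.2))⁻¹ := by
  rw [Config.ext_mem _ he, Config.ext_mem _ he, gaugeAct]

theorem wilsonAction_gaugeAct (h : (Fin d → ℤ) → UN N) (U : Config N Λ) :
    wilsonAction (gaugeAct h U) = wilsonAction U := by
  rw [wilsonAction_eq, wilsonAction_eq]
  refine Finset.sum_congr rfl fun p hp => ?_
  rw [holonomy_eq, ext_gaugeAct h U (boundary_mem_edges hp 0),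
    ext_gaugeAct h U (boundary_mem_edges hp 1), ext_gaugeAct h U (boundary_mem_edges hp 2),
    ext_gaugeAct h U (boundary_mem_edges hp 3), ← phi_conj (h p.1) (holonomy U.ext p), holonomy_eq]
  congr 1
  simp only [boundary, Matrix.cons_val, add_right_comm p.1 (stdVec p.2.2) (stdVec p.2.1)]
  group

theorem measurePreserving_mul_mul (V W : UN N) :
    MeasurePreserving (fun U : UN N => V * U * W) (haarUN N) (haarUN N) :=
  (measurePreserving_mul_right (haarUN N) W).comp (measurePreserving_mul_left (haarUN N) V)

theorem measurePreserving_gaugeAct (h : (Fin d → ℤ) → UN N) :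
    MeasurePreserving (gaugeAct (Λ := Λ) h) (productHaar N Λ) (productHaar N Λ) :=
  measurePreserving_pi (fun _ : edges Λ => haarUN N) (fun _ : edges Λ => haarUN N)
    fun e => measurePreserving_mul_mul (h e.1.1) (h (e.1.1 + stdVec e.1.2))⁻¹

instance : IsProbabilityMeasure (productHaar N Λ) :=
  inferInstanceAs (IsProbabilityMeasure (Measure.pi fun _ => haarUN N))

open scoped Classical in
/-- The configuration with the links in `T` replaced by `1`. -/
def fixOne (T : Set ((Fin d → ℤ) × Fin d)) (U : Config N Λ) : Config N Λ := fun e =>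
  if e.1 ∈ T then 1 else U e

theorem continuous_fixOne (T : Set ((Fin d → ℤ) × Fin d)) :
    Continuous (fixOne T : Config N Λ → Config N Λ) := by
  refine continuous_pi fun e => ?_
  by_cases he : e.1 ∈ T
  · simp only [fixOne, if_pos he]
    fun_prop
  · simp only [fixOne, if_neg he]
    fun_prop

theorem ext_fixOne (T : Set ((Fin d → ℤ) × Fin d)) (U : Config N Λ) (e : (Fin d → ℤ) × Fin d)
    [Decidable (e ∈ T)] : (fixOne T U).ext e = if e ∈ T then 1 else U.ext e := by
  by_cases he : e ∈ edges Λ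
  · rw [Config.ext_mem _ he, Config.ext_mem _ he, fixOne]
    congr
  · simp [Config.ext, Config.link, he]

theorem integrable_of_continuous {f : Config N Λ → ℝ} (hf : Continuous f) :
    Integrable f (productHaar N Λ) := by
  obtain ⟨C, hC⟩ := (isCompact_univ.image hf).isBounded.exists_norm_le
  exact Integrable.of_bound hf.measurable.aestronglyMeasurable C
    (ae_of_all _ fun U => hC _ ⟨U, trivial, rfl⟩)

/-- Condition on the links V in T. A gauge transformation depending on V alone sends them to 1,
preserves f, and preserves the law of the remaining links, so the conditional integral does not
depend on V. -/
theorem integral_fixOne (T : Set ((Fin d → ℤ) × Fin d))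
    (hT : ∀ V : Config N Λ, ∃ h : (Fin d → ℤ) → UN N, ∀ e : edges Λ, e.1 ∈ T → gaugeAct h V e = 1)
    {f : Config N Λ → ℝ} (hf : Continuous f) (hinv : ∀ h U, f (gaugeAct h U) = f U) :
    ∫ U, f (fixOne T U) ∂(productHaar N Λ) = ∫ U, f U ∂(productHaar N Λ) := by
  classical
  have key := integral_piecewise (haarUN N) {e : edges Λ | e.1 ∈ T} (integrable_of_continuous hf)
  rw [productHaar, ← key]
  have hV : ∀ V : Config N Λ,
      ∫ U, f (Set.piecewise {e : edges Λ | e.1 ∈ T} V U) ∂(Measure.pi fun _ => haarUN N) =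
      ∫ U, f (fixOne T U) ∂(productHaar N Λ) := by
    intro V
    obtain ⟨h, hh⟩ := hT V
    have h1 := measurePreserving_gaugeAct (Λ := Λ) h
    have hc : Continuous fun U : Config N Λ => f (fixOne T U) := hf.comp (continuous_fixOne T)
    conv_rhs => rw [← h1.map_eq, integral_map h1.measurable.aemeasurable
      hc.measurable.aestronglyMeasurable]
    refine integral_congr_ae (ae_of_all _ fun U => ?_)
    refine (hinv h _).symm.trans (congrArg f (funext fun e => ?_))
    by_cases he : e.1 ∈ T
    · simpa [fixOne, he, gaugeAct, Set.piecewise] using hh e he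
    · simp [fixOne, he, gaugeAct, Set.piecewise]
  rw [← integral_congr_ae (ae_of_all _ fun V => (hV V).symm)]
  simp [productHaar]

theorem mem_box {n : ℕ} {x : Fin d → ℤ} : x ∈ box d n ↔ ∀ i, 0 ≤ x i ∧ x i < n := by
  simp [box]

theorem sum_add_stdVec (x : Fin d → ℤ) (j : Fin d) : ∑ i, (x + stdVec j) i = ∑ i, x i + 1 := by
  simp [stdVec, Finset.sum_add_distrib]

/-- A set of edges with at most one edge ending at each vertex can be gauged to `1`. -/
theorem exists_gaugeAct_eq_one {n : ℕ} {T : Set ((Fin d → ℤ) × Fin d)}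
    (hT : ∀ e ∈ edges (box d n), ∀ e' ∈ edges (box d n), e ∈ T → e' ∈ T →
      e.1 + stdVec e.2 = e'.1 + stdVec e'.2 → e.2 = e'.2) (V : Config N (box d n)) :
    ∃ h : (Fin d → ℤ) → UN N, ∀ e : edges (box d n), e.1 ∈ T → gaugeAct h V e = 1 := by
  classical
  let P : (Fin d → ℤ) → Fin d → Prop := fun y j =>
    (y - stdVec j, j) ∈ edges (box d n) ∧ (y - stdVec j, j) ∈ T
  -- The gauge at y is forced by the edge of T ending at y, if there is one. The recursion runs over
  -- the coordinate sum, which grows by one along every edge; no cycle can obstruct it.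
  let H : ℕ → (Fin d → ℤ) → UN N := fun k => Nat.rec (fun _ => 1)
    (fun _ H y => if hy : ∃ j, P y j then
      H (y - stdVec hy.choose) * V.ext (y - stdVec hy.choose, hy.choose) else 1) k
  have Hsucc : ∀ k y, H (k + 1) y = if hy : ∃ j, P y j then
      H k (y - stdVec hy.choose) * V.ext (y - stdVec hy.choose, hy.choose) else 1 := fun _ _ => rfl
  refine ⟨fun y => H (∑ i, y i).toNat y, ?_⟩
  rintro ⟨⟨x, j⟩, he⟩ hj
  have hx : 0 ≤ ∑ i, x i := Finset.sum_nonneg fun i _ => (mem_box.1 (mem_edges.1 he).1 i).1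
  have hP : P (x + stdVec j) j := by
    simp only [P, add_sub_cancel_right]
    exact ⟨he, hj⟩
  have hy : ∃ j', P (x + stdVec j) j' := ⟨j, hP⟩
  have hc : hy.choose = j := by
    have h1 := hy.choose_spec
    exact hT _ h1.1 _ he h1.2 hj (by simp)
  have hs : (∑ i, (x + stdVec j) i).toNat = (∑ i, x i).toNat + 1 := by
    rw [sum_add_stdVec]
    omega
  simp only [gaugeAct]
  rw [hs, Hsucc, dif_pos hy, hc, add_sub_cancel_right, V.ext_mem he, mul_inv_eq_one]

end Gauge

/-! ### Spanning trees and the discrete Stokes theorem -/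

section Tree

variable {d : ℕ}

theorem stdVec_apply (j i : Fin d) : stdVec j i = if i = j then 1 else 0 := by
  simp [stdVec, Pi.single_apply]

theorem mem_edges_box {n : ℕ} {x : Fin d → ℤ} {j : Fin d} :
    (x, j) ∈ edges (box d n) ↔ (∀ i, 0 ≤ x i ∧ x i < n) ∧ x j + 1 < n := by
  rw [mem_edges, mem_box, mem_box]
  refine and_congr_right fun h => ⟨fun h' => ?_, fun h' i => ?_⟩
  · simpa [stdVec_apply] using (h' j).2
  · rw [Pi.add_apply, stdVec_apply]
    have h1 : 0 ≤ x i ∧ x i < n := h i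
    simp only
    split_ifs with hi
    · subst hi
      omega
    · omega

theorem mem_axialEdges {n : ℕ} {e : (Fin d → ℤ) × Fin d} :
    e ∈ axialEdges d n ↔ e ∈ edges (box d n) ∧ ∀ k, e.2 < k → e.1 k = 0 := by
  simp [axialEdges]

/-- The edges `(x, j)` for which `j` is the last direction in which the predicate `I` holds at the
end point, or, if there is none, the last direction with non-zero coordinate. -/
def treeEdges (I : (Fin d → ℤ) → Fin d → Prop) : Set ((Fin d → ℤ) × Fin d) :=
  {e | (I (e.1 + stdVec e.2) e.2 ∧ ∀ k, e.2 < k → ¬ I (e.1 + stdVec e.2) k) ∨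
    ((∀ k, ¬ I (e.1 + stdVec e.2) k) ∧ ∀ k, e.2 < k → (e.1 + stdVec e.2) k = 0)}

theorem mem_treeEdges {I : (Fin d → ℤ) → Fin d → Prop} {e : (Fin d → ℤ) × Fin d} :
    e ∈ treeEdges I ↔ (I (e.1 + stdVec e.2) e.2 ∧ ∀ k, e.2 < k → ¬ I (e.1 + stdVec e.2) k) ∨
    ((∀ k, ¬ I (e.1 + stdVec e.2) k) ∧ ∀ k, e.2 < k → (e.1 + stdVec e.2) k = 0) := Iff.rfl

theorem treeEdges_unique {n : ℕ} (I : (Fin d → ℤ) → Fin d → Prop) :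
    ∀ e ∈ edges (box d n), ∀ e' ∈ edges (box d n), e ∈ treeEdges I → e' ∈ treeEdges I →
      e.1 + stdVec e.2 = e'.1 + stdVec e'.2 → e.2 = e'.2 := by
  have key : ∀ e ∈ edges (box d n), ∀ e' ∈ edges (box d n), e ∈ treeEdges I → e' ∈ treeEdges I →
      e.1 + stdVec e.2 = e'.1 + stdVec e'.2 → ¬ e.2 < e'.2 := by
    intro e he e' he' h h' hy hlt
    rw [mem_treeEdges] at h h'
    rw [← hy] at h'
    rcases h with ⟨h1, h2⟩ | ⟨h1, h2⟩ <;> rcases h' with ⟨h3, h4⟩ | ⟨h3, h4⟩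
    · exact h2 _ hlt h3
    · exact h3 _ h1
    · exact h1 _ h3
    · have h5 := h2 _ hlt
      rw [hy, Pi.add_apply, stdVec_apply, if_pos rfl] at h5
      have := (mem_edges_box.1 he').1 e'.2
      omega
  intro e he e' he' h h' hy
  exact le_antisymm (not_lt.1 (key e' he' e he h' h hy.symm)) (not_lt.1 (key e he e' he' h h' hy))

theorem treeEdges_exists {n : ℕ} {I : (Fin d → ℤ) → Fin d → Prop}
    {y : Fin d → ℤ} (hI : ∀ k, I y k → y k ≠ 0) (hy : y ∈ box d n) (h0 : y ≠ 0) :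
    ∃ j, (y - stdVec j, j) ∈ edges (box d n) ∧ (y - stdVec j, j) ∈ treeEdges I := by
  classical
  have hedge : ∀ j, y j ≠ 0 → (y - stdVec j, j) ∈ edges (box d n) := by
    intro j hj
    refine mem_edges.2 ⟨mem_box.2 fun i => ?_, by simpa using hy⟩
    have h1 := mem_box.1 hy i
    simp only [Pi.sub_apply, stdVec_apply]
    split_ifs with hi
    · subst hi
      omega
    · omega
  have hmax : ∀ P : Fin d → Prop, (∃ j, P j) → ∃ j, P j ∧ ∀ k, j < k → ¬ P k := by
    intro P hP
    obtain ⟨j, hj, hj'⟩ := (Finset.univ.filter P).exists_max_image id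
      (by simpa [Finset.filter_nonempty_iff] using hP)
    refine ⟨j, by simpa using hj, fun k hk hPk => ?_⟩
    exact absurd (hj' k (by simpa using hPk)) (not_le.2 hk)
  by_cases hex : ∃ k, I y k
  · obtain ⟨j, hj, hj'⟩ := hmax _ hex
    refine ⟨j, hedge j (hI j hj), mem_treeEdges.2 (Or.inl ?_)⟩
    simpa using ⟨hj, hj'⟩
  · obtain ⟨j, hj, hj'⟩ := hmax (fun k => y k ≠ 0) (by
      by_contra hne
      push Not at hne
      exact h0 (funext hne))
    refine ⟨j, hedge j hj, mem_treeEdges.2 (Or.inr ?_)⟩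
    push Not at hex hj'
    simpa using ⟨hex, hj'⟩

theorem card_box (d n : ℕ) : (box d n).card = n ^ d := by
  simp [box]

-- Sending an edge to its end point is a bijection from the tree onto the non-zero vertices of the
-- box.
open scoped Classical in
theorem card_treeEdges {n : ℕ} (hn : 1 ≤ n) {I : (Fin d → ℤ) → Fin d → Prop}
    (hI : ∀ y ∈ box d n, ∀ k, I y k → y k ≠ 0) :
    ((edges (box d n)).filter (· ∈ treeEdges I)).card + 1 = n ^ d := by
  have h0 : (0 : Fin d → ℤ) ∈ box d n := mem_box.2 fun i => ⟨le_rfl, by simp; omega⟩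
  rw [← card_box, ← Finset.card_erase_add_one h0]
  congr 1
  refine Finset.card_bij (fun e _ => e.1 + stdVec e.2) ?_ ?_ ?_
  · intro e he
    have he := (Finset.mem_filter.1 he).1
    refine Finset.mem_erase.2 ⟨fun h => ?_, (mem_edges.1 he).2⟩
    have h1 := congrFun h e.2
    rw [Pi.add_apply, stdVec_apply, if_pos rfl, Pi.zero_apply] at h1
    have := (mem_edges_box.1 he).1 e.2
    omega
  · intro e he e' he' h
    rw [Finset.mem_filter] at he he'
    have h2 := treeEdges_unique I e he.1 e' he'.1 he.2 he'.2 h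
    refine Prod.ext ?_ h2
    rw [h2] at h
    exact add_right_cancel h
  · intro y hy
    obtain ⟨hy0, hy⟩ := Finset.mem_erase.1 hy
    obtain ⟨j, h1, h2⟩ := treeEdges_exists (hI y hy) hy hy0
    exact ⟨(y - stdVec j, j), Finset.mem_filter.2 ⟨h1, h2⟩, by simp⟩

/-- With no distinguished directions the tree rule falls back on the last non-zero coordinate of the
end point, which is the axial gauge. -/
theorem mem_axialEdges_iff_tree {n : ℕ} {e : (Fin d → ℤ) × Fin d} :
    e ∈ axialEdges d n ↔ e ∈ edges (box d n) ∧ e ∈ treeEdges (fun _ _ => False) := by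
  rw [mem_axialEdges, mem_treeEdges]
  refine and_congr_right fun _ => ?_
  simp only [false_and, not_false_eq_true, implies_true, true_and, false_or, Pi.add_apply]
  refine forall_congr' fun k => forall_congr' fun hk => ?_
  rw [stdVec_apply, if_neg hk.ne', add_zero]

theorem card_axialEdges {n : ℕ} (hn : 1 ≤ n) : (axialEdges d n).card + 1 = n ^ d := by
  classical
  rw [← card_treeEdges hn (I := fun _ _ => False) (by simp)]
  congr 2
  ext e
  rw [mem_axialEdges_iff_tree, Finset.mem_filter]

theorem card_edges_box (n : ℕ) : (edges (box 4 n)).card = 4 * ((n - 1) * n ^ 3) := by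
  have h : edges (box 4 n) = (Finset.univ : Finset (Fin 4)).biUnion fun j =>
      (Fintype.piFinset fun i : Fin 4 => Finset.Ico (0 : ℤ) (if i = j then ((n - 1 : ℕ) : ℤ) else n)).image
        fun x => (x, j) := by
    ext ⟨x, j⟩
    simp only [Finset.mem_biUnion, Finset.mem_univ, true_and, Finset.mem_image,
      Fintype.mem_piFinset, Finset.mem_Ico, Prod.mk.injEq]
    rw [mem_edges_box]
    constructor
    · rintro ⟨h1, h2⟩
      refine ⟨j, x, fun i => ⟨(h1 i).1, ?_⟩, rfl, rfl⟩
      split_ifs with hi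
      · subst hi
        omega
      · exact (h1 i).2
    · rintro ⟨j', x', h1, rfl, rfl⟩
      refine ⟨fun i => ⟨(h1 i).1, ?_⟩, ?_⟩
      · have := (h1 i).2
        split_ifs at this <;> omega
      · have := h1 j'
        rw [if_pos rfl] at this
        omega
  rw [h, Finset.card_biUnion]
  · have : ∀ j : Fin 4, ((Fintype.piFinset fun i : Fin 4 =>
        Finset.Ico (0 : ℤ) (if i = j then ((n - 1 : ℕ) : ℤ) else n)).image fun x => (x, j)).card =
        (n - 1) * n ^ 3 := by
      intro j
      rw [Finset.card_image_of_injective _ (fun a b hab => (Prod.mk.inj hab).1),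
        Fintype.card_piFinset]
      rw [← Finset.mul_prod_erase _ _ (Finset.mem_univ j), if_pos rfl, Finset.prod_congr rfl
        (g := fun _ => n) (fun i hi => by rw [if_neg (Finset.ne_of_mem_erase hi)]; simp)]
      simp
    rw [Finset.sum_congr rfl fun j _ => this j]
    simp
  · intro i _ j _ hij
    rw [Function.onFun, Finset.disjoint_left]
    intro e he he'
    obtain ⟨x, -, rfl⟩ := Finset.mem_image.1 he
    obtain ⟨x', -, h'⟩ := Finset.mem_image.1 he'
    exact hij (Prod.mk.inj h').2.symm

theorem axialEdges_subset (d n : ℕ) : axialEdges d n ⊆ edges (box d n) :=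
  Finset.filter_subset _ _

/-- Each of the four directions has (n - 1)n³ edges and the axial tree removes n⁴ - 1. Divided by
2n⁴ this is the coefficient 3/2 - 2/n + 1/(2n⁴) of N² log g². -/
theorem card_freeEdges {n : ℕ} (hn : 1 ≤ n) :
    ((freeEdges 4 n).card : ℝ) = 3 * (n : ℝ) ^ 4 - 4 * (n : ℝ) ^ 3 + 1 := by
  rw [freeEdges, Finset.card_sdiff_of_subset (axialEdges_subset 4 n),
    Nat.cast_sub (Finset.card_le_card (axialEdges_subset 4 n)), card_edges_box]
  have h := card_axialEdges (d := 4) hn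
  have h2 : ((axialEdges 4 n).card : ℝ) + 1 = (n : ℝ) ^ 4 := by exact_mod_cast h
  push_cast [Nat.cast_sub hn]
  linarith

/-- Discrete Stokes theorem in the axial gauge. -/
theorem le_of_axial {m : ℕ} (D : (Fin d → ℤ) × Fin d → ℝ) {s : ℝ}
    (h0 : ∀ e ∈ axialEdges d m, D e = 0)
    (hp : ∀ p ∈ plaquettes (box d m),
      D (boundary p 2) ≤ D (boundary p 0) + D (boundary p 1) + D (boundary p 3) + s)
    (hs : 0 ≤ s) : ∀ e ∈ edges (box d m), D e ≤ ((∑ i, e.1 i : ℤ) : ℝ) * s := by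
  classical
  suffices H : ∀ k : ℕ, ∀ e ∈ edges (box d m), (∑ i, e.1 i) = k → D e ≤ (k : ℝ) * s by
    intro e he
    have hnn : 0 ≤ ∑ i, e.1 i := Finset.sum_nonneg fun i _ => (mem_box.1 (mem_edges.1 he).1 i).1
    obtain ⟨k, hk⟩ := Int.eq_ofNat_of_zero_le hnn
    rw [hk]
    exact_mod_cast H k e he hk
  intro k
  induction k with
  | zero =>
    intro e he hsum
    have hz : ∀ i, e.1 i = 0 := by
      have := (Finset.sum_eq_zero_iff_of_nonneg
        (fun i _ => (mem_box.1 (mem_edges.1 he).1 i).1)).1 (by exact_mod_cast hsum)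
      exact fun i => this i (Finset.mem_univ i)
    rw [h0 e (mem_axialEdges.2 ⟨he, fun i _ => hz i⟩)]
    simp
  | succ k ih =>
    rintro ⟨x, j⟩ he hsum
    by_cases hax : (x, j) ∈ axialEdges d m
    · rw [h0 _ hax]
      positivity
    have hex : ∃ l, j < l ∧ x l ≠ 0 := by
      by_contra hne
      push Not at hne
      exact hax (mem_axialEdges.2 ⟨he, hne⟩)
    -- Take the last direction l with a non-zero coordinate. In the plaquette (x - e_l, j, l) both
    -- edges in direction l are axial, so D at (x, j) exceeds D at (x - e_l, j) by at most s, and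
    -- the coordinate sum has dropped by one.
    obtain ⟨l, hl, hmax⟩ := (Finset.univ.filter fun l => j < l ∧ x l ≠ 0).exists_max_image id
      (by simpa [Finset.filter_nonempty_iff] using hex)
    simp only [Finset.mem_filter, Finset.mem_univ, true_and, id] at hl hmax
    have hx0 : ∀ i, l < i → x i = 0 := fun i hi => by
      by_contra hne
      exact absurd (hmax i ⟨hl.1.trans hi, hne⟩) (not_le.2 hi)
    obtain ⟨hx, hxj⟩ := mem_edges_box.1 he
    have hjl : j ≠ l := hl.1.ne
    have hlj := hl.1.ne'
    have hb : ∀ i, (x - stdVec l) i = if i = l then x i - 1 else x i := fun i => by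
      rw [Pi.sub_apply, stdVec_apply]
      split_ifs <;> ring
    have hpl : (x - stdVec l, j, l) ∈ plaquettes (box d m) := by
      have hin : x - stdVec l ∈ box d m := mem_box.2 fun i => by
        rw [hb]
        have := hx i
        have := hx l
        split_ifs with hi
        · subst hi
          omega
        · omega
      have hxs : x + stdVec j ∈ box d m := (mem_edges.1 he).2
      refine mem_plaquettes.2 ⟨hin, hl.1, ?_, ?_, ?_⟩
      · refine mem_box.2 fun i => ?_
        have h1 := mem_box.1 hxs i
        rw [Pi.add_apply] at h1 ⊢
        simp only [hb, stdVec_apply] at h1 ⊢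
        by_cases hi : i = l
        · subst hi
          have := hx i
          have := hl.2
          rw [if_pos rfl, if_neg hlj]
          omega
        · rwa [if_neg hi]
      · simpa using (mem_edges.1 he).1
      · simpa [sub_add_eq_add_sub, add_sub_cancel_right] using hxs
    have key := hp _ hpl
    have e2 : boundary (x - stdVec l, j, l) 2 = (x, j) := by simp [boundary]
    have e0 : boundary (x - stdVec l, j, l) 0 = (x - stdVec l, j) := by simp [boundary]
    have h1 : D (boundary (x - stdVec l, j, l) 1) = 0 := by
      refine h0 _ (mem_axialEdges.2 ⟨boundary_mem_edges hpl 1, fun i hi => ?_⟩)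
      have hi' : l < i := hi
      simp only [boundary, Matrix.cons_val, Pi.add_apply, hb, stdVec_apply]
      rw [if_neg hi'.ne', if_neg (hl.1.trans hi').ne', hx0 i hi', add_zero]
    have h3 : D (boundary (x - stdVec l, j, l) 3) = 0 := by
      refine h0 _ (mem_axialEdges.2 ⟨boundary_mem_edges hpl 3, fun i hi => ?_⟩)
      have hi' : l < i := hi
      simp only [boundary, Matrix.cons_val, hb]
      rw [if_neg hi'.ne', hx0 i hi']
    have hsum' : ∑ i, (x - stdVec l) i = k := by
      have h4 := sum_add_stdVec (x - stdVec l) l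
      rw [sub_add_cancel] at h4
      simp only at hsum
      push_cast at hsum
      linarith
    have h5 := ih _ (boundary_mem_edges hpl 0) (by rw [e0]; exact hsum')
    rw [e2, h1, h3] at key
    push_cast
    linarith

/-- Coordinate sums are at most 4m, so each D is at most 4ms, and there are at most 4m⁴ edges: 4m⁴ ·
16m²s² is the bound. -/
theorem sum_sq_le_of_axial {m : ℕ} (D : (Fin 4 → ℤ) × Fin 4 → ℝ) {s : ℝ} (hD : ∀ e, 0 ≤ D e)
    (h0 : ∀ e ∈ axialEdges 4 m, D e = 0)
    (hp : ∀ p ∈ plaquettes (box 4 m),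
      D (boundary p 2) ≤ D (boundary p 0) + D (boundary p 1) + D (boundary p 3) + s)
    (hs : 0 ≤ s) : ∑ e ∈ edges (box 4 m), D e ^ 2 ≤ 64 * (m : ℝ) ^ 6 * s ^ 2 := by
  have h1 : ∀ e ∈ edges (box 4 m), D e ^ 2 ≤ (4 * m * s) ^ 2 := by
    intro e he
    refine pow_le_pow_left₀ (hD e) ((le_of_axial D h0 hp hs e he).trans ?_) 2
    refine mul_le_mul_of_nonneg_right ?_ hs
    have : ∑ i, e.1 i ≤ ∑ _i : Fin 4, (m : ℤ) :=
      Finset.sum_le_sum fun i _ => ((mem_box.1 (mem_edges.1 he).1 i).2).le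
    have h2 : ∑ i, e.1 i ≤ 4 * (m : ℤ) := by simpa using this
    exact_mod_cast h2
  refine (Finset.sum_le_sum h1).trans ?_
  rw [Finset.sum_const, nsmul_eq_mul, card_edges_box]
  have h2 : ((4 * ((m - 1) * m ^ 3) : ℕ) : ℝ) ≤ 4 * (m : ℝ) ^ 4 := by
    have : 4 * ((m - 1) * m ^ 3) ≤ 4 * m ^ 4 := by
      rw [pow_succ' m 3]
      gcongr
      omega
    exact_mod_cast this
  calc _ ≤ 4 * (m : ℝ) ^ 4 * (4 * m * s) ^ 2 := mul_le_mul_of_nonneg_right h2 (sq_nonneg _)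
    _ = _ := by ring

end Tree

/-! ### The partition function of a fixed box in the axial gauge -/

section Box

variable {N m : ℕ}

theorem freeEdges_subset (d n : ℕ) : freeEdges d n ⊆ edges (box d n) := Finset.sdiff_subset

/-- Extension by the constant `a` of a function on the free edges. -/
def extendFree {α : Type*} (a : α) (V : ↥(freeEdges 4 m) → α) (e : (Fin 4 → ℤ) × Fin 4) : α :=
  if h : e ∈ freeEdges 4 m then V ⟨e, h⟩ else a

theorem extendFree_coe {α : Type*} (a : α) (V : ↥(freeEdges 4 m) → α) (e : freeEdges 4 m) :
    extendFree a V e = V e := by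
  simp [extendFree]

theorem extendFree_axial {α : Type*} (a : α) (V : ↥(freeEdges 4 m) → α)
    {e : (Fin 4 → ℤ) × Fin 4} (he : e ∈ axialEdges 4 m) : extendFree a V e = a := by
  simp [extendFree, freeEdges, he]

theorem extendFree_apply_apply (b : ↥(freeEdges 4 m) → Coord N) (e : (Fin 4 → ℤ) × Fin 4)
    (i j : Fin N) : extendFree 0 b e i j = extendFree 0 (fun e => b e i j) e := by
  by_cases h : e ∈ freeEdges 4 m <;> simp [extendFree, h]

theorem sum_extendFree {α : Type*} (a : α) (V : ↥(freeEdges 4 m) → α) (f : α → ℝ) (hf : f a = 0)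
    (W : Finset ((Fin 4 → ℤ) × Fin 4)) :
    ∑ e ∈ W, f (extendFree a V e) = ∑ e : freeEdges 4 m, if e.1 ∈ W then f (V e) else 0 := by
  classical
  have h1 : ∑ e : freeEdges 4 m, (if e.1 ∈ W then f (V e) else 0) =
      ∑ e : freeEdges 4 m, (if e.1 ∈ W then f (extendFree a V e.1) else 0) :=
    Finset.sum_congr rfl fun e _ => by rw [extendFree_coe]
  rw [h1, Finset.sum_coe_sort (freeEdges 4 m) fun e => if e ∈ W then f (extendFree a V e) else 0,
    ← Finset.sum_filter, Finset.filter_mem_eq_inter, Finset.inter_comm]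
  refine (Finset.sum_subset Finset.inter_subset_left fun e he he' => ?_).symm
  rw [extendFree, dif_neg fun h => he' (Finset.mem_inter.2 ⟨he, h⟩), hf]

/-- The configuration in the axial gauge with given values on the free edges. -/
def fill (V : ↥(freeEdges 4 m) → UN N) : Config N (box 4 m) := fun e => extendFree 1 V e

theorem ext_fill (V : ↥(freeEdges 4 m) → UN N) : (fill V).ext = extendFree 1 V := by
  funext e
  by_cases he : e ∈ edges (box 4 m)
  · rw [Config.ext_mem _ he, fill]
  · have : e ∉ freeEdges 4 m := fun h => he (freeEdges_subset _ _ h)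
    simp [Config.ext, Config.link, he, extendFree, this]

theorem continuous_fill : Continuous (fill : (↥(freeEdges 4 m) → UN N) → Config N (box 4 m)) := by
  refine continuous_pi fun e => ?_
  by_cases he : e.1 ∈ freeEdges 4 m
  · simp only [fill, extendFree, dif_pos he]
    fun_prop
  · simp only [fill, extendFree, dif_neg he]
    fun_prop

theorem fixOne_axial (U : Config N (box 4 m)) :
    fixOne (axialEdges 4 m) U = fill fun e => U ⟨e, freeEdges_subset 4 m e.2⟩ := by
  funext e
  by_cases he : e.1 ∈ axialEdges 4 m
  · simp [fixOne, fill, extendFree, he, freeEdges]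
  · simp [fixOne, fill, extendFree, he, freeEdges]

theorem integral_fill {f : Config N (box 4 m) → ℝ} (hf : Continuous f) :
    ∫ U, f (fixOne (axialEdges 4 m) U) ∂(productHaar N (box 4 m)) =
      ∫ V, f (fill V) ∂(Measure.pi fun _ : freeEdges 4 m => haarUN N) := by
  have h := measurePreserving_comp_injective (haarUN N)
    (ι := fun e : freeEdges 4 m => (⟨e, freeEdges_subset 4 m e.2⟩ : edges (box 4 m)))
    (fun a b hab => Subtype.ext (Subtype.mk.inj hab))
  have hc : Continuous fun V : ↥(freeEdges 4 m) → UN N => f (fill V) := hf.comp continuous_fill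
  rw [← h.map_eq, integral_map h.measurable.aemeasurable hc.measurable.aestronglyMeasurable]
  simp only [fixOne_axial]
  rfl

/-- The Wilson action with an additional mass on the edges in `W`. -/
def massiveAction (κ : ℝ) (W : Finset ((Fin 4 → ℤ) × Fin 4)) {Λ : Finset (Fin 4 → ℤ)}
    (U : Config N Λ) : ℝ :=
  wilsonAction U + κ * ∑ e ∈ W, phi (U.ext e)

theorem continuous_massiveAction (κ : ℝ) (W : Finset ((Fin 4 → ℤ) × Fin 4))
    {Λ : Finset (Fin 4 → ℤ)} : Continuous fun U : Config N Λ => massiveAction κ W U :=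
  continuous_wilsonAction.add (continuous_const.mul
    (continuous_finsetSum _ fun e _ => continuous_phi.comp (continuous_ext e)))

theorem dev_one : dev (1 : UN N) = 0 := by
  have h := phi_eq_dev (1 : UN N)
  rw [phi_one] at h
  exact pow_eq_zero_iff two_ne_zero |>.1 (by linarith)

/-- The Stokes bound is applied to `dev`, with s = √(2S), where S is the action: each plaquette
contributes at most S, and φ is half the square of `dev`. This is the coercivity required by
Laplace's method. -/
theorem sum_phi_fill_le (V : ↥(freeEdges 4 m) → UN N) :
    ∑ e, phi (V e) ≤ 64 * (m : ℝ) ^ 6 * wilsonAction (fill V) := by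
  have hS := wilsonAction_nonneg (fill V)
  have h := sum_sq_le_of_axial (m := m) (fun e => dev (extendFree 1 V e))
    (s := √(2 * wilsonAction (fill V))) (fun e => dev_nonneg _)
    (fun e he => by
      rw [extendFree_axial 1 V he, dev_one]) (fun p hp => by
      have h1 : phi (holonomy (fill V).ext p) ≤ wilsonAction (fill V) := by
        rw [wilsonAction_eq]
        exact Finset.single_le_sum (f := fun p => phi (holonomy (fill V).ext p))
          (fun _ _ => phi_nonneg _) hp
      rw [phi_eq_dev] at h1
      have h2 : dev (holonomy (fill V).ext p) ≤ √(2 * wilsonAction (fill V)) :=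
        Real.le_sqrt_of_sq_le (by linarith)
      rw [ext_fill] at h2
      set u := extendFree 1 V with hu
      have h3 : u (boundary p 2) = (u (boundary p 3))⁻¹ * (holonomy u p)⁻¹ * u (boundary p 0) *
          u (boundary p 1) := by
        rw [holonomy_eq]
        group
      have h4 := dev_mul_le ((u (boundary p 3))⁻¹ * (holonomy u p)⁻¹ * u (boundary p 0))
        (u (boundary p 1))
      have h5 := dev_mul_le ((u (boundary p 3))⁻¹ * (holonomy u p)⁻¹) (u (boundary p 0))
      have h6 := dev_mul_le (u (boundary p 3))⁻¹ (holonomy u p)⁻¹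
      rw [dev_inv, dev_inv] at h6
      rw [h3]
      linarith) (Real.sqrt_nonneg _)
  rw [Real.sq_sqrt (by positivity)] at h
  have h7 : ∑ e, phi (V e) = (∑ e ∈ freeEdges 4 m, dev (extendFree 1 V e) ^ 2) / 2 := by
    rw [← Finset.sum_coe_sort (freeEdges 4 m) fun e => dev (extendFree 1 V e) ^ 2, Finset.sum_div]
    exact Finset.sum_congr rfl fun e _ => by rw [phi_eq_dev, extendFree_coe]
  have h8 := Finset.sum_le_sum_of_subset_of_nonneg (freeEdges_subset 4 m)
    (f := fun e => dev (extendFree 1 V e) ^ 2) fun e _ _ => sq_nonneg _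
  rw [h7]
  linarith

theorem maxwellForm0_apply (t : ↥(freeEdges 4 m) → ℝ) :
    maxwellForm0 4 m t = ∑ p ∈ plaquettes (box 4 m), (extendFree 0 t (boundary p 0) +
      extendFree 0 t (boundary p 1) - extendFree 0 t (boundary p 2) -
      extendFree 0 t (boundary p 3)) ^ 2 := by
  have hc : ∀ e : (Fin 4 → ℤ) × Fin 4, edgeCoord (box 4 m) e.1 e.2 (extendZero 4 m t) =
      extendFree 0 t e := by
    intro e
    by_cases he : e ∈ edges (box 4 m)
    · by_cases hf : e ∈ freeEdges 4 m <;> simp [edgeCoord, he, extendZero, extendFree, hf]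
    · have : e ∉ freeEdges 4 m := fun h => he (freeEdges_subset _ _ h)
      simp [edgeCoord, he, extendFree, this]
  rw [maxwellForm0, QuadraticMap.comp_apply, maxwellForm, _root_.sum_apply]
  refine Finset.sum_congr rfl fun p _ => ?_
  rw [QuadraticMap.comp_apply, QuadraticMap.sq_apply, ← sq, ← hc, ← hc, ← hc, ← hc]
  rfl

theorem dotProduct_toMatrix' {ι : Type*} [Fintype ι] [DecidableEq ι] (Q : QuadraticForm ℝ (ι → ℝ))
    (t : ι → ℝ) : t ⬝ᵥ Q.toMatrix' *ᵥ t = Q t := by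
  rw [← Matrix.toLinearMap₂'_apply', QuadraticForm.toMatrix', Matrix.toLinearMap₂'_toMatrix',
    QuadraticMap.associated_eq_self_apply]

/-- The linear counterpart of `sum_phi_fill_le`, used for positive definiteness and to bound the
diagonal of the inverse matrix. -/
theorem sum_sq_le_maxwellForm0 (t : ↥(freeEdges 4 m) → ℝ) :
    ∑ e, t e ^ 2 ≤ 64 * (m : ℝ) ^ 6 * maxwellForm0 4 m t := by
  have hS : 0 ≤ maxwellForm0 4 m t := by
    rw [maxwellForm0_apply]
    exact Finset.sum_nonneg fun _ _ => sq_nonneg _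
  have h := sum_sq_le_of_axial (m := m) (fun e => |extendFree 0 t e|)
    (s := √(maxwellForm0 4 m t)) (fun e => abs_nonneg _)
    (fun e he => by
      rw [extendFree_axial 0 t he, abs_zero]) (fun p hp => by
      have h1 : (extendFree 0 t (boundary p 0) + extendFree 0 t (boundary p 1) -
          extendFree 0 t (boundary p 2) - extendFree 0 t (boundary p 3)) ^ 2 ≤
          maxwellForm0 4 m t := by
        rw [maxwellForm0_apply]
        exact Finset.single_le_sum (f := fun p => (extendFree 0 t (boundary p 0) +
          extendFree 0 t (boundary p 1) - extendFree 0 t (boundary p 2) -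
          extendFree 0 t (boundary p 3)) ^ 2) (fun _ _ => sq_nonneg _) hp
      have h2 := Real.abs_le_sqrt h1
      rw [abs_le] at h2
      rw [abs_le]
      have a0 := neg_abs_le (extendFree 0 t (boundary p 0))
      have a1 := neg_abs_le (extendFree 0 t (boundary p 1))
      have a3 := neg_abs_le (extendFree 0 t (boundary p 3))
      have b0 := le_abs_self (extendFree 0 t (boundary p 0))
      have b1 := le_abs_self (extendFree 0 t (boundary p 1))
      have b3 := le_abs_self (extendFree 0 t (boundary p 3))
      constructor <;> linarith) (Real.sqrt_nonneg _)
  rw [Real.sq_sqrt hS] at h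
  have h7 : ∑ e, t e ^ 2 = ∑ e ∈ freeEdges 4 m, |extendFree 0 t e| ^ 2 := by
    rw [← Finset.sum_coe_sort (freeEdges 4 m) fun e => |extendFree 0 t e| ^ 2]
    exact Finset.sum_congr rfl fun e _ => by rw [sq_abs, extendFree_coe]
  rw [h7]
  exact (Finset.sum_le_sum_of_subset_of_nonneg (freeEdges_subset 4 m)
    fun e _ _ => sq_nonneg _).trans h

/-- The matrix of the Maxwell form with an additional mass on the edges in `W`. -/
def massiveMatrix (m : ℕ) (κ : ℝ) (W : Finset ((Fin 4 → ℤ) × Fin 4)) :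
    Matrix (freeEdges 4 m) (freeEdges 4 m) ℝ :=
  (maxwellForm0 4 m).toMatrix' + Matrix.diagonal fun e => if e.1 ∈ W then κ else 0

theorem dotProduct_massiveMatrix (κ : ℝ) (W : Finset ((Fin 4 → ℤ) × Fin 4))
    (t : ↥(freeEdges 4 m) → ℝ) : t ⬝ᵥ massiveMatrix m κ W *ᵥ t =
      maxwellForm0 4 m t + κ * ∑ e ∈ W, extendFree 0 t e ^ 2 := by
  rw [massiveMatrix, Matrix.add_mulVec, dotProduct_add, dotProduct_toMatrix',
    sum_extendFree (0 : ℝ) t (fun a => a ^ 2) (by simp), Finset.mul_sum]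
  congr 1
  simp only [dotProduct, Matrix.mulVec_diagonal]
  refine Finset.sum_congr rfl fun e _ => ?_
  split_ifs <;> ring

theorem posDef_massiveMatrix (hm : 1 ≤ m) {κ : ℝ} (hκ : 0 ≤ κ)
    (W : Finset ((Fin 4 → ℤ) × Fin 4)) : (massiveMatrix m κ W).PosDef := by
  refine Matrix.PosDef.of_dotProduct_mulVec_pos ?_ fun t ht => ?_
  · rw [massiveMatrix]
    refine Matrix.IsHermitian.add ?_ (Matrix.isHermitian_diagonal _)
    rw [Matrix.IsHermitian, Matrix.conjTranspose_eq_transpose_of_trivial]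
    exact QuadraticForm.isSymm_toMatrix' _
  · rw [star_trivial, dotProduct_massiveMatrix]
    have h1 := sum_sq_le_maxwellForm0 t
    have h2 : 0 ≤ κ * ∑ e ∈ W, extendFree 0 t e ^ 2 :=
      mul_nonneg hκ (Finset.sum_nonneg fun _ _ => sq_nonneg _)
    have h3 : 0 < ∑ e, t e ^ 2 := by
      obtain ⟨e, he⟩ := Function.ne_iff.1 ht
      have he : t e ≠ 0 := he
      exact Finset.sum_pos' (fun _ _ => sq_nonneg _) ⟨e, Finset.mem_univ _, by positivity⟩
    have h4 : 0 < maxwellForm0 4 m t := by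
      have hm' : (0 : ℝ) < 64 * (m : ℝ) ^ 6 := by
        have : (0 : ℝ) < m := by exact_mod_cast hm
        positivity
      exact pos_of_mul_pos_right (h3.trans_le h1) hm'.le
    linarith

theorem hasTangent_extendFree (b : ↥(freeEdges 4 m) → Coord N) (e : (Fin 4 → ℤ) × Fin 4) :
    HasTangent (fun g => extendFree 1 (fun e => cayley ((g / 2) • b e)) e)
      (I • herm (extendFree 0 b e)) := by
  by_cases h : e ∈ freeEdges 4 m
  · simp only [extendFree, dif_pos h]
    exact hasTangent_cayley _
  · simp only [extendFree, dif_neg h, map_zero, smul_zero]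
    exact hasTangent_one

theorem sum_sum_comm {ι : Type*} (S : Finset ι) (f : ι → Fin N → Fin N → ℝ) :
    ∑ i, ∑ j, ∑ p ∈ S, f p i j = ∑ p ∈ S, ∑ i, ∑ j, f p i j := by
  rw [Finset.sum_comm (s := S)]
  exact Finset.sum_congr rfl fun i _ => Finset.sum_comm

/-- Tangents at the identity add under multiplication, so to first order the holonomy is the signed
sum of the link coordinates. To second order φ is then half the sum of squares over the matrix
coordinates. -/
theorem tendsto_massiveAction_div (κ : ℝ) (W : Finset ((Fin 4 → ℤ) × Fin 4))
    (b : ↥(freeEdges 4 m) → Coord N) :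
    Tendsto (fun g : ℝ => massiveAction κ W (fill fun e => cayley ((g / 2) • b e)) / g ^ 2) (𝓝[>] 0)
      (𝓝 ((∑ i, ∑ j, (fun e => b e i j) ⬝ᵥ massiveMatrix m κ W *ᵥ (fun e => b e i j)) / 2)) := by
  set B := extendFree 0 b with hB
  have h1 : ∀ p ∈ plaquettes (box 4 m), Tendsto (fun g : ℝ =>
      phi (holonomy (fill fun e => cayley ((g / 2) • b e)).ext p) / g ^ 2) (𝓝[>] 0)
      (𝓝 ((∑ i, ∑ j, (B (boundary p 0) + B (boundary p 1) - B (boundary p 2) -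
        B (boundary p 3)) i j ^ 2) / 2)) := by
    intro p _
    refine HasTangent.tendsto_phi ?_
    have h := (((hasTangent_extendFree b (boundary p 0)).mul
      (hasTangent_extendFree b (boundary p 1))).mul (hasTangent_extendFree b (boundary p 2)).inv).mul
      (hasTangent_extendFree b (boundary p 3)).inv
    simp only [ext_fill, holonomy_eq]
    convert h using 1
    rw [map_sub, map_sub, map_add, smul_sub, smul_sub, smul_add, hB]
    abel
  have h2 : ∀ e ∈ W, Tendsto (fun g : ℝ =>
      phi ((fill fun e => cayley ((g / 2) • b e)).ext e) / g ^ 2) (𝓝[>] 0)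
      (𝓝 ((∑ i, ∑ j, B e i j ^ 2) / 2)) := by
    intro e _
    simp only [ext_fill]
    exact (hasTangent_extendFree b e).tendsto_phi
  have h3 := (tendsto_finsetSum _ h1).add ((tendsto_finsetSum _ h2).const_mul κ)
  convert h3 using 1
  · funext g
    rw [massiveAction, wilsonAction_eq, add_div, mul_div_assoc, Finset.sum_div, Finset.sum_div]
  · congr 1
    simp only [dotProduct_massiveMatrix, maxwellForm0_apply, ← extendFree_apply_apply, ← hB,
      Finset.sum_add_distrib, Pi.add_apply, Pi.sub_apply, ← Finset.mul_sum, ← Finset.sum_div]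
    rw [add_div, mul_div_assoc]
    rw [sum_sum_comm, sum_sum_comm]

/-- The partition function in the axial gauge with an additional mass on the edges in `W`. -/
def massiveZ (N m : ℕ) (κ : ℝ) (W : Finset ((Fin 4 → ℤ) × Fin 4)) (g : ℝ) : ℝ :=
  ∫ U, Real.exp (-(1 / g ^ 2) * massiveAction κ W (fixOne (axialEdges 4 m) U))
    ∂(productHaar N (box 4 m))

theorem tendsto_log_massiveZ (N : ℕ) (hm : 1 ≤ m) {κ : ℝ} (hκ : 0 ≤ κ)
    (W : Finset ((Fin 4 → ℤ) × Fin 4)) :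
    Tendsto (fun g : ℝ => Real.log (massiveZ N m κ W g) -
        (freeEdges 4 m).card * ((N : ℝ) ^ 2 / 2) * Real.log (g ^ 2)) (𝓝[>] 0)
      (𝓝 ((freeEdges 4 m).card * linkConst N -
        (N : ℝ) ^ 2 / 2 * Real.log (massiveMatrix m κ W).det)) := by
  have hm0 : (0 : ℝ) < m := by exact_mod_cast hm
  have h := tendsto_log_laplace (N := N) (E := freeEdges 4 m)
    (fun V => massiveAction κ W (fill V)) ((continuous_massiveAction κ W).comp continuous_fill)
    (c := (64 * (m : ℝ) ^ 6)⁻¹) (by positivity) (fun V => by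
      have h1 := sum_phi_fill_le V
      rw [inv_mul_le_iff₀ (by positivity)]
      refine h1.trans (mul_le_mul_of_nonneg_left ?_ (by positivity))
      exact le_add_of_nonneg_right (mul_nonneg hκ (Finset.sum_nonneg fun _ _ => phi_nonneg _)))
    (posDef_massiveMatrix hm hκ W) (tendsto_massiveAction_div κ W)
  rw [Fintype.card_coe] at h
  refine h.congr fun g => ?_
  rw [massiveZ, integral_fill (f := fun U => Real.exp (-(1 / g ^ 2) * massiveAction κ W U))
    (Real.continuous_exp.comp (continuous_const.mul (continuous_massiveAction κ W)))]

theorem partitionFunction_eq_massiveZ (N m : ℕ) (κ g : ℝ) :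
    partitionFunction N (box 4 m) (g ^ 2) = massiveZ N m κ ∅ g := by
  rw [partitionFunction, massiveZ]
  simp only [massiveAction, Finset.sum_empty, mul_zero, add_zero]
  refine (integral_fixOne _ (exists_gaugeAct_eq_one ?_) (f := fun U : Config N (box 4 m) =>
    Real.exp (-(1 / g ^ 2) * wilsonAction U))
    (Real.continuous_exp.comp (continuous_const.mul continuous_wilsonAction)) ?_).symm
  · intro e he e' he' h h'
    exact treeEdges_unique _ e he e' he' (mem_axialEdges_iff_tree.1 h).2
      (mem_axialEdges_iff_tree.1 h').2
  · intro h U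
    rw [wilsonAction_gaugeAct]

theorem log_det_massiveMatrix_empty (m : ℕ) (κ : ℝ) :
    (massiveMatrix m κ ∅).det = (maxwellForm0 4 m).toMatrix'.det := by
  simp [massiveMatrix]

end Box

/-! ### Determinants of perturbed matrices and the single link integral -/

section Det

variable {ι : Type*} [Fintype ι] [DecidableEq ι]

/-- Testing coercivity on the i-th column v of M⁻¹ gives (M⁻¹)ᵢᵢ² ≤ |v|² ≤ C (M⁻¹)ᵢᵢ. -/
theorem inv_apply_le {M : Matrix ι ι ℝ} (hM : M.PosDef) {C : ℝ} (hC0 : 0 ≤ C)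
    (hC : ∀ t : ι → ℝ, ∑ i, t i ^ 2 ≤ C * (t ⬝ᵥ M *ᵥ t)) (i : ι) : M⁻¹ i i ≤ C := by
  have hu : IsUnit M.det := hM.det_pos.ne'.isUnit
  set v : ι → ℝ := M⁻¹ *ᵥ Pi.single i 1 with hv
  have hvi : v i = M⁻¹ i i := by simp [hv]
  have h1 : M *ᵥ v = Pi.single i 1 := by
    rw [hv, Matrix.mulVec_mulVec, Matrix.mul_nonsing_inv _ hu, Matrix.one_mulVec]
  have h2 := hC v
  rw [h1, dotProduct_single_one, hvi] at h2
  have h3 : M⁻¹ i i ^ 2 ≤ ∑ k, v k ^ 2 := by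
    rw [← hvi]
    exact Finset.single_le_sum (f := fun k => v k ^ 2) (fun _ _ => sq_nonneg _) (Finset.mem_univ i)
  by_contra hlt
  push Not at hlt
  nlinarith

/-- A single mass is a rank-one perturbation and multiplies the determinant by 1 + κ (M⁻¹)ᵢᵢ. -/
theorem det_add_diagonal_single_le {M : Matrix ι ι ℝ} (hM : M.PosDef) {C κ : ℝ} (hC0 : 0 ≤ C)
    (hκ : 0 ≤ κ) (hC : ∀ t : ι → ℝ, ∑ i, t i ^ 2 ≤ C * (t ⬝ᵥ M *ᵥ t)) (i : ι) :
    (M + Matrix.diagonal (Pi.single i κ)).det ≤ M.det * (1 + κ * C) := by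
  have hu : IsUnit M.det := hM.det_pos.ne'.isUnit
  have h1 : Matrix.diagonal (Pi.single i κ) = Matrix.replicateCol Unit (Pi.single i κ : ι → ℝ) *
      Matrix.replicateRow Unit (Pi.single i 1 : ι → ℝ) := by
    ext a b
    rw [Matrix.mul_apply, Matrix.diagonal_apply]
    simp only [Finset.univ_unique, Finset.sum_singleton, Matrix.replicateCol_apply,
      Matrix.replicateRow_apply, Pi.single_apply]
    split_ifs <;> simp_all
  rw [h1, Matrix.det_add_replicateCol_mul_replicateRow hu]
  refine mul_le_mul_of_nonneg_left ?_ hM.det_pos.le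
  rw [Matrix.det_unique, Matrix.add_apply, Matrix.one_apply_eq]
  have h2 : (Matrix.replicateRow Unit (Pi.single i 1 : ι → ℝ) * M⁻¹ *
      Matrix.replicateCol Unit (Pi.single i κ : ι → ℝ)) default default = κ * M⁻¹ i i := by
    rw [Matrix.mul_assoc, Matrix.mul_apply]
    simp only [Matrix.replicateRow_apply, Matrix.mul_apply, Matrix.replicateCol_apply]
    simp [Pi.single_apply, mul_comm]
  rw [h2]
  have := mul_le_mul_of_nonneg_left (inv_apply_le hM hC0 hC i) hκ
  linarith

theorem det_add_diagonal_le {M : Matrix ι ι ℝ} (hM : M.PosDef) {C κ : ℝ} (hC0 : 0 ≤ C)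
    (hκ : 0 ≤ κ) (hC : ∀ t : ι → ℝ, ∑ i, t i ^ 2 ≤ C * (t ⬝ᵥ M *ᵥ t)) (W : Finset ι) :
    (M + Matrix.diagonal fun i => if i ∈ W then κ else 0).det ≤ M.det * (1 + κ * C) ^ W.card := by
  induction W using Finset.induction_on with
  | empty => simp
  | insert a W ha ih =>
    set A := M + Matrix.diagonal fun i => if i ∈ W then κ else 0 with hA
    have hdiag : (Matrix.diagonal fun i => if i ∈ W then κ else (0 : ℝ)).PosSemidef :=
      Matrix.PosSemidef.diagonal fun i => by
        simp only [Pi.zero_apply]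
        split_ifs <;> simp [hκ]
    have hAp : A.PosDef := hM.add_posSemidef hdiag
    -- Masses only increase the form, so the same coercivity constant serves after each one is
    -- added.
    have hAC : ∀ t : ι → ℝ, ∑ i, t i ^ 2 ≤ C * (t ⬝ᵥ A *ᵥ t) := fun t => by
      refine (hC t).trans (mul_le_mul_of_nonneg_left ?_ hC0)
      rw [hA, Matrix.add_mulVec, dotProduct_add]
      have := hdiag.dotProduct_mulVec_nonneg t
      rw [star_trivial] at this
      linarith
    have hsplit : (M + Matrix.diagonal fun i => if i ∈ insert a W then κ else 0) =
        A + Matrix.diagonal (Pi.single a κ) := by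
      rw [hA, add_assoc, Matrix.diagonal_add]
      congr 2
      funext i
      by_cases hi : i = a
      · subst hi
        simp [ha]
      · simp [hi]
    rw [hsplit, Finset.card_insert_of_notMem ha, pow_succ, ← mul_assoc]
    exact (det_add_diagonal_single_le hAp hC0 hκ hAC a).trans
      (mul_le_mul_of_nonneg_right ih (by positivity))

end Det

/-- Coercivity is only polynomial in m, so each mass costs O(log m). For the boundary edges the
total is O(m³ log m), negligible against m⁴. -/
theorem log_det_massiveMatrix_le {m : ℕ} (hm : 1 ≤ m) {κ : ℝ} (hκ : 0 ≤ κ)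
    (W : Finset ((Fin 4 → ℤ) × Fin 4)) :
    Real.log (massiveMatrix m κ W).det ≤ Real.log (massiveMatrix m κ ∅).det +
      W.card * Real.log (1 + κ * (64 * (m : ℝ) ^ 6)) := by
  have hM := posDef_massiveMatrix hm hκ ∅
  set W' : Finset (freeEdges 4 m) := Finset.univ.filter fun e => e.1 ∈ W with hW'
  have h0 : massiveMatrix m κ ∅ = (maxwellForm0 4 m).toMatrix' := by simp [massiveMatrix]
  have h1 : massiveMatrix m κ W =
      massiveMatrix m κ ∅ + Matrix.diagonal fun e => if e ∈ W' then κ else 0 := by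
    rw [h0, massiveMatrix]
    simp [hW']
  have h2 := det_add_diagonal_le hM (C := 64 * (m : ℝ) ^ 6) (by positivity) hκ (fun t => by
    rw [h0, dotProduct_toMatrix']
    exact sum_sq_le_maxwellForm0 t) W'
  rw [← h1] at h2
  have h3 : W'.card ≤ W.card := by
    refine Finset.card_le_card_of_injOn (fun e => e.1) (fun e he => ?_)
      (Subtype.val_injective.injOn)
    simpa [hW'] using he
  have h4 : (1 : ℝ) ≤ 1 + κ * (64 * (m : ℝ) ^ 6) := by
    have : 0 ≤ κ * (64 * (m : ℝ) ^ 6) := by positivity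
    linarith
  have h5 := h2.trans (mul_le_mul_of_nonneg_left (pow_le_pow_right₀ h4 h3) hM.det_pos.le)
  have h6 := Real.log_le_log (posDef_massiveMatrix hm hκ W).det_pos h5
  rwa [Real.log_mul hM.det_pos.ne' (by positivity), Real.log_pow] at h6

/-- The partition function of a single massive link. -/
def linkZ (N : ℕ) (κ g : ℝ) : ℝ := ∫ U, Real.exp (-(1 / g ^ 2) * (κ * phi U)) ∂(haarUN N)

theorem tendsto_log_linkZ (N : ℕ) {κ : ℝ} (hκ : 0 < κ) :
    Tendsto (fun g : ℝ => Real.log (linkZ N κ g) - (N : ℝ) ^ 2 / 2 * Real.log (g ^ 2)) (𝓝[>] 0)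
      (𝓝 (linkConst N - (N : ℝ) ^ 2 / 2 * Real.log κ)) := by
  have h := tendsto_log_laplace (N := N) (E := Unit) (fun V => κ * phi (V ()))
    (continuous_const.mul (continuous_phi.comp (continuous_apply ()))) hκ (fun V => by simp)
    (M := Matrix.diagonal fun _ => κ) (Matrix.PosDef.diagonal fun _ => hκ) (fun b => by
      have h1 := ((hasTangent_cayley (b ())).tendsto_phi).const_mul κ
      convert h1 using 1
      · funext g
        ring
      · congr 1
        rw [← mul_div_assoc, Finset.mul_sum]
        congr 1
        refine Finset.sum_congr rfl fun i _ => ?_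
        rw [Finset.mul_sum]
        refine Finset.sum_congr rfl fun j _ => ?_
        simp [dotProduct, Matrix.mulVec_diagonal]
        ring)
  simp only [Fintype.card_unit, Nat.cast_one, one_mul, Matrix.det_diagonal, Finset.univ_unique,
    Finset.prod_singleton] at h
  refine h.congr fun g => ?_
  congr 2
  have he := measurePreserving_eval (fun _ : Unit => haarUN N) ()
  have hc : Continuous fun U : UN N => Real.exp (-(1 / g ^ 2) * (κ * phi U)) :=
    Real.continuous_exp.comp (continuous_const.mul (continuous_const.mul continuous_phi))
  rw [linkZ]
  conv_rhs => rw [← he.map_eq, integral_map he.measurable.aemeasurable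
    hc.measurable.aestronglyMeasurable]

/-! ### Decomposition of a box into blocks -/

section Blocks

variable {m q n : ℕ}

/-- The edge in direction `k` ending at `y` lies inside one of the `q ^ 4` blocks of side `m`. -/
def Inner (m q : ℕ) (y : Fin 4 → ℤ) (k : Fin 4) : Prop :=
  (∀ i, y i < q * m) ∧ ¬ (m : ℤ) ∣ y k

/-- The point `x` of the block with index `b`. -/
def blockPt (m : ℕ) (b x : Fin 4 → ℤ) : Fin 4 → ℤ := fun i => m * b i + x i

theorem blockPt_add (b x y : Fin 4 → ℤ) : blockPt m b x + y = blockPt m b (x + y) := by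
  funext i
  simp [blockPt, add_assoc]

theorem blockPt_sub (b x y : Fin 4 → ℤ) : blockPt m b x - y = blockPt m b (x - y) := by
  funext i
  simp [blockPt, add_sub_assoc]

theorem blockPt_inj {b b' x x' : Fin 4 → ℤ} (hx : x ∈ box 4 m) (hx' : x' ∈ box 4 m)
    (h : blockPt m b x = blockPt m b' x') : b = b' ∧ x = x' := by
  have key : ∀ i, b i = b' i ∧ x i = x' i := by
    intro i
    have h1 : (m : ℤ) * b i + x i = m * b' i + x' i := congrFun h i
    have h2 := mem_box.1 hx i
    have h3 := mem_box.1 hx' i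
    have hm : (m : ℤ) ≠ 0 := by omega
    have h4 : (m * b i + x i) / (m : ℤ) = b i := by
      rw [Int.mul_add_ediv_left _ _ hm, Int.ediv_eq_zero_of_lt h2.1 h2.2, add_zero]
    have h5 : (m * b' i + x' i) / (m : ℤ) = b' i := by
      rw [Int.mul_add_ediv_left _ _ hm, Int.ediv_eq_zero_of_lt h3.1 h3.2, add_zero]
    have h6 : b i = b' i := by rw [← h4, ← h5, h1]
    refine ⟨h6, ?_⟩
    rw [h6] at h1
    linarith
  exact ⟨funext fun i => (key i).1, funext fun i => (key i).2⟩

theorem blockPt_bounds {b x : Fin 4 → ℤ} (hb : b ∈ box 4 q) (hx : x ∈ box 4 m) (i : Fin 4) :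
    0 ≤ blockPt m b x i ∧ blockPt m b x i < q * m := by
  have h1 := mem_box.1 hb i
  have h2 := mem_box.1 hx i
  have h3 : (m : ℤ) * b i ≤ m * (q - 1) := mul_le_mul_of_nonneg_left (by omega) (by omega)
  have h4 : 0 ≤ (m : ℤ) * b i := mul_nonneg (by omega) h1.1
  simp only [blockPt]
  constructor
  · linarith
  · nlinarith

theorem blockPt_mem_box (hqm : q * m ≤ n) {b x : Fin 4 → ℤ} (hb : b ∈ box 4 q)
    (hx : x ∈ box 4 m) : blockPt m b x ∈ box 4 n := by
  refine mem_box.2 fun i => ?_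
  have h := blockPt_bounds hb hx i
  have h2 : (q : ℤ) * m ≤ n := by exact_mod_cast hqm
  exact ⟨h.1, h.2.trans_le h2⟩

/-- The edge `e` of the block with index `b`. -/
def blockEdge (m : ℕ) (b : Fin 4 → ℤ) (e : (Fin 4 → ℤ) × Fin 4) : (Fin 4 → ℤ) × Fin 4 :=
  (blockPt m b e.1, e.2)

theorem blockEdge_mem (hqm : q * m ≤ n) {b : Fin 4 → ℤ} (hb : b ∈ box 4 q)
    {e : (Fin 4 → ℤ) × Fin 4} (he : e ∈ edges (box 4 m)) : blockEdge m b e ∈ edges (box 4 n) := by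
  rw [mem_edges] at he ⊢
  refine ⟨blockPt_mem_box hqm hb he.1, ?_⟩
  rw [blockEdge, blockPt_add]
  exact blockPt_mem_box hqm hb he.2

theorem blockEdge_inj {b b' : Fin 4 → ℤ} {e e' : (Fin 4 → ℤ) × Fin 4} (he : e ∈ edges (box 4 m))
    (he' : e' ∈ edges (box 4 m)) (h : blockEdge m b e = blockEdge m b' e') : b = b' ∧ e = e' := by
  have h1 := blockPt_inj (mem_edges.1 he).1 (mem_edges.1 he').1 (Prod.mk.inj h).1
  exact ⟨h1.1, Prod.ext h1.2 (Prod.mk.inj h).2⟩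

theorem inner_blockPt {b y : Fin 4 → ℤ} (hb : b ∈ box 4 q) (hy : y ∈ box 4 m) (k : Fin 4) :
    Inner m q (blockPt m b y) k ↔ y k ≠ 0 := by
  have h1 : (m : ℤ) ∣ blockPt m b y k ↔ y k = 0 := by
    rw [blockPt, dvd_add_right (dvd_mul_right _ _)]
    have h := mem_box.1 hy k
    exact ⟨fun hd => Int.eq_zero_of_dvd_of_nonneg_of_lt h.1 h.2 hd, fun h0 => by simp [h0]⟩
  rw [Inner, h1]
  exact ⟨fun h => h.2, fun h => ⟨fun i => (blockPt_bounds hb hy i).2, h⟩⟩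

/-- The edges inside the blocks. -/
def innerEdges (m q : ℕ) : Finset ((Fin 4 → ℤ) × Fin 4) :=
  (box 4 q ×ˢ edges (box 4 m)).image fun a => blockEdge m a.1 a.2

theorem mem_innerEdges {e : (Fin 4 → ℤ) × Fin 4} : e ∈ innerEdges m q ↔
    ∃ b ∈ box 4 q, ∃ e' ∈ edges (box 4 m), blockEdge m b e' = e := by
  simp only [innerEdges, Finset.mem_image, Finset.mem_product]
  constructor
  · rintro ⟨⟨b, e'⟩, ⟨hb, he'⟩, h⟩
    exact ⟨b, hb, e', he', h⟩
  · rintro ⟨b, hb, e', he', h⟩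
    exact ⟨(b, e'), ⟨hb, he'⟩, h⟩

/-- Division with remainder by m gives the block and the offset; the edge leaves its block exactly
when m divides the coordinate of its end point in its own direction. -/
theorem mem_innerEdges_iff_inner (hm : 1 ≤ m) {e : (Fin 4 → ℤ) × Fin 4}
    (he : e ∈ edges (box 4 n)) :
    e ∈ innerEdges m q ↔ Inner m q (e.1 + stdVec e.2) e.2 := by
  obtain ⟨x, j⟩ := e
  rw [mem_innerEdges]
  constructor
  · rintro ⟨b, hb, ⟨r, j'⟩, hr, h⟩
    obtain ⟨rfl, rfl⟩ := Prod.mk.inj h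
    simp only at hr ⊢
    rw [blockPt_add, inner_blockPt hb (mem_edges.1 hr).2, Pi.add_apply, stdVec_apply, if_pos rfl]
    have : 0 ≤ r j' := (mem_box.1 (mem_edges.1 hr).1 j').1
    change r j' + 1 ≠ 0
    omega
  · rintro ⟨h1, h2⟩
    have hx := (mem_edges_box.1 he).1
    have hm0 : (0 : ℤ) < m := by exact_mod_cast hm
    simp only at h1 h2
    have hxlt : ∀ i, x i < q * m := fun i => by
      have h3 := h1 i
      rw [Pi.add_apply, stdVec_apply] at h3
      split_ifs at h3 <;> omega
    refine ⟨fun i => x i / m, mem_box.2 fun i => ⟨Int.ediv_nonneg (hx i).1 hm0.le,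
      Int.ediv_lt_of_lt_mul hm0 (hxlt i)⟩, (fun i => x i % m, j), ?_, ?_⟩
    · refine mem_edges_box.2 ⟨fun i => ⟨Int.emod_nonneg _ hm0.ne', Int.emod_lt_of_pos _ hm0⟩, ?_⟩
      rw [Pi.add_apply, stdVec_apply, if_pos rfl] at h2
      have h3 := Int.emod_lt_of_pos (x j) hm0
      have h4 : x j % m + 1 ≠ m := fun h5 => h2 ⟨x j / m + 1, by
        have h6 := Int.mul_ediv_add_emod (x j) m
        rw [mul_add, mul_one]
        linarith⟩
      omega
    · refine Prod.ext (funext fun i => ?_) rfl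
      exact Int.mul_ediv_add_emod (x i) m

/-- At points of a block, `Inner` singles out the directions with non-zero local coordinate, and the
direction of an inner edge is among them. So the global tree restricts to the axial tree of every
block, which is the reason for its two-case definition. -/
theorem blockEdge_mem_treeEdges {b : Fin 4 → ℤ} (hb : b ∈ box 4 q) {e : (Fin 4 → ℤ) × Fin 4}
    (he : e ∈ edges (box 4 m)) :
    blockEdge m b e ∈ treeEdges (Inner m q) ↔ e ∈ axialEdges 4 m := by
  obtain ⟨he1, he2⟩ := mem_edges.1 he
  have hI : ∀ k, Inner m q ((blockEdge m b e).1 + stdVec (blockEdge m b e).2) k ↔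
      (e.1 + stdVec e.2) k ≠ 0 := fun k => by
    simp only [blockEdge]
    rw [blockPt_add, inner_blockPt hb he2]
  have hj : (e.1 + stdVec e.2) e.2 ≠ 0 := by
    rw [Pi.add_apply, stdVec_apply, if_pos rfl]
    have := (mem_box.1 he1 e.2).1
    omega
  rw [mem_treeEdges, mem_axialEdges]
  simp only [hI]
  have h2 : (blockEdge m b e).2 = e.2 := rfl
  rw [h2]
  simp only [he, true_and]
  constructor
  · rintro (⟨-, h⟩ | ⟨h, -⟩)
    · intro k hk
      have := h k hk
      rwa [not_not, Pi.add_apply, stdVec_apply, if_neg hk.ne', add_zero] at this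
    · exact absurd hj (h _)
  · intro h
    refine Or.inl ⟨hj, fun k hk => ?_⟩
    rw [not_not, Pi.add_apply, stdVec_apply, if_neg hk.ne', add_zero, h k hk]

open scoped Classical in
/-- The edges that are neither inside a block nor in the spanning tree. -/
def outerEdges (m q n : ℕ) : Finset ((Fin 4 → ℤ) × Fin 4) :=
  (edges (box 4 n)).filter fun e => e ∉ treeEdges (Inner m q) ∧ e ∉ innerEdges m q

theorem mem_outerEdges {e : (Fin 4 → ℤ) × Fin 4} : e ∈ outerEdges m q n ↔
    e ∈ edges (box 4 n) ∧ e ∉ treeEdges (Inner m q) ∧ e ∉ innerEdges m q := by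
  simp [outerEdges]

/-- The block-adapted tree and the axial tree have the same size, and the non-tree edges inside
blocks are copies of free edges. That this is an equality makes the log g² terms cancel in both
bounds. -/
theorem card_outerEdges (hn : 1 ≤ n) (hqm : q * m ≤ n) :
    (outerEdges m q n).card + q ^ 4 * (freeEdges 4 m).card = (freeEdges 4 n).card := by
  classical
  have h1 := card_treeEdges hn (I := Inner m q) (d := 4) fun y _ k hk h0 => hk.2 (by simp [h0])
  have h2 := card_axialEdges (d := 4) hn
  have h3 : (freeEdges 4 n).card + (axialEdges 4 n).card = (edges (box 4 n)).card := by
    rw [freeEdges, Finset.card_sdiff_add_card_eq_card (axialEdges_subset 4 n)]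
  have h4 := Finset.card_filter_add_card_filter_not (s := edges (box 4 n))
    (fun e => e ∈ treeEdges (Inner m q))
  have h5 : (edges (box 4 n)).filter (fun e => e ∉ treeEdges (Inner m q)) =
      outerEdges m q n ∪ (box 4 q ×ˢ freeEdges 4 m).image fun a => blockEdge m a.1 a.2 := by
    ext e
    simp only [Finset.mem_filter, Finset.mem_union, mem_outerEdges, Finset.mem_image,
      Finset.mem_product]
    constructor
    · rintro ⟨he, ht⟩
      by_cases hi : e ∈ innerEdges m q
      · right
        obtain ⟨b, hb, e', he', rfl⟩ := mem_innerEdges.1 hi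
        refine ⟨(b, e'), ⟨hb, ?_⟩, rfl⟩
        rw [blockEdge_mem_treeEdges hb he'] at ht
        exact Finset.mem_sdiff.2 ⟨he', ht⟩
      · exact Or.inl ⟨he, ht, hi⟩
    · rintro (h | ⟨⟨b, e'⟩, ⟨hb, he'⟩, rfl⟩)
      · exact ⟨h.1, h.2.1⟩
      · have h6 := Finset.mem_sdiff.1 he'
        exact ⟨blockEdge_mem hqm hb h6.1, fun h => h6.2 ((blockEdge_mem_treeEdges hb h6.1).1 h)⟩
  have h6 : Disjoint (outerEdges m q n)
      ((box 4 q ×ˢ freeEdges 4 m).image fun a => blockEdge m a.1 a.2) := by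
    rw [Finset.disjoint_left]
    intro e he he'
    obtain ⟨⟨b, e'⟩, hbe, rfl⟩ := Finset.mem_image.1 he'
    obtain ⟨hb, he'⟩ := Finset.mem_product.1 hbe
    exact (mem_outerEdges.1 he).2.2 (mem_innerEdges.2 ⟨b, hb, e', freeEdges_subset 4 m he', rfl⟩)
  have h7 : ((box 4 q ×ˢ freeEdges 4 m).image fun a => blockEdge m a.1 a.2).card =
      q ^ 4 * (freeEdges 4 m).card := by
    rw [Finset.card_image_of_injOn, Finset.card_product, card_box]
    rintro ⟨b, e⟩ h ⟨b', e'⟩ h' heq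
    have ha := Finset.mem_product.1 h
    have ha' := Finset.mem_product.1 h'
    have := blockEdge_inj (freeEdges_subset 4 m ha.2) (freeEdges_subset 4 m ha'.2) heq
    exact Prod.ext this.1 this.2
  rw [h5, Finset.card_union_of_disjoint h6, h7] at h4
  omega

/-- The plaquette `p` of the block with index `b`. -/
def blockPlaquette (m : ℕ) (b : Fin 4 → ℤ) (p : (Fin 4 → ℤ) × Fin 4 × Fin 4) :
    (Fin 4 → ℤ) × Fin 4 × Fin 4 := (blockPt m b p.1, p.2)

theorem boundary_blockPlaquette (b : Fin 4 → ℤ) (p : (Fin 4 → ℤ) × Fin 4 × Fin 4) (s : Fin 4) :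
    boundary (blockPlaquette m b p) s = blockEdge m b (boundary p s) := by
  fin_cases s <;> simp [boundary, blockPlaquette, blockEdge, blockPt_add]

theorem blockPlaquette_mem (hqm : q * m ≤ n) {b : Fin 4 → ℤ} (hb : b ∈ box 4 q)
    {p : (Fin 4 → ℤ) × Fin 4 × Fin 4} (hp : p ∈ plaquettes (box 4 m)) :
    blockPlaquette m b p ∈ plaquettes (box 4 n) := by
  obtain ⟨h0, h1, h2, h3, h4⟩ := mem_plaquettes.1 hp
  refine mem_plaquettes.2 ⟨blockPt_mem_box hqm hb h0, h1, ?_, ?_, ?_⟩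
  · simp only [blockPlaquette, blockPt_add]
    exact blockPt_mem_box hqm hb h2
  · simp only [blockPlaquette, blockPt_add]
    exact blockPt_mem_box hqm hb h3
  · simp only [blockPlaquette, blockPt_add]
    exact blockPt_mem_box hqm hb h4

theorem blockPlaquette_inj {b b' : Fin 4 → ℤ} {p p' : (Fin 4 → ℤ) × Fin 4 × Fin 4}
    (hp : p ∈ plaquettes (box 4 m)) (hp' : p' ∈ plaquettes (box 4 m))
    (h : blockPlaquette m b p = blockPlaquette m b' p') : b = b' ∧ p = p' := by
  have h1 := blockPt_inj (mem_plaquettes.1 hp).1 (mem_plaquettes.1 hp').1 (Prod.mk.inj h).1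
  exact ⟨h1.1, Prod.ext h1.2 (Prod.mk.inj h).2⟩

/-- The plaquettes inside the blocks. -/
def innerPlaquettes (m q : ℕ) : Finset ((Fin 4 → ℤ) × Fin 4 × Fin 4) :=
  (box 4 q ×ˢ plaquettes (box 4 m)).image fun a => blockPlaquette m a.1 a.2

theorem mem_innerPlaquettes {p : (Fin 4 → ℤ) × Fin 4 × Fin 4} : p ∈ innerPlaquettes m q ↔
    ∃ b ∈ box 4 q, ∃ p' ∈ plaquettes (box 4 m), blockPlaquette m b p' = p := by
  simp only [innerPlaquettes, Finset.mem_image, Finset.mem_product]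
  constructor
  · rintro ⟨⟨b, e'⟩, ⟨hb, he'⟩, h⟩
    exact ⟨b, hb, e', he', h⟩
  · rintro ⟨b, hb, e', he', h⟩
    exact ⟨(b, e'), ⟨hb, he'⟩, h⟩

theorem innerPlaquettes_subset (hqm : q * m ≤ n) : innerPlaquettes m q ⊆ plaquettes (box 4 n) := by
  intro p hp
  obtain ⟨b, hb, p', hp', rfl⟩ := mem_innerPlaquettes.1 hp
  exact blockPlaquette_mem hqm hb hp'

theorem sum_innerPlaquettes (f : (Fin 4 → ℤ) × Fin 4 × Fin 4 → ℝ) :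
    ∑ p ∈ innerPlaquettes m q, f p =
      ∑ b ∈ box 4 q, ∑ p ∈ plaquettes (box 4 m), f (blockPlaquette m b p) := by
  rw [innerPlaquettes, Finset.sum_image, Finset.sum_product]
  rintro ⟨b, e⟩ h ⟨b', e'⟩ h' heq
  have ha := Finset.mem_product.1 h
  have ha' := Finset.mem_product.1 h'
  have := blockPlaquette_inj ha.2 ha'.2 heq
  exact Prod.ext this.1 this.2

end Blocks

/-! ### Upper bound for the partition function -/

section Upper

variable {N m q n : ℕ}

/-- The embedding of the edges of a block. -/
def blockEmb (hqm : q * m ≤ n) (a : ↥(box 4 q) × ↥(edges (box 4 m))) : ↥(edges (box 4 n)) :=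
  ⟨blockEdge m a.1 a.2, blockEdge_mem hqm a.1.2 a.2.2⟩

theorem blockEmb_injective (hqm : q * m ≤ n) : Function.Injective (blockEmb hqm) := by
  rintro ⟨b, e⟩ ⟨b', e'⟩ h
  have := blockEdge_inj e.2 e'.2 (Subtype.mk.inj h)
  exact Prod.ext (Subtype.ext this.1) (Subtype.ext this.2)

/-- The restriction of a configuration to a block. -/
def blockConfig (hqm : q * m ≤ n) (U : Config N (box 4 n)) (b : box 4 q) : Config N (box 4 m) :=
  fun e => U (blockEmb hqm (b, e))

theorem ext_blockConfig (hqm : q * m ≤ n) (U : Config N (box 4 n)) (b : box 4 q)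
    {e : (Fin 4 → ℤ) × Fin 4} (he : e ∈ edges (box 4 m)) :
    (blockConfig hqm U b).ext e = U.ext (blockEdge m b e) := by
  rw [Config.ext_mem _ he, Config.ext_mem _ (blockEdge_mem hqm b.2 he)]
  rfl

theorem holonomy_blockConfig (hqm : q * m ≤ n) (U : Config N (box 4 n)) (b : box 4 q)
    {p : (Fin 4 → ℤ) × Fin 4 × Fin 4} (hp : p ∈ plaquettes (box 4 m)) :
    holonomy (blockConfig hqm U b).ext p = holonomy U.ext (blockPlaquette m b p) := by
  simp only [holonomy_eq, boundary_blockPlaquette, ext_blockConfig hqm U b (boundary_mem_edges hp _)]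

theorem sum_innerPlaquettes_phi (hqm : q * m ≤ n) (U : Config N (box 4 n)) :
    ∑ p ∈ innerPlaquettes m q, phi (holonomy U.ext p) =
      ∑ b : box 4 q, wilsonAction (blockConfig hqm U b) := by
  rw [sum_innerPlaquettes, ← Finset.sum_coe_sort (box 4 q)]
  refine Finset.sum_congr rfl fun b _ => ?_
  rw [wilsonAction_eq]
  exact Finset.sum_congr rfl fun p hp => by rw [holonomy_blockConfig hqm U b hp]

/-- The order in which the edges outside the blocks are integrated out. -/
def edgeRank (e : (Fin 4 → ℤ) × Fin 4) : ℤ := 4 * ∑ i, e.1 i - (e.2 : ℤ)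

/-- Let y be the end point of the edge (x, j); the plaquette has y as its top corner and a second
direction k. If some k is inner at y, the edge in direction k ending at y lies in a block.
Otherwise, as (x, j) is not in the tree, some k > j has y_k ≠ 0, and that edge has smaller rank
because of its larger direction. The two remaining edges start at x - e_k and have smaller rank. -/
theorem exists_private_plaquette (hm : 1 ≤ m) {e : (Fin 4 → ℤ) × Fin 4}
    (he : e ∈ outerEdges m q n) : ∃ p ∈ plaquettes (box 4 n), ∃ s, boundary p s = e ∧
      ∀ s', s' ≠ s → boundary p s' ∈ innerEdges m q ∨ edgeRank (boundary p s') < edgeRank e := by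
  obtain ⟨he, htree, hinner⟩ := mem_outerEdges.1 he
  obtain ⟨x, j⟩ := e
  rw [mem_innerEdges_iff_inner hm he] at hinner
  rw [mem_treeEdges] at htree
  simp only at htree hinner
  obtain ⟨hx, hxj⟩ := mem_edges_box.1 he
  obtain ⟨hxb, hyb⟩ := mem_edges.1 he
  have hsub : ∀ k, k ≠ j → (x + stdVec j) k ≠ 0 →
      x - stdVec k ∈ box 4 n ∧ x - stdVec k + stdVec j ∈ box 4 n := by
    intro k hk hk0
    rw [Pi.add_apply, stdVec_apply, if_neg hk, add_zero] at hk0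
    constructor
    · refine mem_box.2 fun i => ?_
      have := hx i
      rw [Pi.sub_apply, stdVec_apply]
      split_ifs with hi
      · subst hi
        omega
      · omega
    · refine mem_box.2 fun i => ?_
      have h1 := hx i
      have h2 := mem_box.1 hyb i
      rw [Pi.add_apply] at h2
      rw [Pi.add_apply, Pi.sub_apply, stdVec_apply k]
      split_ifs with hi
      · subst hi
        rw [stdVec_apply, if_neg hk] at h2 ⊢
        omega
      · rw [sub_zero]
        exact h2
  -- A drop of one in the coordinate sum lowers the rank by 4, more than directions in {0, 1, 2, 3}
  -- can compensate.
  have hrank : ∀ k i : Fin 4, edgeRank (x - stdVec k, i) < edgeRank (x, j) := by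
    intro k i
    have h := sum_add_stdVec (x - stdVec k) k
    rw [sub_add_cancel] at h
    simp only [edgeRank]
    have := j.2
    have := i.2
    omega
  have hrank' : ∀ k, edgeRank (x - stdVec k + stdVec j, k) = edgeRank (x, k) := by
    intro k
    have h := sum_add_stdVec (x - stdVec k) k
    rw [sub_add_cancel] at h
    have h' := sum_add_stdVec (x - stdVec k) j
    simp only [edgeRank]
    omega
  have key : ∃ k, k ≠ j ∧ (x + stdVec j) k ≠ 0 ∧
      ((x - stdVec k + stdVec j, k) ∈ innerEdges m q ∨ j < k) := by
    by_cases hex : ∃ k, Inner m q (x + stdVec j) k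
    · obtain ⟨k, hk⟩ := hex
      have hkj : k ≠ j := fun h => hinner (h ▸ hk)
      have hk0 : (x + stdVec j) k ≠ 0 := fun h => hk.2 (by rw [h]; exact dvd_zero _)
      refine ⟨k, hkj, hk0, Or.inl ?_⟩
      have hs : x - stdVec k + stdVec j + stdVec k = x + stdVec j := by abel
      rw [mem_innerEdges_iff_inner hm (n := n) (mem_edges.2 ⟨(hsub k hkj hk0).2, by
        simpa only [hs] using hyb⟩)]
      simp only [hs]
      exact hk
    · push Not at hex htree
      obtain ⟨k, hk, hk0⟩ := htree.2 hex
      exact ⟨k, hk.ne', hk0, Or.inr hk⟩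
  obtain ⟨k, hkj, hk0, hor⟩ := key
  have hor' : (x - stdVec k + stdVec j, k) ∈ innerEdges m q ∨
      edgeRank (x - stdVec k + stdVec j, k) < edgeRank (x, j) := by
    refine hor.imp_right fun h => ?_
    rw [hrank']
    simp only [edgeRank]
    have : (j : ℕ) < k := h
    omega
  rcases lt_or_gt_of_ne hkj with hlt | hlt
  · refine ⟨(x - stdVec k, k, j), mem_plaquettes.2 ⟨(hsub k hkj hk0).1, hlt, ?_, (hsub k hkj hk0).2, ?_⟩,
      1, by simp [boundary], fun s' hs' => ?_⟩
    · simpa using hxb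
    · simpa using hyb
    · fin_cases s'
      · exact Or.inr (hrank k k)
      · exact absurd rfl hs'
      · exact hor'
      · exact Or.inr (hrank k j)
  · refine ⟨(x - stdVec k, j, k), mem_plaquettes.2 ⟨(hsub k hkj hk0).1, hlt, (hsub k hkj hk0).2, ?_, ?_⟩,
      2, by simp [boundary], fun s' hs' => ?_⟩
    · simpa using hxb
    · have hs : x - stdVec k + stdVec j + stdVec k = x + stdVec j := by abel
      simpa only [hs] using hyb
    · fin_cases s'
      · exact Or.inr (hrank k j)
      · exact hor'
      · exact absurd rfl hs'
      · exact Or.inr (hrank k k)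

/-- Invariance of φ under inversion handles the two reversed links. With two-sided invariance of
Haar measure, integrating any one link of a plaquette gives the same constant. -/
theorem exists_phi_holonomy_eq (u : (Fin 4 → ℤ) × Fin 4 → UN N) (p : (Fin 4 → ℤ) × Fin 4 × Fin 4)
    (s : Fin 4) : ∃ a b : UN N, ∀ u' : (Fin 4 → ℤ) × Fin 4 → UN N,
      (∀ s', s' ≠ s → u' (boundary p s') = u (boundary p s')) →
        phi (holonomy u' p) = phi (a * u' (boundary p s) * b) := by
  fin_cases s
  · refine ⟨1, u (boundary p 1) * (u (boundary p 2))⁻¹ * (u (boundary p 3))⁻¹, fun u' h => ?_⟩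
    rw [holonomy_eq, h 1 (by decide), h 2 (by decide), h 3 (by decide)]
    congr 1
    simp only [Fin.zero_eta]
    group
  · refine ⟨u (boundary p 0), (u (boundary p 2))⁻¹ * (u (boundary p 3))⁻¹, fun u' h => ?_⟩
    rw [holonomy_eq, h 0 (by decide), h 2 (by decide), h 3 (by decide)]
    congr 1
    simp only [Fin.mk_one]
    group
  · refine ⟨u (boundary p 3), (u (boundary p 1))⁻¹ * (u (boundary p 0))⁻¹, fun u' h => ?_⟩
    rw [← phi_inv, holonomy_eq, h 0 (by decide), h 1 (by decide), h 3 (by decide)]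
    congr 1
    simp only [Fin.reduceFinMk]
    group
  · refine ⟨1, u (boundary p 2) * (u (boundary p 1))⁻¹ * (u (boundary p 0))⁻¹, fun u' h => ?_⟩
    rw [← phi_inv, holonomy_eq, h 0 (by decide), h 1 (by decide), h 2 (by decide)]
    congr 1
    simp only [Fin.reduceFinMk]
    group

theorem ext_update_of_ne [DecidableEq (edges (box 4 n))] (U : Config N (box 4 n))
    (e : edges (box 4 n)) (x : UN N) {e' : (Fin 4 → ℤ) × Fin 4} (h : e' ≠ e) :
    Config.ext (Function.update U e x) e' = U.ext e' := by
  by_cases he : e' ∈ edges (box 4 n)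
  · rw [Config.ext_mem _ he, Config.ext_mem _ he, Function.update_of_ne]
    exact fun h' => h (congrArg Subtype.val h')
  · simp [Config.ext, Config.link, he]

theorem exp_mem_Icc {x : ℝ} (g : ℝ) (hx : 0 ≤ x) :
    Real.exp (-(1 / g ^ 2) * x) ∈ Set.Icc (0 : ℝ) 1 := by
  refine ⟨(Real.exp_pos _).le, Real.exp_le_one_iff.2 ?_⟩
  have : 0 ≤ 1 / g ^ 2 * x := by positivity
  linarith

theorem blockConfig_update [DecidableEq (edges (box 4 n))] (hqm : q * m ≤ n)
    (U : Config N (box 4 n)) (b : box 4 q) {e : edges (box 4 n)} (he : e.1 ∉ innerEdges m q)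
    (x : UN N) : blockConfig hqm (Function.update U e x) b = blockConfig hqm U b := by
  funext e'
  rw [blockConfig, blockConfig, Function.update_of_ne]
  rintro rfl
  exact he (mem_innerEdges.2 ⟨b, b.2, e', e'.2, rfl⟩)

theorem continuous_blockConfig (hqm : q * m ≤ n) (b : box 4 q) :
    Continuous fun U : Config N (box 4 n) => blockConfig hqm U b :=
  continuous_pi fun _ => continuous_apply _

/-- Integration over the blocks. -/
theorem integral_blocks (hqm : q * m ≤ n) {f : Config N (box 4 m) → ℝ} (hf : Continuous f) :
    ∫ U, ∏ b : box 4 q, f (blockConfig hqm U b) ∂(productHaar N (box 4 n)) =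
      (∫ V, f V ∂(productHaar N (box 4 m))) ^ q ^ 4 := by
  have h := integral_prod_blocks (haarUN N) (blockEmb_injective hqm) (fun _ => f)
    (fun _ => hf.measurable)
  rw [Finset.prod_const, Finset.card_univ, Fintype.card_coe, card_box] at h
  exact h

/-- Only the plaquettes inside blocks and the private plaquettes are kept, which lowers the action.
The private plaquettes are triangular with respect to the rank, so the outer links integrate out one
by one, leaving independent blocks. -/
theorem partitionFunction_le (N : ℕ) (hm : 1 ≤ m) (hqm : q * m ≤ n) (g : ℝ) :
    partitionFunction N (box 4 n) (g ^ 2) ≤ linkZ N 1 g ^ (outerEdges m q n).card *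
      partitionFunction N (box 4 m) (g ^ 2) ^ q ^ 4 := by
  classical
  have hpriv : ∀ e : (Fin 4 → ℤ) × Fin 4, ∃ p s, e ∈ outerEdges m q n →
      p ∈ plaquettes (box 4 n) ∧ boundary p s = e ∧
      ∀ s', s' ≠ s → boundary p s' ∈ innerEdges m q ∨ edgeRank (boundary p s') < edgeRank e := by
    intro e
    by_cases he : e ∈ outerEdges m q n
    · obtain ⟨p, hp, s, h⟩ := exists_private_plaquette hm he
      exact ⟨p, s, fun _ => ⟨hp, h⟩⟩
    · exact ⟨(0, 0, 0), 0, fun h => absurd h he⟩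
  choose P σ hP using hpriv
  have hother : ∀ e ∈ outerEdges m q n, ∀ s', s' ≠ σ e → boundary (P e) s' ≠ e := by
    intro e he s' hs' h
    rcases (hP e he).2.2 s' hs' with h1 | h1
    · exact (mem_outerEdges.1 he).2.2 (h ▸ h1)
    · rw [h] at h1
      exact lt_irrefl _ h1
  have hedge : ∀ e ∈ outerEdges m q n, ∀ e' ∈ outerEdges m q n, e' ≠ e →
      edgeRank e ≤ edgeRank e' → ∀ s, boundary (P e) s ≠ e' := by
    intro e he e' he' hne hr s h
    by_cases hs : s = σ e
    · rw [hs, (hP e he).2.1] at h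
      exact hne h.symm
    · rcases (hP e he).2.2 s hs with h1 | h1
      · exact (mem_outerEdges.1 he').2.2 (h ▸ h1)
      · rw [h] at h1
        exact absurd hr (not_le.2 h1)
  -- If two edges shared a private plaquette, the one of lower or equal rank would have the other on
  -- its plaquette, contrary to `hedge`.
  have hPinj : Set.InjOn P (outerEdges m q n) := by
    intro e he e' he' h
    by_contra hne
    rcases le_total (edgeRank e) (edgeRank e') with hr | hr
    · exact hedge e he e' he' (Ne.symm hne) hr (σ e') (by rw [h]; exact (hP e' he').2.1)
    · exact hedge e' he' e he hne hr (σ e) (by rw [← h]; exact (hP e he).2.1)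
  -- All edges of a plaquette inside a block are inner, whereas a private plaquette contains an
  -- outer edge.
  have hdisj : Disjoint (innerPlaquettes m q) ((outerEdges m q n).image P) := by
    rw [Finset.disjoint_left]
    intro p hp hp'
    obtain ⟨e, he, rfl⟩ := Finset.mem_image.1 hp'
    obtain ⟨b, hb, p', hp', h⟩ := mem_innerPlaquettes.1 hp
    refine (mem_outerEdges.1 he).2.2 (mem_innerEdges.2 ⟨b, hb, boundary p' (σ e),
      boundary_mem_edges hp' _, ?_⟩)
    rw [← boundary_blockPlaquette, h, (hP e he).2.1]
  have hact : ∀ U : Config N (box 4 n), ∑ b : box 4 q, wilsonAction (blockConfig hqm U b) +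
      ∑ e ∈ outerEdges m q n, phi (holonomy U.ext (P e)) ≤ wilsonAction U := by
    intro U
    rw [← sum_innerPlaquettes_phi hqm U, ← Finset.sum_image (g := P)
      (f := fun p => phi (holonomy U.ext p)) hPinj, ← Finset.sum_union hdisj, wilsonAction_eq]
    refine Finset.sum_le_sum_of_subset_of_nonneg (Finset.union_subset (innerPlaquettes_subset hqm)
      (Finset.image_subset_iff.2 fun e he => (hP e he).1)) fun _ _ _ => phi_nonneg _
  set R : Finset (edges (box 4 n)) := Finset.univ.filter fun e => e.1 ∈ outerEdges m q n with hR
  have hRm : ∀ {e}, e ∈ R ↔ e.1 ∈ outerEdges m q n := by simp [hR]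
  have hsumR : ∀ f : (Fin 4 → ℤ) × Fin 4 → ℝ,
      ∑ e ∈ R, f e = ∑ e ∈ outerEdges m q n, f e := by
    intro f
    refine Finset.sum_bij (fun e _ => e.1) (fun e he => hRm.1 he) (fun e _ e' _ h => Subtype.ext h)
      (fun e he => ⟨⟨e, (mem_outerEdges.1 he).1⟩, hRm.2 he, rfl⟩) fun _ _ => rfl
  have hcard : R.card = (outerEdges m q n).card := by
    have := hsumR fun _ => 1
    simpa using this
  set G : Config N (box 4 n) → ℝ := fun U =>
    ∏ b : box 4 q, Real.exp (-(1 / g ^ 2) * wilsonAction (blockConfig hqm U b)) with hG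
  set ψ : edges (box 4 n) → Config N (box 4 n) → ℝ := fun e U =>
    Real.exp (-(1 / g ^ 2) * (1 * phi (holonomy U.ext (P e)))) with hψ
  have hGc : Continuous G := continuous_finsetProd _ fun b _ => Real.continuous_exp.comp
    (continuous_const.mul (continuous_wilsonAction.comp (continuous_blockConfig hqm b)))
  have hψc : ∀ e, Continuous (ψ e) := fun e => Real.continuous_exp.comp
    (continuous_const.mul (continuous_const.mul (continuous_phi.comp (continuous_holonomy _))))
  have hint := integral_mul_prod_eq (haarUN N) R (fun e => edgeRank e) ψ (linkZ N 1 g) G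
    hGc.measurable
    (fun U => ⟨Finset.prod_nonneg fun b _ => (exp_mem_Icc g (wilsonAction_nonneg _)).1,
      Finset.prod_le_one (fun b _ => (exp_mem_Icc g (wilsonAction_nonneg _)).1)
        fun b _ => (exp_mem_Icc g (wilsonAction_nonneg _)).2⟩)
    (fun e => (hψc e).measurable)
    (fun e U => exp_mem_Icc g (by rw [one_mul]; exact phi_nonneg _))
    (fun e he U x => by
      simp only [hG]
      exact Finset.prod_congr rfl fun b _ => by
        rw [blockConfig_update hqm U b (mem_outerEdges.1 (hRm.1 he)).2.2])
    (fun e he e' he' hne hr U x => by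
      have h := hedge e (hRm.1 he) e' (hRm.1 he') (fun h => hne (Subtype.ext h)) hr
      simp only [hψ, holonomy_eq]
      rw [ext_update_of_ne U e' x (h 0), ext_update_of_ne U e' x (h 1),
        ext_update_of_ne U e' x (h 2), ext_update_of_ne U e' x (h 3)])
    (fun e he U => by
      obtain ⟨a, b, hab⟩ := exists_phi_holonomy_eq (Config.ext U) (P e) (σ e)
      have h1 : ∀ x, phi (holonomy (Config.ext (Function.update U e x)) (P e)) =
          phi (a * x * b) := by
        intro x
        rw [hab _ fun s' hs' => ext_update_of_ne U e x (hother e (hRm.1 he) s' hs'),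
          (hP e (hRm.1 he)).2.1, Config.ext_coe, Function.update_self]
      simp only [hψ, h1]
      have hc : Continuous fun U : UN N => Real.exp (-(1 / g ^ 2) * (1 * phi U)) :=
        Real.continuous_exp.comp (continuous_const.mul (continuous_const.mul continuous_phi))
      have hmp := measurePreserving_mul_mul a b
      rw [linkZ]
      conv_rhs => rw [← hmp.map_eq, integral_map hmp.measurable.aemeasurable
        hc.measurable.aestronglyMeasurable])
  rw [hcard] at hint
  have hblocks := integral_blocks hqm (f := fun V : Config N (box 4 m) =>
    Real.exp (-(1 / g ^ 2) * wilsonAction V))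
    (Real.continuous_exp.comp (continuous_const.mul continuous_wilsonAction))
  have hfinal : ∫ U, G U * ∏ e ∈ R, ψ e U ∂(productHaar N (box 4 n)) =
      linkZ N 1 g ^ (outerEdges m q n).card * partitionFunction N (box 4 m) (g ^ 2) ^ q ^ 4 := by
    rw [partitionFunction, ← hblocks]
    exact hint
  rw [← hfinal, partitionFunction]
  refine integral_mono (integrable_of_continuous (Real.continuous_exp.comp
    (continuous_const.mul continuous_wilsonAction)))
    (integrable_of_continuous (hGc.mul (continuous_finsetProd _ fun e _ => hψc e))) fun U => ?_
  simp only [hG, hψ]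
  rw [← Real.exp_sum, ← Real.exp_sum, ← Real.exp_add, Real.exp_le_exp, ← Finset.mul_sum,
    ← Finset.mul_sum, ← mul_add]
  have h1 := hsumR fun e => 1 * phi (holonomy U.ext (P e))
  rw [h1]
  simp only [one_mul]
  have h2 : 0 ≤ 1 / g ^ 2 := by positivity
  have h3 := mul_le_mul_of_nonneg_left (hact U) h2
  linarith

end Upper

/-! ### Lower bound for the partition function -/

section Lower

variable {N m q n : ℕ}

/-- The edges on the boundary of a box. -/
def boundaryEdges (m : ℕ) : Finset ((Fin 4 → ℤ) × Fin 4) :=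
  (edges (box 4 m)).filter fun e => ∃ k, k ≠ e.2 ∧ (e.1 k = 0 ∨ e.1 k + 1 = m)

theorem mem_boundaryEdges {e : (Fin 4 → ℤ) × Fin 4} : e ∈ boundaryEdges m ↔
    e ∈ edges (box 4 m) ∧ ∃ k, k ≠ e.2 ∧ (e.1 k = 0 ∨ e.1 k + 1 = m) := by
  simp [boundaryEdges]

/-- Four edge directions, four fixed coordinates and two faces for each give 32 families of at most
m³ edges. -/
theorem card_boundaryEdges_le (m : ℕ) : (boundaryEdges m).card ≤ 32 * m ^ 3 := by
  let c : Bool → ℤ := fun s => if s then 0 else (m : ℤ) - 1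
  let S : Fin 4 × Fin 4 × Bool → Finset ((Fin 4 → ℤ) × Fin 4) := fun a =>
    (Fintype.piFinset fun i => if i = a.2.1 then {c a.2.2} else Finset.Ico (0 : ℤ) m).image
      fun x => (x, a.1)
  have hsub : boundaryEdges m ⊆ Finset.univ.biUnion S := by
    rintro ⟨x, j⟩ he
    obtain ⟨he, k, -, hk⟩ := mem_boundaryEdges.1 he
    have hx := (mem_edges_box.1 he).1
    refine Finset.mem_biUnion.2 ⟨(j, k, decide (x k = 0)), Finset.mem_univ _,
      Finset.mem_image.2 ⟨x, Fintype.mem_piFinset.2 fun i => ?_, rfl⟩⟩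
    simp only
    split_ifs with hi
    · subst hi
      rw [Finset.mem_singleton]
      by_cases h0 : x i = 0
      · simp [c, h0]
      · have h1 : x i + 1 = m := hk.resolve_left h0
        simp only [c, h0, decide_false, Bool.false_eq_true, if_false]
        omega
    · exact Finset.mem_Ico.2 (hx i)
  have hS : ∀ a, (S a).card ≤ m ^ 3 := by
    rintro ⟨j, k, s⟩
    refine Finset.card_image_le.trans (le_of_eq ?_)
    rw [Fintype.card_piFinset, ← Finset.mul_prod_erase _ _ (Finset.mem_univ k), if_pos rfl,
      Finset.prod_congr rfl (g := fun _ => m)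
        (fun i hi => by rw [if_neg (Finset.ne_of_mem_erase hi)]; simp)]
    simp
  calc (boundaryEdges m).card ≤ (Finset.univ.biUnion S).card := Finset.card_le_card hsub
    _ ≤ (Finset.univ : Finset (Fin 4 × Fin 4 × Bool)).card * m ^ 3 :=
        Finset.card_biUnion_le_card_mul _ _ _ fun a _ => hS a
    _ = 32 * m ^ 3 := by simp

theorem mem_plaquettes_box {x : Fin 4 → ℤ} {j k : Fin 4} (hjk : j < k)
    (hx : ∀ i, 0 ≤ x i ∧ x i < m) (hj : x j + 1 < m) (hk : x k + 1 < m) :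
    (x, j, k) ∈ plaquettes (box 4 m) := by
  have h : ∀ v : Fin 4 → ℤ, (∀ i, 0 ≤ v i ∧ v i ≤ (if i = j then 1 else 0) + if i = k then 1 else 0) →
      x + v ∈ box 4 m := by
    intro v hv
    refine mem_box.2 fun i => ?_
    have h1 := hv i
    have h2 := hx i
    rw [Pi.add_apply]
    by_cases hi : i = j
    · subst hi
      rw [if_pos rfl, if_neg hjk.ne] at h1
      omega
    · by_cases hi' : i = k
      · subst hi'
        rw [if_pos rfl, if_neg hi] at h1
        omega
      · rw [if_neg hi, if_neg hi'] at h1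
        omega
  refine mem_plaquettes.2 ⟨mem_box.2 hx, hjk, h _ fun i => ?_, h _ fun i => ?_, ?_⟩
  · simp only [stdVec_apply]
    split_ifs <;> simp
  · simp only [stdVec_apply]
    split_ifs <;> simp
  · rw [add_assoc]
    refine h _ fun i => ?_
    rw [Pi.add_apply, stdVec_apply, stdVec_apply]
    split_ifs <;> simp

/-- Around an edge whose transverse coordinates all avoid the faces of the block, every plaquette
stays inside the block. -/
theorem mem_boundaryEdges_of_boundary {p : (Fin 4 → ℤ) × Fin 4 × Fin 4}
    (hp : p ∈ plaquettes (box 4 n)) (hpi : p ∉ innerPlaquettes m q) {b : Fin 4 → ℤ}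
    (hb : b ∈ box 4 q) {e : (Fin 4 → ℤ) × Fin 4} (he : e ∈ edges (box 4 m)) (s : Fin 4)
    (h : boundary p s = blockEdge m b e) : e ∈ boundaryEdges m := by
  obtain ⟨x, j, k⟩ := p
  obtain ⟨r, l⟩ := e
  have hjk : j < k := (mem_plaquettes.1 hp).2.1
  have hkj := hjk.ne'
  obtain ⟨hr, hrl⟩ := mem_edges_box.1 he
  refine mem_boundaryEdges.2 ⟨he, ?_⟩
  by_contra hne
  push Not at hne
  simp only at hne
  have hlower : ∀ i, i ≠ l → ∀ i', 0 ≤ (r - stdVec i) i' ∧ (r - stdVec i) i' < m := by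
    intro i hi i'
    have h1 := hne i hi
    have h2 := hr i'
    rw [Pi.sub_apply, stdVec_apply]
    split_ifs with hii
    · subst hii
      omega
    · omega
  fin_cases s
  · obtain ⟨rfl, rfl⟩ := Prod.mk.inj (show (x, j) = (blockPt m b r, l) from h)
    have h1 := hne k hkj
    have h2 := hr k
    exact hpi (mem_innerPlaquettes.2 ⟨b, hb, (r, j, k),
      mem_plaquettes_box hjk hr hrl (by omega), rfl⟩)
  · obtain ⟨h1, rfl⟩ := Prod.mk.inj (show (x + stdVec j, k) = (blockPt m b r, l) from h)
    have h2 : x = blockPt m b (r - stdVec j) := by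
      rw [← blockPt_sub, ← h1, add_sub_cancel_right]
    refine hpi (mem_innerPlaquettes.2 ⟨b, hb, (r - stdVec j, j, k),
      mem_plaquettes_box hjk (hlower j hjk.ne) ?_ ?_, by rw [h2]; rfl⟩)
    · have := hr j
      rw [Pi.sub_apply, stdVec_apply, if_pos rfl]
      omega
    · rw [Pi.sub_apply, stdVec_apply, if_neg hkj]
      omega
  · obtain ⟨h1, rfl⟩ := Prod.mk.inj (show (x + stdVec k, j) = (blockPt m b r, l) from h)
    have h2 : x = blockPt m b (r - stdVec k) := by
      rw [← blockPt_sub, ← h1, add_sub_cancel_right]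
    refine hpi (mem_innerPlaquettes.2 ⟨b, hb, (r - stdVec k, j, k),
      mem_plaquettes_box hjk (hlower k hkj) ?_ ?_, by rw [h2]; rfl⟩)
    · rw [Pi.sub_apply, stdVec_apply, if_neg hjk.ne]
      omega
    · have := hr k
      rw [Pi.sub_apply, stdVec_apply, if_pos rfl]
      omega
  · obtain ⟨rfl, rfl⟩ := Prod.mk.inj (show (x, k) = (blockPt m b r, l) from h)
    have h1 := hne j hjk.ne
    have h2 := hr j
    exact hpi (mem_innerPlaquettes.2 ⟨b, hb, (r, j, k),
      mem_plaquettes_box hjk hr (by omega) hrl, rfl⟩)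

/-- Once the slot s is fixed, the edge and the other direction of the plaquette determine it, so an
edge fills a given slot at most four times. -/
theorem sum_boundary_le (Λ : Finset (Fin 4 → ℤ)) (f : (Fin 4 → ℤ) × Fin 4 → ℝ) (hf : ∀ e, 0 ≤ f e)
    (s : Fin 4) : ∑ p ∈ plaquettes Λ, f (boundary p s) ≤ 4 * ∑ e ∈ edges Λ, f e := by
  let o : (Fin 4 → ℤ) × Fin 4 × Fin 4 → Fin 4 := fun p => ![p.2.2, p.2.1, p.2.2, p.2.1] s
  have hinj : Set.InjOn (fun p => (boundary p s, o p)) (plaquettes Λ) := by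
    rintro ⟨x, j, k⟩ - ⟨x', j', k'⟩ - h
    obtain ⟨h1, h2⟩ := Prod.mk.inj h
    fin_cases s
    · obtain ⟨rfl, rfl⟩ := Prod.mk.inj (show (x, j) = (x', j') from h1)
      have h2 : k = k' := h2
      rw [h2]
    · obtain ⟨h3, rfl⟩ := Prod.mk.inj (show (x + stdVec j, k) = (x' + stdVec j', k') from h1)
      have h2 : j = j' := h2
      subst h2
      rw [add_right_cancel h3]
    · obtain ⟨h3, rfl⟩ := Prod.mk.inj (show (x + stdVec k, j) = (x' + stdVec k', j') from h1)
      have h2 : k = k' := h2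
      subst h2
      rw [add_right_cancel h3]
    · obtain ⟨rfl, rfl⟩ := Prod.mk.inj (show (x, k) = (x', k') from h1)
      have h2 : j = j' := h2
      rw [h2]
  have h1 : ∑ p ∈ plaquettes Λ, f (boundary p s) =
      ∑ a ∈ (plaquettes Λ).image (fun p => (boundary p s, o p)), f a.1 := by
    rw [Finset.sum_image hinj]
  have h2 : ∑ a ∈ edges Λ ×ˢ (Finset.univ : Finset (Fin 4)), f a.1 = 4 * ∑ e ∈ edges Λ, f e := by
    rw [Finset.sum_product, Finset.mul_sum]
    simp
  rw [h1, ← h2]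
  refine Finset.sum_le_sum_of_subset_of_nonneg (fun a ha => ?_) fun a _ _ => hf _
  obtain ⟨p, hp, rfl⟩ := Finset.mem_image.1 ha
  exact Finset.mem_product.2 ⟨boundary_mem_edges hp s, Finset.mem_univ _⟩

theorem phi_holonomy_le (u : (Fin 4 → ℤ) × Fin 4 → UN N) (p : (Fin 4 → ℤ) × Fin 4 × Fin 4) :
    phi (holonomy u p) ≤ 4 * ∑ s, phi (u (boundary p s)) := by
  have h1 := dev_mul_le (u (boundary p 0) * u (boundary p 1) * (u (boundary p 2))⁻¹)
    (u (boundary p 3))⁻¹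
  have h2 := dev_mul_le (u (boundary p 0) * u (boundary p 1)) (u (boundary p 2))⁻¹
  have h3 := dev_mul_le (u (boundary p 0)) (u (boundary p 1))
  rw [dev_inv] at h1 h2
  rw [← holonomy_eq] at h1
  have h0 := dev_nonneg (holonomy u p)
  simp only [phi_eq_dev, Fin.sum_univ_four]
  set a := dev (u (boundary p 0))
  set b := dev (u (boundary p 1))
  set c := dev (u (boundary p 2))
  set d := dev (u (boundary p 3))
  have h4 : dev (holonomy u p) ≤ a + b + c + d := by linarith
  have h5 := pow_le_pow_left₀ h0 h4 2
  nlinarith [sq_nonneg (a - b), sq_nonneg (a - c), sq_nonneg (a - d), sq_nonneg (b - c),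
    sq_nonneg (b - d), sq_nonneg (c - d)]

/-- A plaquette outside the blocks costs at most 4 times the sum of φ over its links, and each link
fills each of four slots at most four times: 4 · 4 · 4 = 64. Links in the tree are 1, so only outer
edges and block boundaries pay. -/
theorem wilsonAction_le (hqm : q * m ≤ n) (U : Config N (box 4 n)) (htree : ∀ e ∈ edges (box 4 n),
      e ∈ treeEdges (Inner m q) → U.ext e = 1) :
    wilsonAction U ≤ ∑ b : box 4 q, massiveAction 64 (boundaryEdges m) (blockConfig hqm U b) +
      64 * ∑ e ∈ outerEdges m q n, phi (U.ext e) := by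
  classical
  set B : Finset ((Fin 4 → ℤ) × Fin 4) :=
    (box 4 q ×ˢ boundaryEdges m).image fun a => blockEdge m a.1 a.2 with hB
  have hWe : ∀ e ∈ boundaryEdges m, e ∈ edges (box 4 m) := fun e he => (mem_boundaryEdges.1 he).1
  have hdisj : Disjoint (outerEdges m q n) B := by
    rw [Finset.disjoint_left]
    intro e he he'
    obtain ⟨⟨b, e'⟩, hbe, rfl⟩ := Finset.mem_image.1 he'
    obtain ⟨hb, he'⟩ := Finset.mem_product.1 hbe
    exact (mem_outerEdges.1 he).2.2 (mem_innerEdges.2 ⟨b, hb, e', hWe _ he', rfl⟩)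
  have hBsum : ∑ e ∈ B, phi (U.ext e) =
      ∑ b : box 4 q, ∑ e ∈ boundaryEdges m, phi ((blockConfig hqm U b).ext e) := by
    rw [hB, Finset.sum_image, Finset.sum_product, ← Finset.sum_coe_sort (box 4 q)]
    · refine Finset.sum_congr rfl fun b _ => Finset.sum_congr rfl fun e he => ?_
      rw [ext_blockConfig hqm U b (hWe e he)]
    · rintro ⟨b, e⟩ h ⟨b', e'⟩ h' heq
      have ha := Finset.mem_product.1 h
      have ha' := Finset.mem_product.1 h'
      have := blockEdge_inj (hWe _ ha.2) (hWe _ ha'.2) heq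
      exact Prod.ext this.1 this.2
  set f : (Fin 4 → ℤ) × Fin 4 → ℝ := fun e =>
    if e ∈ outerEdges m q n ∪ B then phi (U.ext e) else 0 with hf
  have hf0 : ∀ e, 0 ≤ f e := fun e => by
    simp only [hf]
    split_ifs
    · exact phi_nonneg _
    · exact le_rfl
  have hfsum : ∑ e ∈ edges (box 4 n), f e ≤ ∑ e ∈ outerEdges m q n, phi (U.ext e) +
      ∑ e ∈ B, phi (U.ext e) := by
    rw [← Finset.sum_union hdisj, hf, ← Finset.sum_filter]
    exact Finset.sum_le_sum_of_subset_of_nonneg (fun e he => (Finset.mem_filter.1 he).2)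
      fun _ _ _ => phi_nonneg _
  have hle : ∀ p ∈ plaquettes (box 4 n) \ innerPlaquettes m q, ∀ s,
      phi (U.ext (boundary p s)) ≤ f (boundary p s) := by
    intro p hp s
    obtain ⟨hp, hpi⟩ := Finset.mem_sdiff.1 hp
    have he := boundary_mem_edges hp s
    by_cases ht : boundary p s ∈ treeEdges (Inner m q)
    · rw [htree _ he ht, phi_one]
      exact hf0 _
    have hmem : boundary p s ∈ outerEdges m q n ∪ B := by
      by_cases hi : boundary p s ∈ innerEdges m q
      · obtain ⟨b, hb, e', he', h⟩ := mem_innerEdges.1 hi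
        refine Finset.mem_union_right _ (Finset.mem_image.2 ⟨(b, e'), Finset.mem_product.2 ⟨hb, ?_⟩, h⟩)
        exact mem_boundaryEdges_of_boundary hp hpi hb he' s h.symm
      · exact Finset.mem_union_left _ (mem_outerEdges.2 ⟨he, ht, hi⟩)
    simp only [hf, if_pos hmem]
    exact le_rfl
  have hrest : ∑ p ∈ plaquettes (box 4 n) \ innerPlaquettes m q, phi (holonomy U.ext p) ≤
      64 * ∑ e ∈ edges (box 4 n), f e := by
    calc ∑ p ∈ plaquettes (box 4 n) \ innerPlaquettes m q, phi (holonomy U.ext p)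
        ≤ ∑ p ∈ plaquettes (box 4 n) \ innerPlaquettes m q, 4 * ∑ s, f (boundary p s) :=
          Finset.sum_le_sum fun p hp => (phi_holonomy_le U.ext p).trans
            (mul_le_mul_of_nonneg_left (Finset.sum_le_sum fun s _ => hle p hp s) (by norm_num))
      _ ≤ ∑ p ∈ plaquettes (box 4 n), 4 * ∑ s, f (boundary p s) :=
          Finset.sum_le_sum_of_subset_of_nonneg Finset.sdiff_subset fun p _ _ =>
            mul_nonneg (by norm_num) (Finset.sum_nonneg fun s _ => hf0 _)
      _ = 4 * ∑ s, ∑ p ∈ plaquettes (box 4 n), f (boundary p s) := by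
          rw [← Finset.mul_sum, Finset.sum_comm]
      _ ≤ 4 * ∑ _s : Fin 4, 4 * ∑ e ∈ edges (box 4 n), f e :=
          mul_le_mul_of_nonneg_left (Finset.sum_le_sum fun s _ => sum_boundary_le _ f hf0 s)
            (by norm_num)
      _ = 64 * ∑ e ∈ edges (box 4 n), f e := by
          simp
          ring
  rw [wilsonAction_eq, ← Finset.sum_sdiff (innerPlaquettes_subset hqm), sum_innerPlaquettes_phi hqm U]
  simp only [massiveAction, Finset.sum_add_distrib, ← Finset.mul_sum]
  rw [← hBsum]
  linarith

theorem blockConfig_fixOne (hqm : q * m ≤ n) (U : Config N (box 4 n)) (b : box 4 q) :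
    blockConfig hqm (fixOne (treeEdges (Inner m q)) U) b =
      fixOne (axialEdges 4 m) (blockConfig hqm U b) := by
  funext e
  have h := blockEdge_mem_treeEdges b.2 e.2
  by_cases he : e.1 ∈ axialEdges 4 m <;> simp [blockConfig, fixOne, blockEmb, h, he]

/-- In the tree gauge `wilsonAction_le` bounds the action by a sum over separate blocks and single
outer links, so the integral of the smaller integrand factorizes. -/
theorem le_partitionFunction (N : ℕ) (hqm : q * m ≤ n) (g : ℝ) :
    linkZ N 64 g ^ (outerEdges m q n).card * massiveZ N m 64 (boundaryEdges m) g ^ q ^ 4 ≤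
      partitionFunction N (box 4 n) (g ^ 2) := by
  classical
  set T := treeEdges (Inner m q) with hT
  have hfix := integral_fixOne (N := N) T (exists_gaugeAct_eq_one (n := n) (treeEdges_unique _))
    (f := fun U : Config N (box 4 n) => Real.exp (-(1 / g ^ 2) * wilsonAction U))
    (Real.continuous_exp.comp (continuous_const.mul continuous_wilsonAction))
    (fun h U => by rw [wilsonAction_gaugeAct])
  rw [partitionFunction, ← hfix]
  set R : Finset (edges (box 4 n)) := Finset.univ.filter fun e => e.1 ∈ outerEdges m q n with hR
  have hRm : ∀ {e}, e ∈ R ↔ e.1 ∈ outerEdges m q n := by simp [hR]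
  have hsumR : ∀ f : (Fin 4 → ℤ) × Fin 4 → ℝ,
      ∑ e ∈ R, f e = ∑ e ∈ outerEdges m q n, f e := by
    intro f
    refine Finset.sum_bij (fun e _ => e.1) (fun e he => hRm.1 he) (fun e _ e' _ h => Subtype.ext h)
      (fun e he => ⟨⟨e, (mem_outerEdges.1 he).1⟩, hRm.2 he, rfl⟩) fun _ _ => rfl
  have hcard : R.card = (outerEdges m q n).card := by
    have := hsumR fun _ => 1
    simpa using this
  have hpos : ∀ V : Config N (box 4 m), 0 ≤ massiveAction 64 (boundaryEdges m) V := fun V =>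
    add_nonneg (wilsonAction_nonneg V)
      (mul_nonneg (by norm_num) (Finset.sum_nonneg fun _ _ => phi_nonneg _))
  set F : Config N (box 4 m) → ℝ := fun V =>
    Real.exp (-(1 / g ^ 2) * massiveAction 64 (boundaryEdges m) (fixOne (axialEdges 4 m) V)) with hF
  have hFc : Continuous F := Real.continuous_exp.comp (continuous_const.mul
    ((continuous_massiveAction _ _).comp (continuous_fixOne _)))
  set G : Config N (box 4 n) → ℝ := fun U => ∏ b : box 4 q, F (blockConfig hqm U b) with hG
  set ψ : edges (box 4 n) → Config N (box 4 n) → ℝ := fun e U =>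
    Real.exp (-(1 / g ^ 2) * (64 * phi (U e))) with hψ
  have hGc : Continuous G := continuous_finsetProd _ fun b _ =>
    hFc.comp (continuous_blockConfig hqm b)
  have hψc : ∀ e, Continuous (ψ e) := fun e => Real.continuous_exp.comp
    (continuous_const.mul (continuous_const.mul (continuous_phi.comp (continuous_apply e))))
  -- A constant rank suffices, because each factor depends on its own link only.
  have hint := integral_mul_prod_eq (haarUN N) R (fun _ => 0) ψ (linkZ N 64 g) G
    hGc.measurable
    (fun U => ⟨Finset.prod_nonneg fun b _ => (exp_mem_Icc g (hpos _)).1,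
      Finset.prod_le_one (fun b _ => (exp_mem_Icc g (hpos _)).1)
        fun b _ => (exp_mem_Icc g (hpos _)).2⟩)
    (fun e => (hψc e).measurable)
    (fun e U => exp_mem_Icc g (mul_nonneg (by norm_num) (phi_nonneg _)))
    (fun e he U x => by
      simp only [hG]
      exact Finset.prod_congr rfl fun b _ => by
        rw [blockConfig_update hqm U b (mem_outerEdges.1 (hRm.1 he)).2.2])
    (fun e he e' he' hne hr U x => by
      simp only [hψ]
      rw [Function.update_of_ne (Ne.symm hne)])
    (fun e he U => by
      simp only [hψ, Function.update_self]
      rfl)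
  rw [hcard] at hint
  have hfinal : ∫ U, G U * ∏ e ∈ R, ψ e U ∂(productHaar N (box 4 n)) =
      linkZ N 64 g ^ (outerEdges m q n).card *
        massiveZ N m 64 (boundaryEdges m) g ^ q ^ 4 := by
    rw [massiveZ, ← integral_blocks hqm hFc]
    exact hint
  rw [← hfinal]
  refine integral_mono
    (integrable_of_continuous (hGc.mul (continuous_finsetProd _ fun e _ => hψc e)))
    (integrable_of_continuous (Real.continuous_exp.comp
      (continuous_const.mul (continuous_wilsonAction.comp (continuous_fixOne _))))) fun U => ?_
  simp only [hG, hF, hψ]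
  rw [← Real.exp_sum, ← Real.exp_sum, ← Real.exp_add, Real.exp_le_exp, ← Finset.mul_sum,
    ← Finset.mul_sum, ← mul_add]
  have hact := wilsonAction_le hqm (fixOne T U) fun e _ ht => by
    rw [ext_fixOne, if_pos ht]
  have h1 : ∑ e ∈ R, 64 * phi (U e) = 64 * ∑ e ∈ outerEdges m q n, phi ((fixOne T U).ext e) := by
    rw [← hsumR, Finset.mul_sum]
    refine Finset.sum_congr rfl fun e he => ?_
    rw [ext_fixOne, if_neg (mem_outerEdges.1 (hRm.1 he)).2.1, Config.ext_coe]
  simp only [hT, blockConfig_fixOne] at hact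
  rw [h1]
  have h2 : 0 ≤ 1 / g ^ 2 := by positivity
  have h3 := mul_le_mul_of_nonneg_left hact h2
  simp only [hT]
  linarith

end Lower

/-! ### The thermodynamic limit -/

section Limit

variable {N m n : ℕ}

/-- The logarithm of the partition function after subtraction of its divergent part. -/
def freeEnergy (N n : ℕ) (g : ℝ) : ℝ :=
  Real.log (partitionFunction N (box 4 n) (g ^ 2)) -
    (freeEdges 4 n).card * ((N : ℝ) ^ 2 / 2) * Real.log (g ^ 2)

theorem tendsto_freeEnergy (N : ℕ) (hm : 1 ≤ m) : Tendsto (freeEnergy N m) (𝓝[>] 0)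
    (𝓝 ((freeEdges 4 m).card * linkConst N + (N : ℝ) ^ 2 * ((m : ℝ) ^ 4 * maxwellConst 4 m))) := by
  have h := tendsto_log_massiveZ N hm le_rfl ∅
  simp only [← partitionFunction_eq_massiveZ, log_det_massiveMatrix_empty] at h
  have hm0 : (m : ℝ) ≠ 0 := by
    have : m ≠ 0 := by omega
    exact_mod_cast this
  have hlim : (N : ℝ) ^ 2 * ((m : ℝ) ^ 4 * maxwellConst 4 m) =
      -((N : ℝ) ^ 2 / 2 * Real.log (maxwellForm0 4 m).toMatrix'.det) := by
    rw [maxwellConst]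
    field_simp
  rw [hlim, ← sub_eq_add_neg]
  exact h

theorem partitionFunction_pos (N n : ℕ) (s : ℝ) : 0 < partitionFunction N (box 4 n) s :=
  integral_exp_pos (integrable_of_continuous (Real.continuous_exp.comp
    (continuous_const.mul continuous_wilsonAction)))

theorem massiveZ_pos (N m : ℕ) (κ : ℝ) (W : Finset ((Fin 4 → ℤ) × Fin 4)) (g : ℝ) :
    0 < massiveZ N m κ W g :=
  integral_exp_pos (integrable_of_continuous (Real.continuous_exp.comp
    (continuous_const.mul ((continuous_massiveAction κ W).comp (continuous_fixOne _)))))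

theorem linkZ_pos (N : ℕ) (κ g : ℝ) : 0 < linkZ N κ g := by
  have hc : Continuous fun U : UN N => Real.exp (-(1 / g ^ 2) * (κ * phi U)) :=
    Real.continuous_exp.comp (continuous_const.mul (continuous_const.mul continuous_phi))
  obtain ⟨C, hC⟩ := (isCompact_univ.image hc).isBounded.exists_norm_le
  exact integral_exp_pos (Integrable.of_bound hc.measurable.aestronglyMeasurable C
    (ae_of_all _ fun U => hC _ ⟨U, trivial, rfl⟩))

theorem card_outerEdges_cast (hn : 1 ≤ n) : ((outerEdges m (n / m) n).card : ℝ) =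
    (freeEdges 4 n).card - ((n / m : ℕ) : ℝ) ^ 4 * (freeEdges 4 m).card := by
  have h := card_outerEdges hn (Nat.div_mul_le_self n m)
  rw [← h]
  push_cast
  ring

theorem freeEnergy_le (N : ℕ) (hm : 1 ≤ m) (hn : 1 ≤ n) (g : ℝ) :
    freeEnergy N n g ≤ ((freeEdges 4 n).card - ((n / m : ℕ) : ℝ) ^ 4 * (freeEdges 4 m).card) *
      (Real.log (linkZ N 1 g) - (N : ℝ) ^ 2 / 2 * Real.log (g ^ 2)) +
        ((n / m : ℕ) : ℝ) ^ 4 * freeEnergy N m g := by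
  have h := Real.log_le_log (partitionFunction_pos N n (g ^ 2))
    (partitionFunction_le N hm (Nat.div_mul_le_self n m) g)
  rw [Real.log_mul (pow_ne_zero _ (linkZ_pos N 1 g).ne')
    (pow_ne_zero _ (partitionFunction_pos N m _).ne'), Real.log_pow, Real.log_pow,
    card_outerEdges_cast hn] at h
  push_cast at h
  rw [freeEnergy, freeEnergy]
  linarith

theorem le_freeEnergy (N : ℕ) (hn : 1 ≤ n) (g : ℝ) :
    ((freeEdges 4 n).card - ((n / m : ℕ) : ℝ) ^ 4 * (freeEdges 4 m).card) *
      (Real.log (linkZ N 64 g) - (N : ℝ) ^ 2 / 2 * Real.log (g ^ 2)) +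
        ((n / m : ℕ) : ℝ) ^ 4 * (Real.log (massiveZ N m 64 (boundaryEdges m) g) -
          (freeEdges 4 m).card * ((N : ℝ) ^ 2 / 2) * Real.log (g ^ 2)) ≤ freeEnergy N n g := by
  have h := Real.log_le_log (mul_pos (pow_pos (linkZ_pos N 64 g) _)
    (pow_pos (massiveZ_pos N m 64 (boundaryEdges m) g) _))
    (le_partitionFunction N (Nat.div_mul_le_self n m) g)
  rw [Real.log_mul (pow_ne_zero _ (linkZ_pos N 64 g).ne')
    (pow_ne_zero _ (massiveZ_pos N m _ _ g).ne'), Real.log_pow, Real.log_pow,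
    card_outerEdges_cast hn] at h
  push_cast at h
  rw [freeEnergy]
  linarith

theorem tendsto_div_div (hm : 1 ≤ m) :
    Tendsto (fun n : ℕ => ((n / m : ℕ) : ℝ) ^ 4 / (n : ℝ) ^ 4) atTop (𝓝 (((m : ℝ) ^ 4)⁻¹)) := by
  have h := (tendsto_nat_floor_mul_div_atTop (R := ℝ) (a := (m : ℝ)⁻¹) (by positivity)).comp
    tendsto_natCast_atTop_atTop
  have h2 := h.pow 4
  rw [inv_pow] at h2
  refine h2.congr fun n => ?_
  simp only [Function.comp_apply]
  rw [inv_mul_eq_div, Nat.floor_div_eq_div, div_pow]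

theorem tendsto_card_freeEdges_div :
    Tendsto (fun n : ℕ => ((freeEdges 4 n).card : ℝ) / (n : ℝ) ^ 4) atTop (𝓝 3) := by
  have hinv : Tendsto (fun n : ℕ => ((n : ℝ))⁻¹) atTop (𝓝 0) := tendsto_inv_atTop_nhds_zero_nat
  have h : Tendsto (fun n : ℕ => 3 - 4 * ((n : ℝ))⁻¹ + ((n : ℝ))⁻¹ ^ 4) atTop
      (𝓝 (3 - 4 * 0 + 0 ^ 4)) := ((hinv.const_mul 4).const_sub 3).add (hinv.pow 4)
  norm_num at h
  refine h.congr' ?_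
  filter_upwards [eventually_ge_atTop 1] with n hn
  have hn0 : (n : ℝ) ≠ 0 := by
    have : n ≠ 0 := by omega
    exact_mod_cast this
  rw [card_freeEdges hn]
  field_simp

/-- The error made by cutting a box into blocks of side `m`. -/
def blockError (m : ℕ) : ℝ :=
  ((3 - (freeEdges 4 m).card / (m : ℝ) ^ 4) * Real.log 64 +
    32 * (m : ℝ) ^ 3 * Real.log (1 + 64 * (64 * (m : ℝ) ^ 6)) / (m : ℝ) ^ 4) / 2

theorem tendsto_blockError : Tendsto blockError atTop (𝓝 0) := by
  have h1 : Tendsto (fun m : ℕ => (3 - ((freeEdges 4 m).card : ℝ) / (m : ℝ) ^ 4) * Real.log 64) atTop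
      (𝓝 ((3 - 3) * Real.log 64)) := (tendsto_card_freeEdges_div.const_sub 3).mul_const _
  have hlog : Tendsto (fun m : ℕ => Real.log m / (m : ℝ)) atTop (𝓝 0) :=
    (Real.isLittleO_log_id_atTop.tendsto_div_nhds_zero).comp tendsto_natCast_atTop_atTop
  have hinv : Tendsto (fun n : ℕ => ((n : ℝ))⁻¹) atTop (𝓝 0) := tendsto_inv_atTop_nhds_zero_nat
  -- Here 4097 = 1 + 64 · 64: for m ≥ 1 the argument of the logarithm is at most 4097 m⁶.
  have h2 : Tendsto (fun m : ℕ => 32 * (Real.log 4097 * ((m : ℝ))⁻¹ + 6 * (Real.log m / m))) atTop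
      (𝓝 (32 * (Real.log 4097 * 0 + 6 * 0))) :=
    ((hinv.const_mul _).add (hlog.const_mul 6)).const_mul 32
  have h3 : Tendsto (fun m : ℕ => 32 * (m : ℝ) ^ 3 * Real.log (1 + 64 * (64 * (m : ℝ) ^ 6)) /
      (m : ℝ) ^ 4) atTop (𝓝 0) := by
    simp only [mul_zero, add_zero] at h2
    refine tendsto_of_tendsto_of_tendsto_of_le_of_le' tendsto_const_nhds h2 ?_ ?_
    · refine Eventually.of_forall fun m => ?_
      have : 0 ≤ Real.log (1 + 64 * (64 * (m : ℝ) ^ 6)) :=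
        Real.log_nonneg (le_add_of_nonneg_right (by positivity))
      positivity
    · filter_upwards [eventually_ge_atTop 1] with m hm
      have hm1 : (1 : ℝ) ≤ m := by exact_mod_cast hm
      have hm0 : (0 : ℝ) < m := by linarith
      have h4 : Real.log (1 + 64 * (64 * (m : ℝ) ^ 6)) ≤ Real.log 4097 + 6 * Real.log m := by
        have h5 : (1 : ℝ) ≤ (m : ℝ) ^ 6 := one_le_pow₀ hm1
        refine (Real.log_le_log (by positivity)
          (show 1 + 64 * (64 * (m : ℝ) ^ 6) ≤ 4097 * (m : ℝ) ^ 6 by linarith)).trans ?_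
        rw [Real.log_mul (by norm_num) (by positivity), Real.log_pow]
        push_cast
        exact le_rfl
      have h6 : 32 * (m : ℝ) ^ 3 * Real.log (1 + 64 * (64 * (m : ℝ) ^ 6)) / (m : ℝ) ^ 4 =
          32 * (Real.log (1 + 64 * (64 * (m : ℝ) ^ 6)) / m) := by
        field_simp
      rw [h6]
      refine mul_le_mul_of_nonneg_left ?_ (by norm_num)
      rw [div_le_iff₀ hm0]
      calc _ ≤ _ := h4
        _ = _ := by field_simp
  have h := (h1.add h3).div_const 2
  simp only [sub_self, zero_mul, add_zero, zero_div] at h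
  exact h

theorem blockError_nonneg (hm : 1 ≤ m) : 0 ≤ blockError m := by
  have hm1 : (1 : ℝ) ≤ m := by exact_mod_cast hm
  have h1 : ((freeEdges 4 m).card : ℝ) / (m : ℝ) ^ 4 ≤ 3 := by
    rw [div_le_iff₀ (by positivity), card_freeEdges hm]
    have : (1 : ℝ) ≤ (m : ℝ) ^ 3 := one_le_pow₀ hm1
    linarith
  have h2 : 0 ≤ Real.log (1 + 64 * (64 * (m : ℝ) ^ 6)) :=
    Real.log_nonneg (le_add_of_nonneg_right (by positivity))
  have h3 : 0 ≤ Real.log 64 := Real.log_nonneg (by norm_num)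
  have h4 : 0 ≤ (3 - ((freeEdges 4 m).card : ℝ) / (m : ℝ) ^ 4) * Real.log 64 :=
    mul_nonneg (by linarith) h3
  rw [blockError]
  positivity

/-- In both bounds n enters only through two convergent ratios and g only through partition
functions of fixed size. The two limits therefore decouple, and the estimate holds on the product
filter. -/
theorem eventually_freeEnergy_close (N : ℕ) (hm : 1 ≤ m) {δ : ℝ} (hδ : 0 < δ) :
    ∀ᶠ x : ℕ × ℝ in atTop ×ˢ 𝓝[>] 0, |freeEnergy N x.1 x.2 / (x.1 : ℝ) ^ 4 -
      (3 * linkConst N + (N : ℝ) ^ 2 * maxwellConst 4 m)| ≤ (N : ℝ) ^ 2 * blockError m + δ := by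
  have hm1 : (1 : ℝ) ≤ m := by exact_mod_cast hm
  have hm4 : (m : ℝ) ^ 4 ≠ 0 := by positivity
  set a : ℝ := ((freeEdges 4 m).card : ℝ) with ha
  set l : Filter (ℕ × ℝ) := atTop ×ˢ 𝓝[>] 0 with hl
  have hfst : Tendsto Prod.fst l atTop := tendsto_fst
  have hsnd : Tendsto Prod.snd l (𝓝[>] 0) := tendsto_snd
  have hq := (tendsto_div_div hm).comp hfst
  have hr : Tendsto (fun x : ℕ × ℝ => ((freeEdges 4 x.1).card : ℝ) / (x.1 : ℝ) ^ 4 -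
      ((x.1 / m : ℕ) : ℝ) ^ 4 / (x.1 : ℝ) ^ 4 * a) l (𝓝 (3 - ((m : ℝ) ^ 4)⁻¹ * a)) :=
    (tendsto_card_freeEdges_div.comp hfst).sub (hq.mul_const a)
  have hup := (hr.mul ((tendsto_log_linkZ N one_pos).comp hsnd)).add
    (hq.mul ((tendsto_freeEnergy N hm).comp hsnd))
  have hlo := (hr.mul ((tendsto_log_linkZ N (show (0 : ℝ) < 64 by norm_num)).comp hsnd)).add
    (hq.mul ((tendsto_log_massiveZ N hm (show (0 : ℝ) ≤ 64 by norm_num) (boundaryEdges m)).comp hsnd))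
  -- The upper bound has no block error in the limit: its outer links carry mass 1, and log 1 = 0.
  have hupl : (3 - ((m : ℝ) ^ 4)⁻¹ * a) * (linkConst N - (N : ℝ) ^ 2 / 2 * Real.log 1) +
      ((m : ℝ) ^ 4)⁻¹ * (a * linkConst N + (N : ℝ) ^ 2 * ((m : ℝ) ^ 4 * maxwellConst 4 m)) =
      3 * linkConst N + (N : ℝ) ^ 2 * maxwellConst 4 m := by
    rw [Real.log_one]
    field_simp
    ring
  rw [hupl] at hup
  have hlol : 3 * linkConst N + (N : ℝ) ^ 2 * maxwellConst 4 m - (N : ℝ) ^ 2 * blockError m ≤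
      (3 - ((m : ℝ) ^ 4)⁻¹ * a) * (linkConst N - (N : ℝ) ^ 2 / 2 * Real.log 64) +
      ((m : ℝ) ^ 4)⁻¹ * (a * linkConst N -
        (N : ℝ) ^ 2 / 2 * Real.log (massiveMatrix m 64 (boundaryEdges m)).det) := by
    have h1 := log_det_massiveMatrix_le hm (show (0 : ℝ) ≤ 64 by norm_num) (boundaryEdges m)
    rw [log_det_massiveMatrix_empty] at h1
    have h2 : ((boundaryEdges m).card : ℝ) ≤ 32 * (m : ℝ) ^ 3 := by
      exact_mod_cast card_boundaryEdges_le m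
    have h3 : 0 ≤ Real.log (1 + 64 * (64 * (m : ℝ) ^ 6)) :=
      Real.log_nonneg (le_add_of_nonneg_right (by positivity))
    have h4 := h1.trans (add_le_add_right (mul_le_mul_of_nonneg_right h2 h3) _)
    have h5 : 0 ≤ ((m : ℝ) ^ 4)⁻¹ * ((N : ℝ) ^ 2 / 2) := by positivity
    have h6 := mul_le_mul_of_nonneg_left h4 h5
    have h7 : (N : ℝ) ^ 2 * maxwellConst 4 m =
        -(((m : ℝ) ^ 4)⁻¹ * ((N : ℝ) ^ 2 / 2) * Real.log (maxwellForm0 4 m).toMatrix'.det) := by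
      rw [maxwellConst]
      field_simp
    have h8 : (N : ℝ) ^ 2 * blockError m = (3 - ((m : ℝ) ^ 4)⁻¹ * a) * ((N : ℝ) ^ 2 / 2 * Real.log 64) +
        ((m : ℝ) ^ 4)⁻¹ * ((N : ℝ) ^ 2 / 2) *
          (32 * (m : ℝ) ^ 3 * Real.log (1 + 64 * (64 * (m : ℝ) ^ 6))) := by
      rw [blockError, ← ha, div_eq_inv_mul a, div_eq_mul_inv _ ((m : ℝ) ^ 4)]
      ring
    rw [h7, h8]
    linarith
  have hn : ∀ᶠ x : ℕ × ℝ in l, 1 ≤ x.1 := hfst.eventually (eventually_ge_atTop 1)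
  filter_upwards [hup.eventually (gt_mem_nhds (lt_add_of_pos_right _ hδ)),
    hlo.eventually (lt_mem_nhds (sub_lt_self _ hδ)), hn] with x h1 h2 hx
  have hx4 : (0 : ℝ) < (x.1 : ℝ) ^ 4 := by
    have : (0 : ℝ) < x.1 := by exact_mod_cast hx
    positivity
  simp only [Function.comp_apply] at h1 h2
  have h3 := div_le_div_of_nonneg_right (freeEnergy_le N hm hx x.2) hx4.le
  have h4 := div_le_div_of_nonneg_right (le_freeEnergy (m := m) N hx x.2) hx4.le
  have hsplit : ∀ A B C D E : ℝ, ((A - B * C) * D + B * E) / (x.1 : ℝ) ^ 4 =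
      (A / (x.1 : ℝ) ^ 4 - B / (x.1 : ℝ) ^ 4 * C) * D + B / (x.1 : ℝ) ^ 4 * E := by
    intro A B C D E
    field_simp
  rw [hsplit] at h3 h4
  have h5 : 0 ≤ (N : ℝ) ^ 2 * blockError m := mul_nonneg (sq_nonneg _) (blockError_nonneg hm)
  rw [abs_le]
  constructor <;> linarith

/-- The Maxwell constants do not involve N, so the case N = 1 is enough. For fixed large n, letting
g tend to 0 in the joint estimate turns the free energy into the constant of side n. -/
theorem eventually_maxwellConst_close (hm : 1 ≤ m) {δ : ℝ} (hδ : 0 < δ) :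
    ∀ᶠ n : ℕ in atTop, |maxwellConst 4 n - maxwellConst 4 m| ≤ blockError m + δ := by
  have h1 := (eventually_freeEnergy_close 1 hm (half_pos hδ)).curry
  have h2 : Tendsto (fun n : ℕ => (((freeEdges 4 n).card : ℝ) / (n : ℝ) ^ 4 - 3) * linkConst 1) atTop
      (𝓝 ((3 - 3) * linkConst 1)) := (tendsto_card_freeEdges_div.sub_const 3).mul_const _
  rw [sub_self, zero_mul] at h2
  have h3 := h2.abs
  rw [abs_zero] at h3
  filter_upwards [h1, h3.eventually (gt_mem_nhds (half_pos hδ)), eventually_ge_atTop 1] with n hn hn2 hn1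
  have hn0 : (n : ℝ) ≠ 0 := by
    have : n ≠ 0 := by omega
    exact_mod_cast this
  have hlim := (((tendsto_freeEnergy 1 hn1).div_const ((n : ℝ) ^ 4)).sub_const
    (3 * linkConst 1 + ((1 : ℕ) : ℝ) ^ 2 * maxwellConst 4 m)).abs
  have h4 := le_of_tendsto hlim hn
  have h5 : ((freeEdges 4 n).card * linkConst 1 +
      ((1 : ℕ) : ℝ) ^ 2 * ((n : ℝ) ^ 4 * maxwellConst 4 n)) / (n : ℝ) ^ 4 -
      (3 * linkConst 1 + ((1 : ℕ) : ℝ) ^ 2 * maxwellConst 4 m) =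
      (((freeEdges 4 n).card : ℝ) / (n : ℝ) ^ 4 - 3) * linkConst 1 +
        (maxwellConst 4 n - maxwellConst 4 m) := by
    push_cast
    field_simp
    ring
  rw [h5] at h4
  push_cast at h4
  rw [abs_le] at h4 ⊢
  rw [abs_lt] at hn2
  constructor <;> linarith

theorem exists_tendsto_maxwellConst : ∃ K : ℝ, Tendsto (maxwellConst 4) atTop (𝓝 K) := by
  refine cauchySeq_tendsto_of_complete (Metric.cauchySeq_iff'.2 fun ε hε => ?_)
  obtain ⟨m, hm1, hm⟩ := ((eventually_ge_atTop 1).and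
    (tendsto_blockError.eventually (gt_mem_nhds (show (0 : ℝ) < ε / 8 by positivity)))).exists
  obtain ⟨n₀, hn₀⟩ := eventually_atTop.1
    (eventually_maxwellConst_close hm1 (show (0 : ℝ) < ε / 8 by positivity))
  refine ⟨n₀, fun n hn => ?_⟩
  have h1 := abs_le.1 (hn₀ n hn)
  have h2 := abs_le.1 (hn₀ n₀ le_rfl)
  rw [Real.dist_eq, abs_lt]
  constructor <;> linarith

theorem eventually_freeEnergy_limit (N : ℕ) {K : ℝ} (hK : Tendsto (maxwellConst 4) atTop (𝓝 K))
    {δ : ℝ} (hδ : 0 < δ) : ∀ᶠ x : ℕ × ℝ in atTop ×ˢ 𝓝[>] 0,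
      |freeEnergy N x.1 x.2 / (x.1 : ℝ) ^ 4 - (3 * linkConst N + (N : ℝ) ^ 2 * K)| ≤ δ := by
  have h1 : Tendsto (fun m => (N : ℝ) ^ 2 * blockError m) atTop (𝓝 ((N : ℝ) ^ 2 * 0)) :=
    tendsto_blockError.const_mul _
  have h2 : Tendsto (fun m => (N : ℝ) ^ 2 * maxwellConst 4 m) atTop (𝓝 ((N : ℝ) ^ 2 * K)) :=
    hK.const_mul _
  rw [mul_zero] at h1
  have hδ3 : 0 < δ / 3 := by positivity
  obtain ⟨m, hm1, hm, hmK⟩ := ((eventually_ge_atTop 1).and ((h1.eventually (gt_mem_nhds hδ3)).and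
    (h2.eventually (Metric.ball_mem_nhds _ hδ3)))).exists
  filter_upwards [eventually_freeEnergy_close N hm1 hδ3] with x hx
  rw [Real.dist_eq, abs_lt] at hmK
  rw [abs_le] at hx ⊢
  constructor <;> linarith

end Limit

end LatticeGauge

end

theorem theorem2p3 :
    ∃ K₄ : ℝ, Tendsto (fun n : ℕ => LatticeGauge.maxwellConst 4 n) atTop (𝓝 K₄) ∧
      ∀ N : ℕ, 1 ≤ N →
        (fun q : ℕ × ℝ × ℝ =>
            Real.log (LatticeGauge.scaledPartitionFunction 4 N q.1 q.2.1 q.2.2) -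
              (q.1 : ℝ) ^ 4 *
                ((3 / 2 - 2 / (q.1 : ℝ) + 1 / (2 * (q.1 : ℝ) ^ 4)) * (N : ℝ) ^ 2 *
                    Real.log (q.2.2 ^ 2) +
                  3 * Real.log ((∏ j ∈ Finset.Ico 1 N, (Nat.factorial j : ℝ)) /
                    (2 * Real.pi) ^ ((N : ℝ) / 2)) +
                  (N : ℝ) ^ 2 * K₄))
          =o[atTop ×ˢ (𝓝[>] (0 : ℝ) ×ˢ 𝓝[>] (0 : ℝ))] fun q : ℕ × ℝ × ℝ => (q.1 : ℝ) ^ 4 := by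
  obtain ⟨K, hK⟩ := LatticeGauge.exists_tendsto_maxwellConst
  refine ⟨K, hK, fun N _ => isLittleO_iff.2 fun δ hδ => ?_⟩
  have hmap : Tendsto (fun q : ℕ × ℝ × ℝ => (q.1, q.2.2))
      (atTop ×ˢ (𝓝[>] (0 : ℝ) ×ˢ 𝓝[>] (0 : ℝ))) (atTop ×ˢ 𝓝[>] (0 : ℝ)) :=
    tendsto_fst.prodMk (tendsto_snd.comp tendsto_snd)
  filter_upwards [hmap.eventually (LatticeGauge.eventually_freeEnergy_limit N hK hδ),
    tendsto_fst.eventually (eventually_ge_atTop 1)] with q hq hn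
  obtain ⟨n, ε, g⟩ := q
  simp only at hq hn ⊢
  have hn0 : (0 : ℝ) < n := by exact_mod_cast hn
  -- The exponent 4 - d vanishes, so ε disappears.
  have hscaled : LatticeGauge.scaledPartitionFunction 4 N n ε g =
      LatticeGauge.partitionFunction N (LatticeGauge.box 4 n) (g ^ 2) := by
    simp [LatticeGauge.scaledPartitionFunction]
  have hmain : Real.log (LatticeGauge.scaledPartitionFunction 4 N n ε g) -
      (n : ℝ) ^ 4 * ((3 / 2 - 2 / (n : ℝ) + 1 / (2 * (n : ℝ) ^ 4)) * (N : ℝ) ^ 2 *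
        Real.log (g ^ 2) + 3 * Real.log ((∏ j ∈ Finset.Ico 1 N, (Nat.factorial j : ℝ)) /
          (2 * Real.pi) ^ ((N : ℝ) / 2)) + (N : ℝ) ^ 2 * K) =
      (LatticeGauge.freeEnergy N n g / (n : ℝ) ^ 4 -
        (3 * LatticeGauge.linkConst N + (N : ℝ) ^ 2 * K)) * (n : ℝ) ^ 4 := by
    rw [hscaled, LatticeGauge.freeEnergy, LatticeGauge.card_freeEdges hn, LatticeGauge.linkConst]
    field_simp
    ring
  rw [hmain, norm_mul, Real.norm_eq_abs]
  exact mul_le_mul_of_nonneg_right hq (norm_nonneg _)
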